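/- **Setting.** Let $\mathcal G$ be a finite-dimensional semisimple Hopf algebra over $\mathbb C$ with coproduct $\Delta$, counit $\epsilon$, antipode $\mathcal S$, and a conjugate-linear involution $*$. Write $P$ for the flip and $X'=PXP$, $\Delta'=P\Delta P$; tensor products carry the factorwise $*$. Let $R\in\mathcal G\otimes\mathcal G$ be invertible with $R\Delta(\xi)=\Delta'(\xi)R$, $(\mathrm{id}\otimes\Delta)(R)=R_{13}R_{12}$, $(\Delta\otimes \mathrm{id})(R)=R_{13}R_{23}$, and let $v\in\mathcal G$ be an invertible central element with $R'R=(v\otimes v)\Delta(v^{-1})$, $\mathcal S(v)=v$, $\epsilon(v)=1$. Assume $R^*=(R^{-1})'$, $\Delta(\xi)^*=\Delta'(\xi^*)$, $v^*=v^{-1}$, and fix a central $\kappa$ with $\kappa^2=v$. Let $\tau^I:\mathcal G\to\mathrm{End}(V^I)$ be irreducible $*$-representations on finite-dimensional Hilbert spaces, exactly one from each equivalence class of irreducible representations, and assume that $\mathcal G$ is modular: the matrix $\big((\mathrm{tr}^I_q\otimes \mathrm{tr}^J_q)(\tau^I\otimes\tau^J)(R'R)\big)_{IJ}$ is invertible,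 where $\mathrm{tr}_q^I(X)=\mathrm{tr}(X\tau^I(w))$ and $w^{-1}=v^{-1}\sum \mathcal S(r^2)r^1$ for $R=\sum r^1\otimes r^2$. Let $\mathcal M=\bigoplus_I V^I$ (orthogonal direct sum), $\mathcal V=\mathrm{End}(\mathcal M)$, and regard $\mathcal G$ as a subalgebra of $\mathcal V$ by its diagonal action. Let $\mathcal C$ be the center of $\mathcal G$, and let $\mathcal G_a$ be another copy of $\mathcal G$. Put $R_+=R$, $R_-=(R')^{-1}$, $N_\pm=R_\pm\in\mathcal G_a\otimes\mathcal G$, $N=N_+N_-^{-1}$, $S=R_+\Delta(\kappa)(\kappa\otimes\kappa)^{-1}$. Superscripts and subscripts $1,2,3$ indicate positions of tensor factors $\mathcal G_a$, and $\Delta_a=\Delta\otimes\mathrm{id}$ acts on a factor $\mathcal G_a$. A *vertex operator* for $\mathcal G$ is an invertible $\Phi\in\mathcal G_a\otimes\mathcal V$ with $\xi\Phi=\Phi\Delta'(\xi)$ for all $\xi\in\mathcal G$ and $\Phi^*=S^{-1}\Phi^{-1}=\kappa_a\kappa N_+^{-1}\Phi^{-1}\kappa^{-1}$, where $\kappa_a=\kappa\otimes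 1$ and $\xi=1\otimes \xi$. **Hypotheses.** Let $F\in\mathcal G_a\otimes\mathcal G_a\otimes\mathcal C$ be invertible and let $\sigma:\mathcal C\to\mathcal G_a\otimes\mathcal C$ be a homomorphism of unital algebras. Put $D=(v\otimes 1)(1\otimes v^{-1})\sigma(v)$, $\mathcal R_\pm=F'R_\pm F^{-1}$ (where $F'$ is $F$ with its first two factors exchanged) and $\Delta_F(\cdot)=F\,\Delta_a(\cdot)\,F^{-1}$, and let $\overset{i}{\sigma}$ be $\sigma$ applied to the factor $\mathcal C$ with the new factor $\mathcal G_a$ put in position $i$. Suppose that, for all $f\in\mathcal C$ and $\xi\in\mathcal G$, $$(e\otimes F)\,(\mathrm{id}\otimes\Delta_a)(F)=\overset{3}{\sigma}(F)\,(\Delta_a\otimes \mathrm{id})(F),\qquad \overset{2}{\sigma}\overset{1}{\sigma}(f)=\Delta_F(\sigma(f)),$$ $$\overset{1}{D}\mathcal R_-=\mathcal R_+\overset{2}{\sigma}(D),\qquad \mathcal R_-\overset{2}{D}=\overset{1}{\sigma}(D)\mathcal R_+,$$ $$\mathcal R_{\pm,12}\,\overset{2}{\sigma}(\mathcal R_{\pm,13})\,\mathcal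 R_{\pm,23}=\overset{1}{\sigma}(\mathcal R_{\pm,23})\,\mathcal R_{\pm,13}\,\overset{3}{\sigma}(\mathcal R_{\pm,12}),$$ $$F^*=(S\otimes 1)F^{-1},\quad \mathcal R_\pm^*=\mathcal R_\pm^{-1},\quad D^*=D^{-1},\quad \sigma(f)^*=\sigma(f^*),\quad \Delta_F(\xi)^*=\Delta_F(\xi^*).$$ **Conclusion.** There are a vertex operator $\Phi\in\mathcal G_a\otimes\mathcal V$ for $\mathcal G$ and an injective $*$-homomorphism $j:\mathcal C\to\mathcal V$ whose image is the center of $\mathcal G\subset\mathcal V$ and which satisfies $j(v)=v$, such that, when $\mathcal C$ is regarded as a subalgebra of $\mathcal V$ by means of $j$, $$\overset{2}{\Phi}\,\overset{1}{\Phi}=F\,\Delta_a(\Phi),\qquad \Phi f=\sigma(f)\Phi\quad(f\in\mathcal C),\qquad \Phi N\Phi^{-1}=D .$$ Moreover $\mathcal V=\mathrm{End}(\bigoplus_I V^I)$ is the associative unital algebra generated by $\mathcal C$ and the components $(\pi\otimes\mathrm{id})(\Phi)$, $\pi\in\mathcal G_a'$, of an invertible element $\Phi$ subject to the first two of these relations: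 it is generated by these elements, and for every unital algebra $B$ with a homomorphism $j_B:\mathcal C\to B$ and an invertible $\Phi_B\in\mathcal G_a\otimes B$ satisfying the first two relations there is a unique algebra homomorphism $\psi:\mathcal V\to B$ with $\psi\circ j=j_B$ and $(\mathrm{id}\otimes\psi)(\Phi)=\Phi_B$. -/

import Mathlib

open scoped TensorProduct

universe u₁ u₂ u₃ u₄

noncomputable section

namespace VertexOp

universe u w

/-! ### Tensor legs

`G` plays the role of both `𝒢` and its auxiliary copy `𝒢_a`.  Triple tensor products are bracketed
to the right: `𝒢_a ⊗ 𝒢_a ⊗ X` is `G ⊗ (G ⊗ X)`. -/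

section Legs

variable {G : Type*} [Ring G] [HopfAlgebra ℂ G]
variable {X : Type*} [Ring X] [Algebra ℂ X]

/-- `g ⊗ x ↦ g ⊗ e ⊗ x`. -/
def leg1 : G ⊗[ℂ] X →ₐ[ℂ] G ⊗[ℂ] (G ⊗[ℂ] X) :=
  Algebra.TensorProduct.map (AlgHom.id ℂ G) Algebra.TensorProduct.includeRight

/-- `g ⊗ x ↦ e ⊗ g ⊗ x`. -/
def leg2 : G ⊗[ℂ] X →ₐ[ℂ] G ⊗[ℂ] (G ⊗[ℂ] X) :=
  Algebra.TensorProduct.includeRight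

/-- `g ⊗ h ↦ g ⊗ h ⊗ e`, with `e` the unit of `X`. -/
def leg12 : G ⊗[ℂ] G →ₐ[ℂ] G ⊗[ℂ] (G ⊗[ℂ] X) :=
  Algebra.TensorProduct.map (AlgHom.id ℂ G) Algebra.TensorProduct.includeLeft

/-- The permutation of the first two factors, `g ⊗ h ⊗ x ↦ h ⊗ g ⊗ x`; on `𝒢_a ⊗ 𝒢_a ⊗ 𝒞` this is
`F ↦ F'`. -/
def swap12 : G ⊗[ℂ] (G ⊗[ℂ] X) →ₐ[ℂ] G ⊗[ℂ] (G ⊗[ℂ] X) :=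
  (Algebra.TensorProduct.leftComm ℂ G G X : G ⊗[ℂ] (G ⊗[ℂ] X) →ₐ[ℂ] G ⊗[ℂ] (G ⊗[ℂ] X))

/-- The permutation of the two factors, `ξ ⊗ η ↦ η ⊗ ξ`. -/
def flip : G ⊗[ℂ] G →ₐ[ℂ] G ⊗[ℂ] G :=
  (Algebra.TensorProduct.comm ℂ G G : G ⊗[ℂ] G →ₐ[ℂ] G ⊗[ℂ] G)

/-- `Δ_a = Δ ⊗ id`, the coproduct acting on the first factor. -/
def comulFirst : G ⊗[ℂ] X →ₐ[ℂ] G ⊗[ℂ] (G ⊗[ℂ] X) :=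
  (Algebra.TensorProduct.assoc ℂ ℂ ℂ G G X : (G ⊗[ℂ] G) ⊗[ℂ] X →ₐ[ℂ] G ⊗[ℂ] (G ⊗[ℂ] X)).comp
    (Algebra.TensorProduct.map (Bialgebra.comulAlgHom ℂ G) (AlgHom.id ℂ X))

/-- `id ⊗ f`. -/
def mapSnd {Y Z : Type*} [Ring Y] [Algebra ℂ Y] [Ring Z] [Algebra ℂ Z] (f : Y →ₐ[ℂ] Z) :
    G ⊗[ℂ] Y →ₐ[ℂ] G ⊗[ℂ] Z :=
  Algebra.TensorProduct.map (AlgHom.id ℂ G) f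

/-- The `π`-component `(π ⊗ id)(Φ) ∈ X` of `Φ ∈ G ⊗ X`, for a linear form `π` on `G`. -/
def component (π : Module.Dual ℂ G) : G ⊗[ℂ] X →ₗ[ℂ] X :=
  (TensorProduct.lid ℂ X).toLinearMap.comp (TensorProduct.map π LinearMap.id)

end Legs

/-! ### Ribbon Hopf `*`-algebras, their irreducible representations, modularity -/

section Hopf

variable (G : Type u) [Ring G] [HopfAlgebra ℂ G] [StarRing G] [StarModule ℂ G]

/-- A quasi-triangular ribbon structure compatible with the `*`-operation, with a chosen central
square root `κ` of the ribbon element.  The star on `G ⊗ G` is `(ξ ⊗ η)* = ξ* ⊗ η*`. -/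
structure RibbonStructure where
  R : (G ⊗[ℂ] G)ˣ
  v : Gˣ
  κ : Gˣ
  R_comul (ξ : G) : (R : G ⊗[ℂ] G) * Coalgebra.comul (R := ℂ) ξ =
    flip (Coalgebra.comul (R := ℂ) ξ) * (R : G ⊗[ℂ] G)
  /-- `(id ⊗ Δ)(R) = R₁₃ R₁₂` -/
  id_comul_R : mapSnd (Bialgebra.comulAlgHom ℂ G) (R : G ⊗[ℂ] G) =
    (leg1 (R : G ⊗[ℂ] G)) * (leg12 (R : G ⊗[ℂ] G))
  /-- `(Δ ⊗ id)(R) = R₁₃ R₂₃` -/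
  comul_id_R : comulFirst (R : G ⊗[ℂ] G) = (leg1 (R : G ⊗[ℂ] G)) * (leg2 (R : G ⊗[ℂ] G))
  v_central : (v : G) ∈ Subalgebra.center ℂ G
  /-- `R'R = (v ⊗ v) Δ(v⁻¹)` -/
  ribbon : flip (R : G ⊗[ℂ] G) * (R : G ⊗[ℂ] G) =
    ((v : G) ⊗ₜ[ℂ] (v : G)) * Coalgebra.comul (R := ℂ) ((v⁻¹ : Gˣ) : G)
  antipode_v : HopfAlgebra.antipode ℂ (v : G) = (v : G)
  counit_v : Coalgebra.counit (R := ℂ) (v : G) = 1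
  /-- `R* = (R⁻¹)'` -/
  star_R : star (R : G ⊗[ℂ] G) = flip ((R⁻¹ : (G ⊗[ℂ] G)ˣ) : G ⊗[ℂ] G)
  /-- `Δ(ξ)* = Δ'(ξ*)` -/
  star_comul (ξ : G) : star (Coalgebra.comul (R := ℂ) ξ) =
    flip (Coalgebra.comul (R := ℂ) (star ξ))
  star_v : star (v : G) = ((v⁻¹ : Gˣ) : G)
  κ_central : (κ : G) ∈ Subalgebra.center ℂ G
  κ_sq : (κ : G) ^ 2 = (v : G)

/-- The center `𝒞` of `G`, as a `*`-algebra. -/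
def Center : StarSubalgebra ℂ G where
  toSubalgebra := Subalgebra.center ℂ G
  star_mem' := fun ha => Set.star_mem_center ha

variable {G}

namespace RibbonStructure

variable (𝓡 : RibbonStructure G)

/-- The ribbon element as an element of `𝒞`. -/
def vC : (Center G)ˣ where
  val := ⟨(𝓡.v : G), 𝓡.v_central⟩
  inv := ⟨((𝓡.v⁻¹ : Gˣ) : G), by
    refine Subalgebra.mem_center_iff.2 fun b => ?_
    have h := Subalgebra.mem_center_iff.1 𝓡.v_central b
    have h' : Commute b (𝓡.v : G) := h
    exact h'.units_inv_right⟩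
  val_inv := Subtype.ext 𝓡.v.mul_inv
  inv_val := Subtype.ext 𝓡.v.inv_mul

/-- `R₊ = R`. -/
def Rplus : (G ⊗[ℂ] G)ˣ := 𝓡.R

/-- `R₋ = (R')⁻¹`. -/
def Rminus : (G ⊗[ℂ] G)ˣ := (Units.map (flip (G := G) : G ⊗[ℂ] G →* G ⊗[ℂ] G) 𝓡.R)⁻¹

/-- `N = N₊ N₋⁻¹`, where `N_± = R_±`. -/
def N : (G ⊗[ℂ] G)ˣ := 𝓡.Rplus * 𝓡.Rminus⁻¹

/-- `κ ⊗ κ`. -/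
def κκ : (G ⊗[ℂ] G)ˣ :=
  Units.map (Algebra.TensorProduct.includeLeft : G →ₐ[ℂ] G ⊗[ℂ] G).toMonoidHom 𝓡.κ *
    Units.map (Algebra.TensorProduct.includeRight : G →ₐ[ℂ] G ⊗[ℂ] G).toMonoidHom 𝓡.κ

/-- `S = R₊ Δ(κ) (κ ⊗ κ)⁻¹`. -/
def S : (G ⊗[ℂ] G)ˣ :=
  𝓡.Rplus * Units.map (Bialgebra.comulAlgHom ℂ G).toMonoidHom 𝓡.κ * 𝓡.κκ⁻¹

/-- The element `w`, determined by `w⁻¹ = v⁻¹ ∑ 𝒮(r²) r¹` for `R = ∑ r¹ ⊗ r²`. -/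
def wElt : G :=
  Ring.inverse (((𝓡.v⁻¹ : Gˣ) : G) *
    LinearMap.mul' ℂ G (TensorProduct.map (HopfAlgebra.antipode ℂ) LinearMap.id
      (flip (𝓡.R : G ⊗[ℂ] G))))

end RibbonStructure

section Irreps

variable {I : Type*} [Fintype I] {V : I → Type*} [∀ i, NormedAddCommGroup (V i)]
  [∀ i, InnerProductSpace ℂ (V i)] [∀ i, FiniteDimensional ℂ (V i)] [∀ i, CompleteSpace (V i)]

/-- The `τ i` are irreducible `*`-representations on Hilbert spaces, exactly one from each
equivalence class of irreducible representations of `G`. -/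
structure IsIrrepSystem (τ : ∀ i, G →⋆ₐ[ℂ] (V i →L[ℂ] V i)) : Prop where
  nontrivial : ∀ i, Nontrivial (V i)
  irreducible : ∀ i (W : Submodule ℂ (V i)), (∀ ξ : G, ∀ x ∈ W, τ i ξ x ∈ W) → W = ⊥ ∨ W = ⊤
  inequivalent : ∀ i j (e : V i ≃ₗ[ℂ] V j), (∀ ξ x, e (τ i ξ x) = τ j ξ (e x)) → i = j
  complete : ∀ (W : Type u) [AddCommGroup W] [Module G W] [IsSimpleModule G W],
    ∃ (i : I) (e : W ≃+ V i), ∀ (ξ : G) (x : W), e (ξ • x) = τ i ξ (e x)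

/-- The quantum trace `tr_q(X) = tr(X τ(w))`. -/
def qTrace (𝓡 : RibbonStructure G) (τ : ∀ i, G →⋆ₐ[ℂ] (V i →L[ℂ] V i)) (i : I) :
    (V i →L[ℂ] V i) →ₗ[ℂ] ℂ :=
  (LinearMap.trace ℂ (V i)).comp
    ((ContinuousLinearMap.coeLM ℂ).comp (LinearMap.mulRight ℂ (τ i 𝓡.wElt)))

/-- The `S`-matrix `(tr_q ⊗ tr_q)((τ i ⊗ τ j)(R'R))`, with normalization factor `1`; a nonzero
factor does not affect its invertibility. -/
def sMatrix (𝓡 : RibbonStructure G) (τ : ∀ i, G →⋆ₐ[ℂ] (V i →L[ℂ] V i)) : Matrix I I ℂ :=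
  Matrix.of fun i j =>
    LinearMap.mul' ℂ ℂ
      (TensorProduct.map (qTrace 𝓡 τ i) (qTrace 𝓡 τ j)
        (Algebra.TensorProduct.map (τ i).toAlgHom (τ j).toAlgHom
          (flip (𝓡.R : G ⊗[ℂ] G) * (𝓡.R : G ⊗[ℂ] G))))

/-- The model space `ℳ = ⨁ V i`, a Hilbert space direct sum. -/
abbrev ModelSpace (V : I → Type*) [∀ i, NormedAddCommGroup (V i)] : Type _ := PiLp 2 V

/-- The algebra `𝒱 = End(ℳ)`; its star is the Hilbert space adjoint.  As `ℳ` is finite dimensional,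
continuity is no restriction. -/
abbrev ModelEnd (V : I → Type*) [∀ i, NormedAddCommGroup (V i)] [∀ i, InnerProductSpace ℂ (V i)] :
    Type _ := ModelSpace V →L[ℂ] ModelSpace V

/-- The canonical (diagonal) action of `G` on the model space. -/
def modelRep (τ : ∀ i, G →⋆ₐ[ℂ] (V i →L[ℂ] V i)) : G →ₐ[ℂ] ModelEnd V :=
  AlgHom.ofLinearMap
    { toFun := fun ξ => LinearMap.toContinuousLinearMap
        { toFun := fun x => WithLp.toLp 2 fun i => τ i ξ (x i)
          map_add' := fun x y => by ext i; simp
          map_smul' := fun c x => by ext i; simp }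
      map_add' := fun ξ η => by ext x i; simp
      map_smul' := fun c ξ => by ext x i; simp }
    (by ext x i; simp)
    (fun ξ η => by ext x i; simp)

/-- Vertex operators for `G`: invertible `Φ ∈ 𝒢_a ⊗ End(ℳ)`, covariant and unitary in the
generalized sense. -/
structure IsVertexOperator (𝓡 : RibbonStructure G) (τ : ∀ i, G →⋆ₐ[ℂ] (V i →L[ℂ] V i))
    (Φ : (G ⊗[ℂ] ModelEnd V)ˣ) : Prop where
  /-- `ξ Φ = Φ Δ'(ξ)` -/
  covariance : ∀ ξ : G, ((1 : G) ⊗ₜ[ℂ] modelRep τ ξ) * (Φ : G ⊗[ℂ] ModelEnd V) =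
    (Φ : G ⊗[ℂ] ModelEnd V) * mapSnd (modelRep τ) (flip (Coalgebra.comul (R := ℂ) ξ))
  /-- `Φ* = S⁻¹ Φ⁻¹` -/
  star_eq : star (Φ : G ⊗[ℂ] ModelEnd V) =
    mapSnd (modelRep τ) ((𝓡.S⁻¹ : (G ⊗[ℂ] G)ˣ) : G ⊗[ℂ] G) *
      ((Φ⁻¹ : (G ⊗[ℂ] ModelEnd V)ˣ) : G ⊗[ℂ] ModelEnd V)
  /-- `Φ* = κ_a κ N₊⁻¹ Φ⁻¹ κ⁻¹` -/
  star_eq' : star (Φ : G ⊗[ℂ] ModelEnd V) =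
    ((𝓡.κ : G) ⊗ₜ[ℂ] (1 : ModelEnd V)) * ((1 : G) ⊗ₜ[ℂ] modelRep τ (𝓡.κ : G)) *
      mapSnd (modelRep τ) ((𝓡.Rplus⁻¹ : (G ⊗[ℂ] G)ˣ) : G ⊗[ℂ] G) *
      ((Φ⁻¹ : (G ⊗[ℂ] ModelEnd V)ˣ) : G ⊗[ℂ] ModelEnd V) *
      ((1 : G) ⊗ₜ[ℂ] modelRep τ ((𝓡.κ⁻¹ : Gˣ) : G))

end Irreps

/-! ### Structure data -/

section StructureData

variable (𝓡 : RibbonStructure G) (F : (G ⊗[ℂ] (G ⊗[ℂ] Center G))ˣ)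
  (σ : Center G →ₐ[ℂ] G ⊗[ℂ] Center G)

/-- `D = v_a v⁻¹ σ(v)`. -/
def structD : (G ⊗[ℂ] Center G)ˣ :=
  Units.map (Algebra.TensorProduct.includeLeft : G →ₐ[ℂ] G ⊗[ℂ] Center G).toMonoidHom 𝓡.v *
    (Units.map (Algebra.TensorProduct.includeRight : Center G →ₐ[ℂ] G ⊗[ℂ] Center G).toMonoidHom
      𝓡.vC)⁻¹ *
    Units.map σ.toMonoidHom 𝓡.vC

/-- `F' r F⁻¹` for `r ∈ 𝒢_a ⊗ 𝒢_a`. -/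
def twistedR (r : (G ⊗[ℂ] G)ˣ) : (G ⊗[ℂ] (G ⊗[ℂ] Center G))ˣ :=
  Units.map (swap12 (G := G) (X := Center G)).toMonoidHom F *
    Units.map (leg12 (G := G) (X := Center G)).toMonoidHom r * F⁻¹

/-- `ℛ₊ = F' R₊ F⁻¹`. -/
def RRplus : (G ⊗[ℂ] (G ⊗[ℂ] Center G))ˣ := twistedR F 𝓡.Rplus

/-- `ℛ₋ = F' R₋ F⁻¹`. -/
def RRminus : (G ⊗[ℂ] (G ⊗[ℂ] Center G))ˣ := twistedR F 𝓡.Rminus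

/-- `Δ_F(ξ) = F (Δ(ξ) ⊗ e) F⁻¹`. -/
def comulF (ξ : G) : G ⊗[ℂ] (G ⊗[ℂ] Center G) :=
  (F : G ⊗[ℂ] (G ⊗[ℂ] Center G)) * leg12 (Coalgebra.comul (R := ℂ) ξ) *
    ((F⁻¹ : (G ⊗[ℂ] (G ⊗[ℂ] Center G))ˣ) : G ⊗[ℂ] (G ⊗[ℂ] Center G))

/-- `Δ_F` extended to `𝒢_a ⊗ 𝒞`, acting on the first factor: `y ↦ F Δ_a(y) F⁻¹`. -/
def comulFFirst (y : G ⊗[ℂ] Center G) : G ⊗[ℂ] (G ⊗[ℂ] Center G) :=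
  (F : G ⊗[ℂ] (G ⊗[ℂ] Center G)) * comulFirst y *
    ((F⁻¹ : (G ⊗[ℂ] (G ⊗[ℂ] Center G))ˣ) : G ⊗[ℂ] (G ⊗[ℂ] Center G))

/-- The generalized Yang-Baxter equation
`ℛ₁₂ σ²(ℛ₁₃) ℛ₂₃ = σ¹(ℛ₂₃) ℛ₁₃ σ³(ℛ₁₂)` in `𝒢_a ⊗ 𝒢_a ⊗ 𝒢_a ⊗ 𝒞`.  Here `σⁱ` applies `σ` to the
factor `𝒞` and puts the new factor `𝒢_a` into position `i`; for `ℛ = r¹ ⊗ r² ⊗ c` and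
`σ(c) = s ⊗ c'`, the six factors are, in order,
`r¹ ⊗ r² ⊗ e ⊗ c`, `r¹ ⊗ s ⊗ r² ⊗ c'`, `e ⊗ r¹ ⊗ r² ⊗ c`,
`s ⊗ r¹ ⊗ r² ⊗ c'`, `r¹ ⊗ e ⊗ r² ⊗ c`, `r¹ ⊗ r² ⊗ s ⊗ c'`. -/
def DynamicalYangBaxter (ℛ : G ⊗[ℂ] (G ⊗[ℂ] Center G)) : Prop :=
  mapSnd leg1 ℛ * mapSnd swap12 (mapSnd (mapSnd σ) ℛ) * leg2 (X := G ⊗[ℂ] Center G) ℛ =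
    swap12 (X := G ⊗[ℂ] Center G) (mapSnd swap12 (mapSnd (mapSnd σ) ℛ)) *
      leg1 (X := G ⊗[ℂ] Center G) ℛ * mapSnd (mapSnd σ) ℛ

/-- The relations imposed on `F`, `σ`, with `D`, `ℛ_±` defined from them. -/
structure StructureRelations : Prop where
  /-- `(e ⊗ F) (id ⊗ Δ_a)(F) = σ³(F) (Δ_a ⊗ id)(F)` -/
  cocycle : leg2 (X := G ⊗[ℂ] Center G) (F : G ⊗[ℂ] (G ⊗[ℂ] Center G)) *
      mapSnd comulFirst (F : G ⊗[ℂ] (G ⊗[ℂ] Center G)) =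
    mapSnd (mapSnd σ) (F : G ⊗[ℂ] (G ⊗[ℂ] Center G)) *
      comulFirst (X := G ⊗[ℂ] Center G) (F : G ⊗[ℂ] (G ⊗[ℂ] Center G))
  /-- `D¹ ℛ₋ = ℛ₊ σ²(D)` -/
  D_left : leg1 (structD 𝓡 σ : G ⊗[ℂ] Center G) * (RRminus 𝓡 F : G ⊗[ℂ] (G ⊗[ℂ] Center G)) =
    (RRplus 𝓡 F : G ⊗[ℂ] (G ⊗[ℂ] Center G)) * mapSnd σ (structD 𝓡 σ : G ⊗[ℂ] Center G)
  /-- `ℛ₋ D² = σ¹(D) ℛ₊` -/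
  D_right : (RRminus 𝓡 F : G ⊗[ℂ] (G ⊗[ℂ] Center G)) * leg2 (structD 𝓡 σ : G ⊗[ℂ] Center G) =
    swap12 (mapSnd σ (structD 𝓡 σ : G ⊗[ℂ] Center G)) *
      (RRplus 𝓡 F : G ⊗[ℂ] (G ⊗[ℂ] Center G))
  /-- `σ² σ¹(f) = Δ_F(σ(f))` -/
  σ_σ : ∀ f : Center G, mapSnd σ (σ f) = comulFFirst F (σ f)
  yangBaxter_plus : DynamicalYangBaxter σ (RRplus 𝓡 F : G ⊗[ℂ] (G ⊗[ℂ] Center G))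
  yangBaxter_minus : DynamicalYangBaxter σ (RRminus 𝓡 F : G ⊗[ℂ] (G ⊗[ℂ] Center G))
  /-- `F* = S_a F⁻¹` -/
  star_F : star (F : G ⊗[ℂ] (G ⊗[ℂ] Center G)) =
    leg12 (𝓡.S : G ⊗[ℂ] G) * ((F⁻¹ : (G ⊗[ℂ] (G ⊗[ℂ] Center G))ˣ) : G ⊗[ℂ] (G ⊗[ℂ] Center G))
  star_RRplus : star (RRplus 𝓡 F) = (RRplus 𝓡 F)⁻¹
  star_RRminus : star (RRminus 𝓡 F) = (RRminus 𝓡 F)⁻¹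
  star_D : star (structD 𝓡 σ) = (structD 𝓡 σ)⁻¹
  star_σ : ∀ f : Center G, star (σ f) = σ (star f)
  star_comulF : ∀ ξ : G, star (comulF F ξ) = comulF F (star ξ)

/-- The relations `Φ² Φ¹ = F Δ_a(Φ)` and `Φ f = σ(f) Φ` for an invertible `Φ ∈ 𝒢_a ⊗ A`, where
`j : 𝒞 → A` says how `𝒞` sits in the algebra `A`. -/
structure SolvesRelations {A : Type*} [Ring A] [Algebra ℂ A] (j : Center G →ₐ[ℂ] A)
    (Φ : (G ⊗[ℂ] A)ˣ) : Prop where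
  operatorProduct : leg2 (Φ : G ⊗[ℂ] A) * leg1 (Φ : G ⊗[ℂ] A) =
    mapSnd (mapSnd j) (F : G ⊗[ℂ] (G ⊗[ℂ] Center G)) * comulFirst (Φ : G ⊗[ℂ] A)
  exchange : ∀ f : Center G, (Φ : G ⊗[ℂ] A) * ((1 : G) ⊗ₜ[ℂ] j f) =
    mapSnd j (σ f) * (Φ : G ⊗[ℂ] A)

/-- `(A, j, Φ)` is the algebra generated by `𝒞` and by the components of an invertible element `Φ`
subject to the relations `Φ² Φ¹ = F Δ_a(Φ)` and `Φ f = σ(f) Φ`: the relations hold, `𝒞` and the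
components of `Φ` generate `A`, and every other solution of the relations is the image of this one
under a unique algebra homomorphism. -/
structure IsAlgebraOfRelations {A : Type*} [Ring A] [Algebra ℂ A] (j : Center G →ₐ[ℂ] A)
    (Φ : (G ⊗[ℂ] A)ˣ) : Prop where
  solves : SolvesRelations F σ j Φ
  generated : Algebra.adjoin ℂ
    (Set.range j ∪ Set.range fun π : Module.Dual ℂ G => component π (Φ : G ⊗[ℂ] A)) = ⊤
  universal : ∀ (B : Type w) [Ring B] [Algebra ℂ B] (jB : Center G →ₐ[ℂ] B) (ΦB : (G ⊗[ℂ] B)ˣ),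
    SolvesRelations F σ jB ΦB →
      ∃! ψ : A →ₐ[ℂ] B, ψ.comp j = jB ∧ mapSnd ψ (Φ : G ⊗[ℂ] A) = (ΦB : G ⊗[ℂ] B)

end StructureData

end Hopf

end VertexOp

end

/-! Every solution of the relations carries an action of $\mathcal G$, and two opposite dimension
bounds then pin the solution down. In a solution (B, j, Φ) the element Φ⁻¹DΦ obeys the fusion and
covariance relations of N. Modularity makes N nondegenerate: π ↦ (id ⊗ π)(N) is onto G
(`exists_rightComponent_N`). Hence N ↦ Φ⁻¹DΦ defines a homomorphism ι : G → B for which Φ is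
covariant (`exists_hopfAction`).

Upper bound: the products f Φ_π span the generated algebra, so its dimension is at most dim 𝒞 · dim
G (`finrank_adjoin_le`). Lower bound: a covariant invertible Φ over End(W), W ≠ 0, forces dim W ≥
dim G (`finrank_le_of_covariant`); this rests on the integral of G. The cocycle identity for F
yields an explicit solution on the dual of G (`exists_solvesRelations`). By the lower bound it is
irreducible, so by Burnside it generates all (dim G)² dimensions of operators. The upper bound then
gives dim 𝒞 = dim G: the relations force G to be commutative (`StructureRelations.mul_comm`), and
every V^I is a line. Both bounds being attained also yields universality (`isAlgebraOfRelations`)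
and injectivity of j.

The rest concerns characters. Unitarity makes the values of S both positive and of modulus one, so S
= 1 (`S_eq_one`). The integral supplies a vacuum vector from which Φ creates an eigenbasis of G;
declaring it orthonormal turns the dual of G into the model space. There Φ permutes the basis up to
phases and is unitary (`star_eq_inv`). Evaluating ΦN = DΦ on the vacuum gives j(v) = v up to a
scalar, and the nonvanishing Gauss sum of v⁻¹ makes this scalar 1 (`embedding_vC`). -/

set_option linter.unusedSectionVars false

noncomputable section

namespace VertexOp

open Coalgebra HopfAlgebra

/-! ### Calculus of tensor legs -/

section LegCalculus

variable {G : Type*} [Ring G] [HopfAlgebra ℂ G]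
variable {X : Type*} [Ring X] [Algebra ℂ X] {Y : Type*} [Ring Y] [Algebra ℂ Y]
variable {Z : Type*} [Ring Z] [Algebra ℂ Z]

@[simp] lemma leg1_tmul (g : G) (x : X) : leg1 (g ⊗ₜ[ℂ] x) = g ⊗ₜ[ℂ] ((1 : G) ⊗ₜ[ℂ] x) := rfl

@[simp] lemma leg2_apply (y : G ⊗[ℂ] X) : leg2 y = (1 : G) ⊗ₜ[ℂ] y := rfl

@[simp] lemma leg12_tmul (g h : G) :
    leg12 (X := X) (g ⊗ₜ[ℂ] h) = g ⊗ₜ[ℂ] (h ⊗ₜ[ℂ] (1 : X)) := rfl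

@[simp] lemma swap12_tmul (g h : G) (x : X) :
    swap12 (g ⊗ₜ[ℂ] (h ⊗ₜ[ℂ] x)) = h ⊗ₜ[ℂ] (g ⊗ₜ[ℂ] x) := rfl

@[simp] lemma flip_tmul (g h : G) : flip (g ⊗ₜ[ℂ] h) = h ⊗ₜ[ℂ] g := rfl

@[simp] lemma mapSnd_tmul (f : Y →ₐ[ℂ] Z) (g : G) (y : Y) :
    mapSnd f (g ⊗ₜ[ℂ] y) = g ⊗ₜ[ℂ] f y := rfl

@[simp] lemma component_tmul (π : Module.Dual ℂ G) (g : G) (x : X) :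
    component π (g ⊗ₜ[ℂ] x) = π g • x := rfl

@[simp] lemma flip_flip (x : G ⊗[ℂ] G) : flip (flip x) = x :=
  (TensorProduct.comm ℂ G G).symm_apply_apply x

lemma comulFirst_tmul (g : G) (x : X) :
    comulFirst (g ⊗ₜ[ℂ] x) = leg12 (comul (R := ℂ) g) * ((1 : G) ⊗ₜ[ℂ] ((1 : G) ⊗ₜ[ℂ] x)) := by
  change TensorProduct.assoc ℂ G G X (comul (R := ℂ) g ⊗ₜ x) = _
  induction comul (R := ℂ) g using TensorProduct.induction_on with
  | zero => simp
  | tmul a b => simp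
  | add a b ha hb => simp [TensorProduct.add_tmul, ha, hb, add_mul]

@[simp] lemma comulFirst_one_tmul (x : X) :
    comulFirst ((1 : G) ⊗ₜ[ℂ] x) = (1 : G) ⊗ₜ[ℂ] ((1 : G) ⊗ₜ[ℂ] x) := by
  rw [comulFirst_tmul, Bialgebra.comul_one, map_one, one_mul]

@[simp] lemma comulFirst_tmul_one (g : G) :
    comulFirst (g ⊗ₜ[ℂ] (1 : X)) = leg12 (comul (R := ℂ) g) := by
  rw [comulFirst_tmul, ← Algebra.TensorProduct.one_def, ← Algebra.TensorProduct.one_def, mul_one]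

lemma mapSnd_mapSnd (f : X →ₐ[ℂ] Y) (g : Y →ₐ[ℂ] Z) (y : G ⊗[ℂ] X) :
    mapSnd g (mapSnd f y) = mapSnd (g.comp f) y := by
  induction y using TensorProduct.induction_on with
  | zero => simp only [map_zero]
  | tmul a b => simp
  | add a b ha hb => simp only [map_add, ha, hb]

@[simp] lemma mapSnd_leg1 (f : X →ₐ[ℂ] Y) (y : G ⊗[ℂ] X) :
    mapSnd (mapSnd f) (leg1 y) = leg1 (mapSnd f y) := by
  induction y using TensorProduct.induction_on with
  | zero => simp only [map_zero]
  | tmul a b => simp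
  | add a b ha hb => simp only [map_add, ha, hb]

lemma mapSnd_leg2 (f : X →ₐ[ℂ] Y) (y : G ⊗[ℂ] X) :
    mapSnd (mapSnd f) (leg2 y) = leg2 (mapSnd f y) := rfl

@[simp] lemma mapSnd_leg12 (f : X →ₐ[ℂ] Y) (y : G ⊗[ℂ] G) :
    mapSnd (mapSnd f) (leg12 y) = leg12 y := by
  induction y using TensorProduct.induction_on with
  | zero => simp only [map_zero]
  | tmul a b => simp
  | add a b ha hb => simp only [map_add, ha, hb]

@[simp] lemma mapSnd_swap12 (f : X →ₐ[ℂ] Y) (y : G ⊗[ℂ] (G ⊗[ℂ] X)) :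
    mapSnd (mapSnd f) (swap12 y) = swap12 (mapSnd (mapSnd f) y) := by
  induction y using TensorProduct.induction_on with
  | zero => simp
  | tmul a b =>
    induction b using TensorProduct.induction_on with
    | zero => simp
    | tmul b c => rfl
    | add b c hb hc => simp only [TensorProduct.tmul_add, map_add, hb, hc]
  | add a b ha hb => simp [ha, hb]

lemma mapSnd_comulFirst (f : X →ₐ[ℂ] Y) (y : G ⊗[ℂ] X) :
    mapSnd (mapSnd f) (comulFirst y) = comulFirst (mapSnd f y) := by
  induction y using TensorProduct.induction_on with
  | zero => simp only [map_zero]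
  | tmul a b => simp [comulFirst_tmul]
  | add a b ha hb => simp only [map_add, ha, hb]

@[simp] lemma swap12_leg1 (y : G ⊗[ℂ] X) : swap12 (leg1 y) = leg2 y := by
  induction y using TensorProduct.induction_on with
  | zero => simp only [map_zero]
  | tmul a b => simp
  | add a b ha hb => simp only [map_add, ha, hb]

@[simp] lemma swap12_leg2 (y : G ⊗[ℂ] X) : swap12 (leg2 y) = leg1 y := by
  induction y using TensorProduct.induction_on with
  | zero => simp only [map_zero]
  | tmul a b => simp
  | add a b ha hb => simp only [map_add, ha, hb]

@[simp] lemma swap12_leg12 (y : G ⊗[ℂ] G) : swap12 (leg12 (X := X) y) = leg12 (flip y) := by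
  induction y using TensorProduct.induction_on with
  | zero => simp only [map_zero]
  | tmul a b => simp
  | add a b ha hb => simp only [map_add, ha, hb]

lemma mapSnd_flip_leg1 (y : G ⊗[ℂ] G) : mapSnd flip (leg1 y) = leg12 y := by
  induction y using TensorProduct.induction_on with
  | zero => simp only [map_zero]
  | tmul a b => simp
  | add a b ha hb => simp only [map_add, ha, hb]

lemma mapSnd_flip_leg12 (y : G ⊗[ℂ] G) : mapSnd flip (leg12 y) = leg1 y := by
  induction y using TensorProduct.induction_on with
  | zero => simp only [map_zero]
  | tmul a b => simp
  | add a b ha hb => simp only [map_add, ha, hb]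

lemma comul_coassoc (h : G) :
    mapSnd (Bialgebra.comulAlgHom ℂ G) (comul (R := ℂ) h) = comulFirst (comul (R := ℂ) h) :=
  (coassoc_apply h).symm

/-- The component `(id ⊗ π)(x) ∈ G` of `x ∈ G ⊗ G`. -/
def rightComponent (π : Module.Dual ℂ G) : G ⊗[ℂ] G →ₗ[ℂ] G :=
  (TensorProduct.rid ℂ G).toLinearMap.comp (TensorProduct.map LinearMap.id π)

@[simp] lemma rightComponent_tmul (π : Module.Dual ℂ G) (g h : G) :
    rightComponent π (g ⊗ₜ[ℂ] h) = π h • g := rfl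

lemma component_counit_comul (h : G) : component counit (comul (R := ℂ) h) = h := by
  exact (congrArg (TensorProduct.lid ℂ G) (rTensor_counit_comul (R := ℂ) h)).trans
    (by simp)

lemma rightComponent_counit_comul (h : G) : rightComponent counit (comul (R := ℂ) h) = h := by
  exact (congrArg (TensorProduct.rid ℂ G) (lTensor_counit_comul (R := ℂ) h)).trans
    (by simp)

end LegCalculus

/-! ### Counit and antipode calculus, with Sweedler computations run through linear maps. -/

section HopfCalculus

variable {G : Type*} [Ring G] [HopfAlgebra ℂ G]
variable {X : Type*} [Ring X] [Algebra ℂ X] {Y : Type*} [Ring Y] [Algebra ℂ Y]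

/-- `ε ⊗ id` as an algebra map. -/
def counitFirst : G ⊗[ℂ] X →ₐ[ℂ] X :=
  (Algebra.TensorProduct.lid ℂ X).toAlgHom.comp
    (Algebra.TensorProduct.map (Bialgebra.counitAlgHom ℂ G) (AlgHom.id ℂ X))

@[simp] lemma counitFirst_tmul (g : G) (x : X) :
    counitFirst (g ⊗ₜ[ℂ] x) = counit (R := ℂ) g • x := by
  simp [counitFirst]

lemma counitFirst_eq_component (y : G ⊗[ℂ] X) : counitFirst y = component counit y := by
  induction y using TensorProduct.induction_on with
  | zero => simp
  | tmul a b => simp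
  | add a b ha hb => simp [ha, hb]

lemma counitFirst_comul (h : G) : counitFirst (comul (R := ℂ) h) = h := by
  rw [counitFirst_eq_component, component_counit_comul]

lemma counitFirst_mapSnd (f : X →ₐ[ℂ] Y) (y : G ⊗[ℂ] X) :
    counitFirst (mapSnd f y) = f (counitFirst y) := by
  induction y using TensorProduct.induction_on with
  | zero => simp
  | tmul a b => simp
  | add a b ha hb => simp [ha, hb]

lemma counitFirst_comulFirst (y : G ⊗[ℂ] X) : counitFirst (comulFirst y) = y := by
  induction y using TensorProduct.induction_on with
  | zero => simp
  | tmul a b =>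
    rw [comulFirst_tmul, map_mul]
    have h : ∀ z : G ⊗[ℂ] G, counitFirst (leg12 (X := X) z) = counitFirst z ⊗ₜ[ℂ] (1 : X) := by
      intro z
      induction z using TensorProduct.induction_on with
      | zero => simp
      | tmul a b => simp [TensorProduct.smul_tmul']
      | add a b ha hb => simp [ha, hb, TensorProduct.add_tmul]
    rw [h, counitFirst_comul]
    simp
  | add a b ha hb => simp [ha, hb]

/-- `x ⊗ y ↦ (a ↦ p x * a * q y)`. -/
def sandwich {A P Q : Type*} [Ring A] [Algebra ℂ A] [AddCommGroup P] [Module ℂ P]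
    [AddCommGroup Q] [Module ℂ Q] (p : P →ₗ[ℂ] A) (q : Q →ₗ[ℂ] A) :
    P ⊗[ℂ] Q →ₗ[ℂ] A →ₗ[ℂ] A :=
  TensorProduct.lift (LinearMap.mk₂ ℂ
    (fun a b => (LinearMap.mulLeft ℂ (p a)).comp (LinearMap.mulRight ℂ (q b)))
    (by intros; ext; simp [add_mul]) (by intros; ext; simp)
    (by intros; ext; simp [mul_add]) (by intros; ext; simp))

@[simp] lemma sandwich_tmul {A P Q : Type*} [Ring A] [Algebra ℂ A] [AddCommGroup P]
    [Module ℂ P] [AddCommGroup Q] [Module ℂ Q] (p : P →ₗ[ℂ] A) (q : Q →ₗ[ℂ] A) (a : P) (b : Q)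
    (x : A) : sandwich p q (a ⊗ₜ[ℂ] b) x = p a * x * q b := by
  simp [sandwich, mul_assoc]

/-- `x ⊗ y ↦ x * S y` -/
def mulAntipode : G ⊗[ℂ] G →ₗ[ℂ] G := (LinearMap.mul' ℂ G).comp ((antipode ℂ).lTensor G)

@[simp] lemma mulAntipode_tmul (a b : G) : mulAntipode (a ⊗ₜ[ℂ] b) = a * antipode ℂ b := by
  simp [mulAntipode]

lemma mulAntipode_comul (h : G) :
    mulAntipode (comul (R := ℂ) h) = algebraMap ℂ G (counit (R := ℂ) h) :=
  mul_antipode_lTensor_comul_apply h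

/-- `x ⊗ y ↦ S x * y` -/
def antipodeMul : G ⊗[ℂ] G →ₗ[ℂ] G := (LinearMap.mul' ℂ G).comp ((antipode ℂ).rTensor G)

@[simp] lemma antipodeMul_tmul (a b : G) : antipodeMul (a ⊗ₜ[ℂ] b) = antipode ℂ a * b := by
  simp [antipodeMul]

lemma antipodeMul_comul (h : G) :
    antipodeMul (comul (R := ℂ) h) = algebraMap ℂ G (counit (R := ℂ) h) :=
  mul_antipode_rTensor_comul_apply h

/-- Coassociativity, evaluated by a linear map. -/
lemma coassoc_eval {Z : Type*} [AddCommGroup Z] [Module ℂ Z]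
    (f : G ⊗[ℂ] (G ⊗[ℂ] G) →ₗ[ℂ] Z) (l : G ⊗[ℂ] G →ₗ[ℂ] Z)
    (hl : ∀ a c, f (leg12 (comul (R := ℂ) a) * (1 ⊗ₜ[ℂ] (1 ⊗ₜ[ℂ] c))) = l (a ⊗ₜ c)) (h : G) :
    f (mapSnd (Bialgebra.comulAlgHom ℂ G) (comul (R := ℂ) h)) = l (comul (R := ℂ) h) := by
  have h1 : ∀ x : G ⊗[ℂ] G, f (comulFirst x) = l x := by
    intro x
    induction x using TensorProduct.induction_on with
    | zero => simp
    | tmul a b => rw [comulFirst_tmul, hl]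
    | add a b ha hb => simp [ha, hb]
  rw [comul_coassoc, h1]

lemma mapSnd_comul_eval {Z : Type*} [AddCommGroup Z] [Module ℂ Z]
    (f : G ⊗[ℂ] (G ⊗[ℂ] G) →ₗ[ℂ] Z) (r : G ⊗[ℂ] G →ₗ[ℂ] Z)
    (hr : ∀ a b, f (a ⊗ₜ[ℂ] (comul (R := ℂ) b)) = r (a ⊗ₜ b)) (x : G ⊗[ℂ] G) :
    f (mapSnd (Bialgebra.comulAlgHom ℂ G) x) = r x := by
  induction x using TensorProduct.induction_on with
  | zero => simp
  | tmul a b => rw [mapSnd_tmul, Bialgebra.comulAlgHom_apply, hr]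
  | add a b ha hb => simp [ha, hb]

end HopfCalculus

/-! ### The R-matrix, the Drinfeld element and the monodromy element N. -/

section QuasiTriangular

variable {G : Type*} [Ring G] [HopfAlgebra ℂ G] [StarRing G] [StarModule ℂ G]

namespace RibbonStructure

variable (𝓡 : RibbonStructure G)

/-- Applying ε to the middle leg of (id ⊗ Δ)(R) = R₁₃R₁₂ gives R = R·((id ⊗ ε)(R) ⊗ 1), and R
cancels. -/
lemma rightComponent_counit_R : rightComponent counit (𝓡.R : G ⊗[ℂ] G) = 1 := by
  have h := congrArg (mapSnd (G := G) counitFirst) 𝓡.id_comul_R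
  have e1 : ∀ x : G ⊗[ℂ] G, mapSnd (G := G) counitFirst
      (mapSnd (Bialgebra.comulAlgHom ℂ G) x) = x := by
    intro x
    induction x using TensorProduct.induction_on with
    | zero => simp
    | tmul a b => simp [counitFirst_comul]
    | add a b ha hb => simp [ha, hb]
  have e2 : ∀ x : G ⊗[ℂ] G, mapSnd (G := G) counitFirst (leg1 x) = x := by
    intro x
    induction x using TensorProduct.induction_on with
    | zero => simp
    | tmul a b => simp
    | add a b ha hb => simp [ha, hb]
  have e3 : ∀ x : G ⊗[ℂ] G, mapSnd (G := G) counitFirst (leg12 (X := G) x) =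
      rightComponent counit x ⊗ₜ[ℂ] (1 : G) := by
    intro x
    induction x using TensorProduct.induction_on with
    | zero => simp
    | tmul a b => simp [TensorProduct.smul_tmul']
    | add a b ha hb => simp [ha, hb, TensorProduct.add_tmul]
  rw [e1, map_mul, e2, e3] at h
  have h2 : rightComponent counit (𝓡.R : G ⊗[ℂ] G) ⊗ₜ[ℂ] (1 : G) = 1 := by
    have := congrArg (((𝓡.R⁻¹ : (G ⊗[ℂ] G)ˣ) : G ⊗[ℂ] G) * ·) h
    simpa using this.symm
  have h3 := congrArg (rightComponent counit) h2
  rw [Algebra.TensorProduct.one_def] at h3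
  simpa using h3

/-- `∑ r¹ρ¹ ⊗ ρ² S(r²) = 1` for two copies of `R`. -/
lemma sandwich_antipode_R :
    sandwich (Algebra.TensorProduct.includeLeft : G →ₐ[ℂ] G ⊗[ℂ] G).toLinearMap
      (Algebra.TensorProduct.includeRight : G →ₐ[ℂ] G ⊗[ℂ] G).toLinearMap
      ((antipode ℂ).lTensor G (𝓡.R : G ⊗[ℂ] G)) (𝓡.R : G ⊗[ℂ] G) = 1 := by
  -- Applying x ⊗ y ↦ x S(y) to the last two legs of (id ⊗ Δ)(R) = R₁₃R₁₂ collapses the left side to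
  -- (id ⊗ ε)(R) ⊗ 1.
  have h := congrArg (mulAntipode.lTensor G) 𝓡.id_comul_R
  have e1 : ∀ x : G ⊗[ℂ] G, mulAntipode.lTensor G (mapSnd (Bialgebra.comulAlgHom ℂ G) x) =
      rightComponent counit x ⊗ₜ[ℂ] (1 : G) := by
    intro x
    induction x using TensorProduct.induction_on with
    | zero => simp
    | tmul a b =>
      simp [mulAntipode_comul, Algebra.algebraMap_eq_smul_one, TensorProduct.smul_tmul']
    | add a b ha hb => simp [ha, hb, TensorProduct.add_tmul]
  have e2 : ∀ x y : G ⊗[ℂ] G, mulAntipode.lTensor G (leg1 x * leg12 y) =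
      sandwich (Algebra.TensorProduct.includeLeft : G →ₐ[ℂ] G ⊗[ℂ] G).toLinearMap
      (Algebra.TensorProduct.includeRight : G →ₐ[ℂ] G ⊗[ℂ] G).toLinearMap
      ((antipode ℂ).lTensor G x) y := by
    intro x y
    induction x using TensorProduct.induction_on with
    | zero => simp
    | tmul a b =>
      induction y using TensorProduct.induction_on with
      | zero => simp
      | tmul c d => simp
      | add c d hc hd => simp only [map_add, mul_add, hc, hd]
    | add a b ha hb => simp only [map_add, add_mul, ha, hb, LinearMap.add_apply]
  rw [e1, e2, rightComponent_counit_R] at h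
  exact h.symm

/-- The element `∑ S(r²) r¹`. -/
def uElt : G := LinearMap.mul' ℂ G
  (TensorProduct.map (antipode ℂ) LinearMap.id (flip (𝓡.R : G ⊗[ℂ] G)))

/-- Apply a ⊗ b ↦ S(b)a to RΔ(h) = Δ'(h)R: the left side becomes ∑ S(h₂) u h₁, while on the right
S(h₁)h₂ contracts to ε(h). -/
lemma sandwich_antipode_uElt (h : G) :
    sandwich (antipode ℂ) LinearMap.id (flip (comul (R := ℂ) h)) 𝓡.uElt =
      counit (R := ℂ) h • 𝓡.uElt := by
  let Θ : G ⊗[ℂ] G →ₗ[ℂ] G := (LinearMap.mul' ℂ G).comp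
    ((TensorProduct.map (antipode ℂ) LinearMap.id).comp (flip (G := G)).toLinearMap)
  have hΘ : ∀ a b : G, Θ (a ⊗ₜ b) = antipode ℂ b * a := fun a b => by simp [Θ]
  have e1 : ∀ x y : G ⊗[ℂ] G, Θ (x * y) =
      sandwich (antipode ℂ) LinearMap.id (flip y) (Θ x) := by
    intro x y
    induction x using TensorProduct.induction_on with
    | zero => simp
    | tmul a b =>
      induction y using TensorProduct.induction_on with
      | zero => simp
      | tmul c d => simp [hΘ, antipode_mul_antidistrib, mul_assoc]
      | add c d hc hd => simp only [map_add, mul_add, hc, hd, LinearMap.add_apply]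
    | add a b ha hb => simp only [map_add, add_mul, ha, hb]
  have e2 : ∀ x y : G ⊗[ℂ] G, Θ (flip y * x) =
      sandwich (antipode ℂ) LinearMap.id (flip x) (antipodeMul y) := by
    intro x y
    induction x using TensorProduct.induction_on with
    | zero => simp
    | tmul a b =>
      induction y using TensorProduct.induction_on with
      | zero => simp
      | tmul c d => simp [hΘ, antipode_mul_antidistrib, mul_assoc]
      | add c d hc hd => simp only [map_add, add_mul, hc, hd]
    | add a b ha hb => simp only [map_add, mul_add, ha, hb, LinearMap.add_apply]
  have h1 := congrArg Θ (𝓡.R_comul h)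
  rw [e1, e2, antipodeMul_comul] at h1
  have e3 : ∀ x : G ⊗[ℂ] G, sandwich (antipode ℂ) LinearMap.id (flip x) 1 = Θ x := by
    intro x
    rw [← one_mul x, e1, one_mul]
    simp [hΘ, Algebra.TensorProduct.one_def]
  rw [Algebra.algebraMap_eq_smul_one, map_smul, e3] at h1
  exact h1

/-- Drinfeld's identity: evaluate ∑ S²(h₃) S(h₂) u h₁ by contracting h₁, h₂ with
`sandwich_antipode_uElt`, or h₂, h₃ through S(h₂ S(h₃)). -/
lemma antipode_antipode_mul_uElt (h : G) :
    antipode ℂ (antipode ℂ h) * 𝓡.uElt = 𝓡.uElt * h := by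
  let f : G ⊗[ℂ] (G ⊗[ℂ] G) →ₗ[ℂ] G :=
    (LinearMap.applyₗ 𝓡.uElt).comp ((sandwich (antipode ℂ) LinearMap.id).comp
      ((flip (G := G)).toLinearMap.comp (mulAntipode.lTensor G)))
  have hf : ∀ a b c : G, f (a ⊗ₜ (b ⊗ₜ c)) =
      antipode ℂ (antipode ℂ c) * (antipode ℂ b * 𝓡.uElt * a) := fun a b c => by
    simp [f, antipode_mul_antidistrib, mul_assoc]
  have hf' : ∀ (x : G ⊗[ℂ] G) (c : G), f (leg12 x * (1 ⊗ₜ[ℂ] (1 ⊗ₜ[ℂ] c))) =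
      antipode ℂ (antipode ℂ c) *
        sandwich (antipode ℂ) LinearMap.id (flip x) 𝓡.uElt := by
    intro x c
    induction x using TensorProduct.induction_on with
    | zero => simp
    | tmul a b => simp [hf]
    | add a b ha hb => simp only [map_add, add_mul, mul_add, ha, hb, LinearMap.add_apply]
  have key := coassoc_eval f
    ((LinearMap.mulRight ℂ 𝓡.uElt).comp ((antipode ℂ).comp ((antipode ℂ).comp
      (component counit))))
    (fun a c => by rw [hf', sandwich_antipode_uElt]; simp) h
  rw [mapSnd_comul_eval f ((LinearMap.mulLeft ℂ 𝓡.uElt).comp (rightComponent counit))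
    (fun a b => by
      simp [f, mulAntipode_comul, Algebra.algebraMap_eq_smul_one, antipode_one])] at key
  simpa [component_counit_comul, rightComponent_counit_comul] using key.symm

/-- Since u h = S²(h) u, multiplying ∑ h₂ u⁻¹ S(h₁) by u on the left gives ∑ S²(h₂)S(h₁) = S(∑ h₁
S(h₂)) = ε(h). This makes quantum characters invariant. -/
lemma sandwich_inv_uElt {u : Gˣ} (hu : (u : G) = 𝓡.uElt) (h : G) :
    sandwich LinearMap.id (antipode ℂ) (flip (comul (R := ℂ) h)) ((u⁻¹ : Gˣ) : G) =
      counit (R := ℂ) h • ((u⁻¹ : Gˣ) : G) := by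
  have e1 : ∀ x : G ⊗[ℂ] G,
      (u : G) * sandwich LinearMap.id (antipode ℂ) (flip x) ((u⁻¹ : Gˣ) : G) =
        antipode ℂ (mulAntipode x) := by
    intro x
    induction x using TensorProduct.induction_on with
    | zero => simp
    | tmul a b =>
      have hb := 𝓡.antipode_antipode_mul_uElt b
      rw [← hu] at hb
      simp only [flip_tmul, sandwich_tmul, LinearMap.id_coe, id_eq, mulAntipode_tmul,
        antipode_mul_antidistrib, ← mul_assoc]
      rw [← hb, mul_assoc _ (u : G), Units.mul_inv, mul_one]
    | add a b ha hb => simp only [map_add, mul_add, ha, hb, LinearMap.add_apply]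
  have h1 := e1 (comul (R := ℂ) h)
  rw [mulAntipode_comul, Algebra.algebraMap_eq_smul_one, map_smul, antipode_one] at h1
  have h2 := congrArg (((u⁻¹ : Gˣ) : G) * ·) h1
  simpa using h2

/-- S² is conjugation by the unit u, hence onto. -/
lemma antipode_surjective (hu : IsUnit 𝓡.uElt) : Function.Surjective (antipode ℂ (A := G)) := by
  obtain ⟨u, hu⟩ := hu
  intro g
  refine ⟨antipode ℂ (((u⁻¹ : Gˣ) : G) * g * u), ?_⟩
  have h := 𝓡.antipode_antipode_mul_uElt (((u⁻¹ : Gˣ) : G) * g * u)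
  rw [← hu, ← mul_assoc, ← mul_assoc, Units.mul_inv, one_mul] at h
  exact (Units.mul_left_inj u).1 h

lemma N_eq : (𝓡.N : G ⊗[ℂ] G) = 𝓡.R * flip (𝓡.R : G ⊗[ℂ] G) := by
  simp [N, Rplus, Rminus]

lemma flip_R_comul (ξ : G) : flip (𝓡.R : G ⊗[ℂ] G) * flip (comul (R := ℂ) ξ) =
    comul (R := ℂ) ξ * flip (𝓡.R : G ⊗[ℂ] G) := by
  have h := congrArg flip (𝓡.R_comul ξ)
  simpa using h

lemma N_comul (ξ : G) : (𝓡.N : G ⊗[ℂ] G) * flip (comul (R := ℂ) ξ) =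
    flip (comul (R := ℂ) ξ) * 𝓡.N := by
  rw [N_eq, mul_assoc, flip_R_comul, ← mul_assoc, 𝓡.R_comul, mul_assoc]

/-- `a ⊗ b ⊗ c ↦ b ⊗ c ⊗ a` -/
def rotate : G ⊗[ℂ] (G ⊗[ℂ] G) →ₐ[ℂ] G ⊗[ℂ] (G ⊗[ℂ] G) :=
  (mapSnd flip).comp swap12

/-- This is (id ⊗ Δ)(R) = R₁₃R₁₂ after a cyclic rotation of the legs. -/
lemma comulFirst_flip_R : comulFirst (flip (𝓡.R : G ⊗[ℂ] G)) =
    leg2 (flip (𝓡.R : G ⊗[ℂ] G)) * leg1 (flip (𝓡.R : G ⊗[ℂ] G)) := by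
  have e0 : ∀ (b : G) (z : G ⊗[ℂ] G), rotate (b ⊗ₜ[ℂ] z) =
      leg12 z * (1 ⊗ₜ[ℂ] (1 ⊗ₜ[ℂ] b)) := by
    intro b z
    induction z using TensorProduct.induction_on with
    | zero => simp
    | tmul c d => simp [rotate]
    | add c d hc hd => simp only [map_add, add_mul, TensorProduct.tmul_add, hc, hd]
  have e1 : ∀ x : G ⊗[ℂ] G, comulFirst (flip x) =
      rotate (mapSnd (Bialgebra.comulAlgHom ℂ G) x) := by
    intro x
    induction x using TensorProduct.induction_on with
    | zero => simp
    | tmul a b => simp [e0, comulFirst_tmul]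
    | add a b ha hb => simp [ha, hb]
  have e2 : ∀ x : G ⊗[ℂ] G, rotate (leg1 x) = leg2 (flip x) := by
    intro x
    induction x using TensorProduct.induction_on with
    | zero => simp
    | tmul a b => simp [rotate]
    | add a b ha hb => simp only [map_add, ha, hb]
  have e3 : ∀ x : G ⊗[ℂ] G, rotate (leg12 x) = leg1 (flip x) := by
    intro x
    induction x using TensorProduct.induction_on with
    | zero => simp
    | tmul a b => simp [rotate]
    | add a b ha hb => simp only [map_add, ha, hb]
  rw [e1, 𝓡.id_comul_R, map_mul, e2, e3]

lemma comulFirst_N : comulFirst (𝓡.N : G ⊗[ℂ] G) =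
    leg1 (𝓡.R : G ⊗[ℂ] G) * leg2 (𝓡.N : G ⊗[ℂ] G) * leg1 (flip (𝓡.R : G ⊗[ℂ] G)) := by
  rw [N_eq, map_mul, 𝓡.comul_id_R, comulFirst_flip_R, map_mul]
  simp only [mul_assoc]

/-- `(id ⊗ Δ')(x)`. -/
def mapComulFlip : G ⊗[ℂ] G →ₐ[ℂ] G ⊗[ℂ] (G ⊗[ℂ] G) :=
  mapSnd ((flip (G := G)).comp (Bialgebra.comulAlgHom ℂ G))

lemma mapComulFlip_R : mapComulFlip (𝓡.R : G ⊗[ℂ] G) =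
    leg12 (𝓡.R : G ⊗[ℂ] G) * leg1 (𝓡.R : G ⊗[ℂ] G) := by
  rw [mapComulFlip, ← mapSnd_mapSnd, 𝓡.id_comul_R, map_mul, mapSnd_flip_leg1, mapSnd_flip_leg12]

lemma mapComulFlip_flip_R : mapComulFlip (flip (𝓡.R : G ⊗[ℂ] G)) =
    leg1 (flip (𝓡.R : G ⊗[ℂ] G)) * leg12 (flip (𝓡.R : G ⊗[ℂ] G)) := by
  have hrev : ∀ a b c : G, swap12 (rotate (a ⊗ₜ[ℂ] (b ⊗ₜ[ℂ] c))) = c ⊗ₜ (b ⊗ₜ a) := by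
    intros; simp [rotate]
  have e0 : ∀ (z : G ⊗[ℂ] G) (b : G), swap12 (rotate (leg12 z * (1 ⊗ₜ[ℂ] (1 ⊗ₜ[ℂ] b)))) =
      b ⊗ₜ[ℂ] flip z := by
    intro z b
    induction z using TensorProduct.induction_on with
    | zero => simp
    | tmul c d => simp [rotate]
    | add c d hc hd => simp only [map_add, add_mul, TensorProduct.tmul_add, hc, hd]
  have e1 : ∀ x : G ⊗[ℂ] G, mapComulFlip (flip x) = swap12 (rotate (comulFirst x)) := by
    intro x
    induction x using TensorProduct.induction_on with
    | zero => simp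
    | tmul a b => simp [e0, comulFirst_tmul, mapComulFlip, -map_mul]
    | add a b ha hb => simp [ha, hb]
  have e2 : ∀ x : G ⊗[ℂ] G, swap12 (rotate (leg1 x)) = leg1 (flip x) := by
    intro x
    induction x using TensorProduct.induction_on with
    | zero => simp
    | tmul a b => simp [hrev]
    | add a b ha hb => simp only [map_add, ha, hb]
  have e3 : ∀ x : G ⊗[ℂ] G, swap12 (rotate (leg2 x)) = leg12 (flip x) := by
    intro x
    induction x using TensorProduct.induction_on with
    | zero => simp
    | tmul a b => simp [rotate]
    | add a b ha hb => simp only [map_add, ha, hb]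
  rw [e1, 𝓡.comul_id_R, map_mul, map_mul, e2, e3]

lemma mapComulFlip_N : mapComulFlip (𝓡.N : G ⊗[ℂ] G) =
    leg12 (𝓡.R : G ⊗[ℂ] G) * leg1 (𝓡.N : G ⊗[ℂ] G) * leg12 (flip (𝓡.R : G ⊗[ℂ] G)) := by
  rw [N_eq, map_mul, mapComulFlip_R, mapComulFlip_flip_R, map_mul]
  simp only [mul_assoc]

lemma leg2_N_mul_mapComulFlip (x : G ⊗[ℂ] G) :
    leg2 (𝓡.N : G ⊗[ℂ] G) * mapComulFlip x = mapComulFlip x * leg2 (𝓡.N : G ⊗[ℂ] G) := by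
  induction x using TensorProduct.induction_on with
  | zero => simp
  | tmul a b => simp [mapComulFlip, N_comul]
  | add a b ha hb => simp only [map_add, mul_add, add_mul, ha, hb]

/-- The fusion relation R₁₂ (Δ ⊗ id)(N) = N₂₃ R₁₂ N₁₃. Here R₁₂R₁₃ = (id ⊗ Δ')(R), and N₂₃ passes
through it because N commutes with Δ'. -/
lemma leg12_R_mul_comulFirst_N : leg12 (𝓡.R : G ⊗[ℂ] G) * comulFirst (𝓡.N : G ⊗[ℂ] G) =
    leg2 (𝓡.N : G ⊗[ℂ] G) * leg12 (𝓡.R : G ⊗[ℂ] G) * leg1 (𝓡.N : G ⊗[ℂ] G) := by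
  rw [comulFirst_N, N_eq 𝓡, map_mul leg1, ← N_eq 𝓡, ← mul_assoc, ← mul_assoc, ← mul_assoc,
    ← mapComulFlip_R, mul_assoc (leg2 _), ← mapComulFlip_R, leg2_N_mul_mapComulFlip]

/-- N commutes with Δ'(h), so (1 ⊗ S(h₁)) N (h₃ ⊗ h₂) = (1 ⊗ S(h₁))(h₃ ⊗ h₂) N. Under id ⊗ π the
invariance of π contracts the left side to (id ⊗ π)(N) h, and the antipode axiom contracts the right
side to h (id ⊗ π)(N). -/
lemma commute_rightComponent_N (π : Module.Dual ℂ G)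
    (hπ : ∀ h x : G, π (sandwich (antipode ℂ) LinearMap.id (comul (R := ℂ) h) x) =
      counit (R := ℂ) h * π x) (h : G) :
    rightComponent π (𝓡.N : G ⊗[ℂ] G) * h = h * rightComponent π (𝓡.N : G ⊗[ℂ] G) := by
  let s : G ⊗[ℂ] (G ⊗[ℂ] G) →ₗ[ℂ] G ⊗[ℂ] G →ₗ[ℂ] G ⊗[ℂ] G :=
    sandwich ((Algebra.TensorProduct.includeRight : G →ₐ[ℂ] G ⊗[ℂ] G).toLinearMap.comp
      (antipode ℂ)) (flip (G := G)).toLinearMap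
  let f : G ⊗[ℂ] (G ⊗[ℂ] G) →ₗ[ℂ] G :=
    (rightComponent π).comp ((LinearMap.applyₗ (𝓡.N : G ⊗[ℂ] G)).comp s)
  let g : G ⊗[ℂ] (G ⊗[ℂ] G) →ₗ[ℂ] G :=
    (rightComponent π).comp ((LinearMap.mulRight ℂ (𝓡.N : G ⊗[ℂ] G)).comp
      ((LinearMap.applyₗ (1 : G ⊗[ℂ] G)).comp s))
  have hs : ∀ (x n : G ⊗[ℂ] G) (c : G),
      rightComponent π (s (leg12 x * (1 ⊗ₜ[ℂ] (1 ⊗ₜ[ℂ] c))) n) =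
        rightComponent (π.comp (sandwich (antipode ℂ) LinearMap.id x)) n * c := by
    intro x n c
    induction x using TensorProduct.induction_on with
    | zero => simp [rightComponent]
    | tmul a b =>
      induction n using TensorProduct.induction_on with
      | zero => simp
      | tmul n m => simp [s]
      | add n m hn hm => simp only [map_add, add_mul, hn, hm]
    | add a b ha hb =>
      simp only [map_add, add_mul, LinearMap.add_apply, ha, hb]
      simp [rightComponent, LinearMap.comp_add, TensorProduct.map_add_right, add_mul]
  have hg : ∀ (x : G ⊗[ℂ] G) (c : G), s (leg12 x * (1 ⊗ₜ[ℂ] (1 ⊗ₜ[ℂ] c))) 1 =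
      c ⊗ₜ[ℂ] antipodeMul x := by
    intro x c
    induction x using TensorProduct.induction_on with
    | zero => simp
    | tmul a b => simp [s]
    | add a b ha hb => simp only [map_add, add_mul, LinearMap.add_apply, ha, hb,
        TensorProduct.tmul_add]
  have hmul : ∀ (a : G) (n : G ⊗[ℂ] G), rightComponent π ((a ⊗ₜ[ℂ] (1 : G)) * n) =
      a * rightComponent π n := by
    intro a n
    induction n using TensorProduct.induction_on with
    | zero => simp
    | tmul n m => simp
    | add n m hn hm => simp only [map_add, mul_add, hn, hm]
  have h1 := coassoc_eval f ((LinearMap.mulLeft ℂ (rightComponent π (𝓡.N : G ⊗[ℂ] G))).comp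
    (component counit)) (fun a c => by
      have : π.comp (sandwich (antipode ℂ) LinearMap.id (comul (R := ℂ) a)) =
          counit (R := ℂ) a • π := by ext x; simp [hπ]
      simp only [f, LinearMap.comp_apply, LinearMap.applyₗ_apply_apply, hs, this]
      simp [rightComponent, TensorProduct.map_smul_right]) h
  have h2 := coassoc_eval g ((LinearMap.mulRight ℂ (rightComponent π (𝓡.N : G ⊗[ℂ] G))).comp
    (component counit)) (fun a c => by
      simp only [g, LinearMap.comp_apply, LinearMap.applyₗ_apply_apply, hg, antipodeMul_comul,
        Algebra.algebraMap_eq_smul_one, TensorProduct.tmul_smul, LinearMap.mulRight_apply,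
        map_smul, hmul, component_tmul]) h
  have h3 : f (mapSnd (Bialgebra.comulAlgHom ℂ G) (comul (R := ℂ) h)) =
      g (mapSnd (Bialgebra.comulAlgHom ℂ G) (comul (R := ℂ) h)) := by
    refine mapSnd_comul_eval f (g.comp (mapSnd (Bialgebra.comulAlgHom ℂ G)).toLinearMap)
      (fun a b => ?_) _
    simp [f, g, s, mul_assoc, N_comul]
  rw [h1, h2] at h3
  simpa [component_counit_comul] using h3

end RibbonStructure

end QuasiTriangular

/-! ### Integrals of a semisimple Hopf algebra. -/

section Integrals

variable {G : Type*} [Ring G] [HopfAlgebra ℂ G]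

/-- Two-sided integrals, normalized by the counit. -/
structure IsIntegral (Λ : G) : Prop where
  left : ∀ h : G, h * Λ = counit (R := ℂ) h • Λ
  right : ∀ h : G, Λ * h = counit (R := ℂ) h • Λ
  counit_eq : counit (R := ℂ) Λ = 1

-- By semisimplicity the kernel of ε has a complementary left ideal; the component of 1 in it is a
-- left integral.
variable (G) in
lemma exists_isIntegral [IsSemisimpleRing G] : ∃ Λ : G, IsIntegral Λ := by
  let J : Submodule G G := RingHom.ker (Bialgebra.counitAlgHom ℂ G)
  have memJ : ∀ x : G, x ∈ J ↔ counit (R := ℂ) x = 0 := fun x => Iff.rfl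
  obtain ⟨L, hL⟩ := exists_isCompl J
  obtain ⟨e, he, Λ, hΛ, hsum⟩ := Submodule.mem_sup.1
    (show (1 : G) ∈ J ⊔ L by rw [hL.sup_eq_top]; trivial)
  have hcounit : counit (R := ℂ) Λ = 1 := by
    have := congrArg (counit (R := ℂ)) hsum
    rw [map_add, (memJ e).1 he, zero_add, Bialgebra.counit_one] at this
    exact this
  have hleft : ∀ h : G, h * Λ = counit (R := ℂ) h • Λ := by
    intro h
    have h1 : (h - algebraMap ℂ G (counit (R := ℂ) h)) * Λ = 0 := by
      refine (Submodule.disjoint_def.1 hL.disjoint) _ ?_ (L.smul_mem _ hΛ)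
      rw [memJ, Bialgebra.counit_mul, map_sub, Bialgebra.counit_algebraMap]
      simp
    rw [sub_mul, sub_eq_zero] at h1
    rw [h1, Algebra.smul_def]
  refine ⟨Λ, hleft, fun h => ?_, hcounit⟩
  -- The defect x of right invariance is itself a left integral with ε(x) = 0, so the left ideal Gx
  -- squares to zero; having a complement, it vanishes.
  set x := Λ * h - counit (R := ℂ) h • Λ with hx
  have xleft : ∀ g : G, g * x = counit (R := ℂ) g • x := by
    intro g
    rw [hx, mul_sub, ← mul_assoc, hleft, mul_smul_comm, hleft, smul_mul_assoc, smul_sub,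
      smul_comm]
  have xcounit : counit (R := ℂ) x = 0 := by
    rw [hx, map_sub, Bialgebra.counit_mul, map_smul, hcounit]; simp
  obtain ⟨M, hM⟩ := exists_isCompl (Submodule.span G {x})
  obtain ⟨y, hy, z, hz, hyz⟩ := Submodule.mem_sup.1
    (show (1 : G) ∈ Submodule.span G {x} ⊔ M by rw [hM.sup_eq_top]; trivial)
  obtain ⟨g, rfl⟩ := Submodule.mem_span_singleton.1 hy
  have hxz : x = x * z := by
    have := congrArg (x * ·) hyz
    simp only [smul_eq_mul, mul_add, mul_one, xleft, mul_smul_comm, xcounit, zero_smul, smul_zero,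
      zero_add] at this
    exact this.symm
  have : x = 0 := by
    refine (Submodule.disjoint_def.1 hM.disjoint) x (Submodule.mem_span_singleton_self x) ?_
    rw [hxz]
    exact M.smul_mem x hz
  exact sub_eq_zero.1 this

lemma tensor_eq_sum_component {ι : Type*} [Fintype ι] (b : Module.Basis ι ℂ G) {X : Type*} [Ring X]
    [Algebra ℂ X] (y : G ⊗[ℂ] X) : y = ∑ i, b i ⊗ₜ[ℂ] component (b.coord i) y := by
  induction y using TensorProduct.induction_on with
  | zero => simp
  | tmul g x =>
    simp only [component_tmul, TensorProduct.tmul_smul]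
    simp_rw [TensorProduct.smul_tmul', ← TensorProduct.sum_tmul]
    exact congrArg (· ⊗ₜ[ℂ] x) (b.sum_repr g).symm
  | add x y hx hy =>
    nth_rewrite 1 [hx, hy]
    simp only [map_add, TensorProduct.tmul_add, Finset.sum_add_distrib]

end Integrals

section IntegralCalculus

variable {G : Type*} [Ring G] [HopfAlgebra ℂ G]

namespace IsIntegral

variable {Λ : G}

/-- Evaluate ∑ (S(h₁) ⊗ 1) (h₂ ⊗ h₃) Δ(Λ) in two ways: h₂, h₃ are absorbed by Λ, or S(h₁)h₂
contracts. -/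
lemma one_tmul_mul_comul (hΛ : IsIntegral Λ) (h : G) :
    ((1 : G) ⊗ₜ[ℂ] h) * comul (R := ℂ) Λ =
      (antipode ℂ h ⊗ₜ[ℂ] (1 : G)) * comul (R := ℂ) Λ := by
  let f : G ⊗[ℂ] (G ⊗[ℂ] G) →ₗ[ℂ] G ⊗[ℂ] G :=
    (LinearMap.mulRight ℂ (comul (R := ℂ) Λ)).comp ((LinearMap.applyₗ (1 : G ⊗[ℂ] G)).comp
      (sandwich ((Algebra.TensorProduct.includeLeft : G →ₐ[ℂ] G ⊗[ℂ] G).toLinearMap.comp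
        (antipode ℂ)) LinearMap.id))
  have hf : ∀ (x : G ⊗[ℂ] G) (c : G), f (leg12 x * (1 ⊗ₜ[ℂ] (1 ⊗ₜ[ℂ] c))) =
      (antipodeMul x ⊗ₜ[ℂ] c) * comul (R := ℂ) Λ := by
    intro x c
    induction x using TensorProduct.induction_on with
    | zero => simp
    | tmul a b => simp [f]
    | add a b ha hb => simp only [map_add, add_mul, ha, hb, TensorProduct.add_tmul]
  have h1 := coassoc_eval f ((LinearMap.mulRight ℂ (comul (R := ℂ) Λ)).comp
    ((TensorProduct.mk ℂ G G 1).comp (component counit))) (fun a c => by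
      simp [hf, antipodeMul_comul, Algebra.algebraMap_eq_smul_one, TensorProduct.smul_tmul']) h
  rw [mapSnd_comul_eval f ((LinearMap.mulRight ℂ (comul (R := ℂ) Λ)).comp
    (((TensorProduct.mk ℂ G G).flip 1).comp ((antipode ℂ).comp (rightComponent counit))))
    (fun a b => by
      simp [f, mul_assoc, ← Bialgebra.comul_mul, hΛ.left])] at h1
  simpa [component_counit_comul, rightComponent_counit_comul] using h1.symm

/-- The mirror argument with Δ(Λ)(h₁ ⊗ h₂)(1 ⊗ S(h₃)). It lets a factor move from one leg to the
other behind Δ(Λ), which drives the dimension bound. -/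
lemma comul_mul_tmul_one (hΛ : IsIntegral Λ) (h : G) :
    comul (R := ℂ) Λ * (h ⊗ₜ[ℂ] (1 : G)) =
      comul (R := ℂ) Λ * ((1 : G) ⊗ₜ[ℂ] antipode ℂ h) := by
  let f : G ⊗[ℂ] (G ⊗[ℂ] G) →ₗ[ℂ] G ⊗[ℂ] G :=
    (LinearMap.mulLeft ℂ (comul (R := ℂ) Λ)).comp (mulAntipode.lTensor G)
  have hf : ∀ (x : G ⊗[ℂ] G) (c : G), f (leg12 x * (1 ⊗ₜ[ℂ] (1 ⊗ₜ[ℂ] c))) =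
      comul (R := ℂ) Λ * x * ((1 : G) ⊗ₜ[ℂ] antipode ℂ c) := by
    intro x c
    induction x using TensorProduct.induction_on with
    | zero => simp
    | tmul a b => simp [f, mul_assoc]
    | add a b ha hb => simp only [map_add, add_mul, mul_add, ha, hb]
  have h1 := coassoc_eval f ((LinearMap.mulLeft ℂ (comul (R := ℂ) Λ)).comp
    ((TensorProduct.mk ℂ G G 1).comp ((antipode ℂ).comp (component counit)))) (fun a c => by
      rw [hf, ← Bialgebra.comul_mul, hΛ.right]; simp) h
  rw [mapSnd_comul_eval f ((LinearMap.mulLeft ℂ (comul (R := ℂ) Λ)).comp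
    (((TensorProduct.mk ℂ G G).flip 1).comp (rightComponent counit)))
    (fun a b => by
      simp [f, mulAntipode_comul, Algebra.algebraMap_eq_smul_one, TensorProduct.smul_tmul'])] at h1
  simpa [component_counit_comul, rightComponent_counit_comul] using h1

/-- The second legs of `Δ(Λ)` span `G`. -/
lemma eq_top_of_component_mem [FiniteDimensional ℂ G] (hΛ : IsIntegral Λ) (K : Submodule ℂ G)
    (hK : ∀ φ : Module.Dual ℂ G, component φ (comul (R := ℂ) Λ) ∈ K) : K = ⊤ := by
  -- By `one_tmul_mul_comul`, left multiplication by g only changes the linear form.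
  have hmul : ∀ (g : G) (φ : Module.Dual ℂ G), g * component φ (comul (R := ℂ) Λ) ∈ K := by
    intro g φ
    have e1 : ∀ x : G ⊗[ℂ] G, g * component φ x = component φ (((1 : G) ⊗ₜ[ℂ] g) * x) := by
      intro x
      induction x using TensorProduct.induction_on with
      | zero => simp
      | tmul a b => simp
      | add a b ha hb => simp only [map_add, mul_add, ha, hb]
    have e2 : ∀ x : G ⊗[ℂ] G, component φ ((antipode ℂ g ⊗ₜ[ℂ] (1 : G)) * x) =
        component (φ.comp (LinearMap.mulLeft ℂ (antipode ℂ g))) x := by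
      intro x
      induction x using TensorProduct.induction_on with
      | zero => simp
      | tmul a b => simp
      | add a b ha hb => simp only [map_add, mul_add, ha, hb]
    rw [e1, hΛ.one_tmul_mul_comul, e2]
    exact hK _
  rw [eq_top_iff]
  intro g _
  -- Since ε(Λ) = 1, g = ∑ g S(Λ₁) Λ₂ is a sum of left multiples of second legs.
  have h1 := antipodeMul_comul Λ
  rw [hΛ.counit_eq, map_one] at h1
  have h2 : g = g * antipodeMul (comul (R := ℂ) Λ) := by rw [h1, mul_one]
  rw [tensor_eq_sum_component (Module.finBasis ℂ G) (comul (R := ℂ) Λ), map_sum,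
    Finset.mul_sum] at h2
  rw [h2]
  refine K.sum_mem fun i _ => ?_
  rw [antipodeMul_tmul, ← mul_assoc]
  exact hmul _ _

lemma mulAntipode_comul_eq_one (hΛ : IsIntegral Λ) : mulAntipode (comul (R := ℂ) Λ) = 1 := by
  rw [mulAntipode_comul, hΛ.counit_eq, map_one]

end IsIntegral

end IntegralCalculus

/-! ### From an integral in the image of N to surjectivity. -/

section Factorizable

variable {G : Type*} [Ring G] [HopfAlgebra ℂ G]

lemma comul_rightComponent (π : Module.Dual ℂ G) (x : G ⊗[ℂ] G) :
    comul (R := ℂ) (rightComponent π x) = (rightComponent π).lTensor G (comulFirst x) := by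
  induction x using TensorProduct.induction_on with
  | zero => simp
  | tmul a b =>
    have e : ∀ z : G ⊗[ℂ] G, π b • z =
        (rightComponent π).lTensor G (leg12 z * (1 ⊗ₜ[ℂ] (1 ⊗ₜ[ℂ] b))) := by
      intro z
      induction z using TensorProduct.induction_on with
      | zero => simp
      | tmul c d => simp
      | add c d hc hd => simp only [map_add, smul_add, add_mul, hc, hd]
    rw [comulFirst_tmul, ← e]
    simp
  | add a b ha hb => simp [ha, hb]

/-- The image of π ↦ (id ⊗ π)(N) contains the second legs of Δ(Λ): by (Δ ⊗ id)(N) = R₁₃N₂₃R'₁₃,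
contracting legs 1 and 3 leaves some (id ⊗ π)(N). These second legs span G. -/
lemma RibbonStructure.rightComponent_N_surjective [StarRing G] [StarModule ℂ G]
    [FiniteDimensional ℂ G] (𝓡 : RibbonStructure G)
    {Λ : G} (hΛ : IsIntegral Λ) (π₀ : Module.Dual ℂ G)
    (hπ₀ : rightComponent π₀ (𝓡.N : G ⊗[ℂ] G) = Λ) (g : G) :
    ∃ π : Module.Dual ℂ G, rightComponent π (𝓡.N : G ⊗[ℂ] G) = g := by
  let Q : Module.Dual ℂ G →ₗ[ℂ] G :=
    { toFun := fun π => rightComponent π (𝓡.N : G ⊗[ℂ] G)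
      map_add' := fun π φ => by simp [rightComponent, TensorProduct.map_add_right]
      map_smul' := fun c π => by simp [rightComponent, TensorProduct.map_smul_right] }
  suffices h : LinearMap.range Q = ⊤ from LinearMap.range_eq_top.1 h g
  refine hΛ.eq_top_of_component_mem _ fun φ => ?_
  have e0 : ∀ (a b c d : G) (n : G ⊗[ℂ] G),
      component φ ((rightComponent π₀).lTensor G
        (leg1 (a ⊗ₜ b) * leg2 n * leg1 (c ⊗ₜ d))) =
      rightComponent (φ (a * c) • π₀.comp ((LinearMap.mulLeft ℂ b).comp
        (LinearMap.mulRight ℂ d))) n := by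
    intro a b c d n
    induction n using TensorProduct.induction_on with
    | zero => simp
    | tmul m n => simp [mul_assoc, smul_smul, mul_comm]
    | add m n hm hn => simp only [map_add, mul_add, add_mul, hm, hn]
  have e1 : ∀ x y : G ⊗[ℂ] G, component φ ((rightComponent π₀).lTensor G
      (leg1 x * leg2 (𝓡.N : G ⊗[ℂ] G) * leg1 y)) ∈ LinearMap.range Q := by
    intro x y
    induction x using TensorProduct.induction_on with
    | zero => simp
    | tmul a b =>
      induction y using TensorProduct.induction_on with
      | zero => simp
      | tmul c d => rw [e0]; exact ⟨_, rfl⟩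
      | add c d hc hd => simp only [map_add, mul_add]; exact Submodule.add_mem _ hc hd
    | add a b ha hb => simp only [map_add, add_mul]; exact Submodule.add_mem _ ha hb
  rw [← hπ₀, comul_rightComponent, RibbonStructure.comulFirst_N]
  exact e1 _ _

end Factorizable

/-! ### Modularity puts the integral in the image of N. -/

section Modular

variable {G : Type u₁} [Ring G] [HopfAlgebra ℂ G] [StarRing G] [StarModule ℂ G]
variable {I : Type u₂} {V : I → Type u₃}
  [∀ i, NormedAddCommGroup (V i)] [∀ i, InnerProductSpace ℂ (V i)]
  [∀ i, FiniteDimensional ℂ (V i)] [∀ i, CompleteSpace (V i)]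
  {τ : ∀ i, G →⋆ₐ[ℂ] (V i →L[ℂ] V i)}

variable (G) in
lemma nontrivial_of_hopf : Nontrivial G := by
  refine ⟨1, 0, fun h => ?_⟩
  have := congrArg (counit (R := ℂ)) h
  simp at this

namespace IsIrrepSystem

lemma nonempty (hτ : IsIrrepSystem τ) : Nonempty I := by
  have := nontrivial_of_hopf G
  obtain ⟨m, hm⟩ := Ideal.exists_maximal G
  have : IsSimpleModule G (G ⧸ m) := isSimpleModule_iff_isCoatom.2 hm.1
  obtain ⟨i, -⟩ := hτ.complete (G ⧸ m)
  exact ⟨i⟩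

/-- G is the sum of its simple left ideals, and an element acting as zero in every irreducible kills
each of them, hence kills 1. -/
lemma faithful [IsSemisimpleRing G] (hτ : IsIrrepSystem τ) {x : G} (hx : ∀ i, τ i x = 0) :
    x = 0 := by
  have h1 : (1 : G) ∈ ⨆ m : {m : Submodule G G | IsSimpleModule G m}, (m : Submodule G G) := by
    rw [← sSup_eq_iSup', IsSemisimpleModule.sSup_simples_eq_top G G]
    trivial
  rw [← mul_one x]
  refine Submodule.iSup_induction _ (motive := fun y => x * y = 0) h1 ?_ (mul_zero x) ?_
  · rintro ⟨m, hm⟩ y hy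
    have : IsSimpleModule G m := hm
    obtain ⟨i, e, he⟩ := hτ.complete m
    have h2 : x • (⟨y, hy⟩ : m) = 0 := e.injective (by rw [he, hx, map_zero]; rfl)
    exact congrArg Subtype.val h2
  · intro a b ha hb
    rw [mul_add, ha, hb, add_zero]

lemma exists_smul_of_central (hτ : IsIrrepSystem τ) {z : G} (hz : ∀ h, z * h = h * z) (i : I) :
    ∃ c : ℂ, τ i z = c • 1 := by
  have := hτ.nontrivial i
  obtain ⟨c, hc⟩ := Module.End.exists_eigenvalue ((τ i z : V i →L[ℂ] V i) : V i →ₗ[ℂ] V i)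
  refine ⟨c, ?_⟩
  have hmem : ∀ x, x ∈ Module.End.eigenspace ((τ i z : V i →L[ℂ] V i) : V i →ₗ[ℂ] V i) c ↔
      τ i z x = c • x := fun x => Module.End.mem_eigenspace_iff
  rcases hτ.irreducible i (Module.End.eigenspace ((τ i z : V i →L[ℂ] V i) : V i →ₗ[ℂ] V i) c)
    (fun ξ x hx => by
      rw [hmem] at hx ⊢
      have : τ i z (τ i ξ x) = τ i ξ (τ i z x) := by
        rw [← mul_apply_eq_comp, ← mul_apply_eq_comp, ← map_mul,
          ← map_mul, hz]
      rw [this, hx, map_smul]) with h | h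
  · exact absurd h hc
  · ext x
    have : x ∈ Module.End.eigenspace ((τ i z : V i →L[ℂ] V i) : V i →ₗ[ℂ] V i) c := by
      rw [h]; trivial
    simpa using (hmem x).1 this

end IsIrrepSystem

/-- The character of `τ i`. -/
def character (τ : ∀ i, G →⋆ₐ[ℂ] (V i →L[ℂ] V i)) (i : I) : Module.Dual ℂ G :=
  (LinearMap.trace ℂ (V i)).comp ((ContinuousLinearMap.coeLM ℂ).comp (τ i).toAlgHom.toLinearMap)

lemma character_mul_comm (i : I) (x y : G) : character τ i (x * y) = character τ i (y * x) := by
  simp only [character, LinearMap.comp_apply, AlgHom.toLinearMap_apply, map_mul]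
  exact LinearMap.trace_mul_comm ℂ _ _

/-- The quantum character of `τ i`. -/
def qCharacter (𝓡 : RibbonStructure G) (τ : ∀ i, G →⋆ₐ[ℂ] (V i →L[ℂ] V i)) (i : I) :
    Module.Dual ℂ G :=
  (character τ i).comp (LinearMap.mulRight ℂ 𝓡.wElt)

lemma qTrace_apply (𝓡 : RibbonStructure G) (i : I) (x : G) :
    qTrace 𝓡 τ i (τ i x) = qCharacter 𝓡 τ i x := by
  simp only [qTrace, qCharacter, character, LinearMap.comp_apply, LinearMap.mulRight_apply,
    AlgHom.toLinearMap_apply, map_mul]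
  rfl

lemma sMatrix_apply [Fintype I] (𝓡 : RibbonStructure G) (i j : I) : sMatrix 𝓡 τ i j =
    qCharacter 𝓡 τ j (rightComponent (qCharacter 𝓡 τ i) (𝓡.N : G ⊗[ℂ] G)) := by
  have e : ∀ x : G ⊗[ℂ] G, LinearMap.mul' ℂ ℂ
      (TensorProduct.map (qTrace 𝓡 τ i) (qTrace 𝓡 τ j)
        (Algebra.TensorProduct.map (τ i).toAlgHom (τ j).toAlgHom (flip x))) =
      qCharacter 𝓡 τ j (rightComponent (qCharacter 𝓡 τ i) x) := by
    intro x
    induction x using TensorProduct.induction_on with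
    | zero => simp
    | tmul a b =>
      simp only [flip_tmul, Algebra.TensorProduct.map_tmul, TensorProduct.map_tmul,
        LinearMap.mul'_apply, rightComponent_tmul, map_smul, smul_eq_mul]
      rw [← qTrace_apply, ← qTrace_apply]
      rfl
    | add a b ha hb => simp only [map_add, ha, hb]
  rw [← e, RibbonStructure.N_eq, map_mul flip, flip_flip]
  rfl

/-- `Ring.inverse` is 0 on non-units, so a non-invertible u would give w = 0 and a vanishing
S-matrix of nonzero size. -/
lemma isUnit_uElt [Fintype I] [DecidableEq I] (𝓡 : RibbonStructure G) (hτ : IsIrrepSystem τ)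
    (hmodular : IsUnit (sMatrix 𝓡 τ)) : IsUnit 𝓡.uElt := by
  by_contra hu
  have hw : 𝓡.wElt = 0 := by
    refine Ring.inverse_non_unit _ fun h => hu ?_
    have := (𝓡.v⁻¹).isUnit.unit.isUnit_units_mul 𝓡.uElt
    exact this.1 h
  have := hτ.nonempty
  have h0 : sMatrix 𝓡 τ = 0 := by
    ext i j
    rw [sMatrix_apply]
    simp [qCharacter, hw]
  rw [h0] at hmodular
  exact not_isUnit_zero hmodular

/-- Here w = u⁻¹v, and cyclicity turns tr(S(h₁) x h₂ w) into tr(x h₂ u⁻¹ S(h₁) v), where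
`sandwich_inv_uElt` applies. -/
lemma qCharacter_invariant (𝓡 : RibbonStructure G) (hu : IsUnit 𝓡.uElt) (i : I) (h x : G) :
    qCharacter 𝓡 τ i (sandwich (antipode ℂ) LinearMap.id (comul (R := ℂ) h) x) =
      counit (R := ℂ) h * qCharacter 𝓡 τ i x := by
  obtain ⟨u, hu⟩ := hu
  have hw : 𝓡.wElt = ((u⁻¹ : Gˣ) : G) * 𝓡.v := by
    have : 𝓡.wElt = Ring.inverse ((𝓡.v⁻¹ * u : Gˣ) : G) := by
      rw [Units.val_mul, hu]; rfl
    rw [this, Ring.inverse_unit]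
    simp
  have hv : ∀ y : G, y * (𝓡.v : G) = 𝓡.v * y := Subalgebra.mem_center_iff.1 𝓡.v_central
  have e1 : ∀ y : G ⊗[ℂ] G, qCharacter 𝓡 τ i (sandwich (antipode ℂ) LinearMap.id y x) =
      character τ i (x * (sandwich LinearMap.id (antipode ℂ) (flip y) ((u⁻¹ : Gˣ) : G) * 𝓡.v)) := by
    intro y
    induction y using TensorProduct.induction_on with
    | zero => simp
    | tmul a b =>
      simp only [sandwich_tmul, flip_tmul, LinearMap.id_coe, id_eq, qCharacter,
        LinearMap.comp_apply, LinearMap.mulRight_apply, hw]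
      rw [mul_assoc, mul_assoc, character_mul_comm]
      congr 1
      simp only [mul_assoc]
      rw [← hv (antipode ℂ a)]
    | add a b ha hb => simp only [map_add, LinearMap.add_apply, add_mul, mul_add, ha, hb]
  rw [e1, 𝓡.sandwich_inv_uElt hu]
  simp [qCharacter, hw, mul_assoc]

/-- The elements (id ⊗ χ)(N), χ a quantum character, are central, and the S-matrix lists their
quantum traces. Central elements are determined by quantum traces, so inverting the matrix reaches
Λ. -/
lemma exists_rightComponent_N_eq [Fintype I] [DecidableEq I] [IsSemisimpleRing G]
    (𝓡 : RibbonStructure G) (hτ : IsIrrepSystem τ) (hmodular : IsUnit (sMatrix 𝓡 τ))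
    {Λ : G} (hΛ : IsIntegral Λ) :
    ∃ π : Module.Dual ℂ G, rightComponent π (𝓡.N : G ⊗[ℂ] G) = Λ := by
  have hu := isUnit_uElt 𝓡 hτ hmodular
  have hcentral : ∀ i h, rightComponent (qCharacter 𝓡 τ i) (𝓡.N : G ⊗[ℂ] G) * h =
      h * rightComponent (qCharacter 𝓡 τ i) (𝓡.N : G ⊗[ℂ] G) := fun i h =>
    𝓡.commute_rightComponent_N _ (qCharacter_invariant 𝓡 hu i) h
  have hscalar : ∀ (j : I) (z : G) (c : ℂ), τ j z = c • 1 →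
      qCharacter 𝓡 τ j z = c * character τ j 𝓡.wElt := by
    intro j z c hc
    have : τ j (z * 𝓡.wElt) = c • τ j 𝓡.wElt := by rw [map_mul, hc]; simp
    change character τ j (z * 𝓡.wElt) = _
    change LinearMap.trace ℂ (V j) ((τ j (z * 𝓡.wElt) : V j →L[ℂ] V j) : V j →ₗ[ℂ] V j) = _
    rw [this]
    simp [character]
  -- A vanishing quantum dimension would produce a zero column of the S-matrix.
  have hdim : ∀ j, character τ j 𝓡.wElt ≠ 0 := by
    intro j hj
    have h0 : (sMatrix 𝓡 τ).mulVec (Pi.single j 1) = 0 := by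
      ext i
      obtain ⟨c, hc⟩ := hτ.exists_smul_of_central (hcentral i) j
      rw [Matrix.mulVec_single_one, Matrix.col_apply, sMatrix_apply, hscalar j _ c hc, hj, mul_zero]
      rfl
    have h1 : (Pi.single j 1 : I → ℂ) = 0 :=
      Matrix.mulVec_injective_of_isUnit hmodular (by rw [h0, Matrix.mulVec_zero])
    have := congrFun h1 j
    simp at this
  obtain ⟨c, hc⟩ : ∃ c : I → ℂ, Matrix.vecMul c (sMatrix 𝓡 τ) =
      fun j => qCharacter 𝓡 τ j Λ :=
    ⟨Matrix.vecMul (fun j => qCharacter 𝓡 τ j Λ) (sMatrix 𝓡 τ)⁻¹, by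
      rw [Matrix.vecMul_vecMul,
        Matrix.nonsing_inv_mul _ ((Matrix.isUnit_iff_isUnit_det _).1 hmodular),
        Matrix.vecMul_one]⟩
  -- With these coefficients the difference to Λ is central and has zero quantum trace in every
  -- irreducible.
  refine ⟨∑ i, c i • qCharacter 𝓡 τ i, ?_⟩
  have hsum : rightComponent (∑ i, c i • qCharacter 𝓡 τ i) (𝓡.N : G ⊗[ℂ] G) =
      ∑ i, c i • rightComponent (qCharacter 𝓡 τ i) (𝓡.N : G ⊗[ℂ] G) := by
    generalize (𝓡.N : G ⊗[ℂ] G) = x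
    induction x using TensorProduct.induction_on with
    | zero => simp
    | tmul a b => simp [Finset.sum_smul, smul_smul]
    | add a b ha hb => simp only [map_add, smul_add, Finset.sum_add_distrib, ha, hb]
  rw [hsum, ← sub_eq_zero]
  refine hτ.faithful fun j => ?_
  have hz : ∀ h, (∑ i, c i • rightComponent (qCharacter 𝓡 τ i) (𝓡.N : G ⊗[ℂ] G) - Λ) * h =
      h * (∑ i, c i • rightComponent (qCharacter 𝓡 τ i) (𝓡.N : G ⊗[ℂ] G) - Λ) := by
    intro h
    rw [sub_mul, mul_sub, hΛ.left, hΛ.right, Finset.sum_mul, Finset.mul_sum]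
    simp only [smul_mul_assoc, mul_smul_comm, hcentral]
  obtain ⟨d, hd⟩ := hτ.exists_smul_of_central hz j
  have h1 := hscalar j _ d hd
  have h2 := congrFun hc j
  simp only [Matrix.vecMul, dotProduct, sMatrix_apply] at h2
  rw [map_sub, map_sum] at h1
  simp only [map_smul, smul_eq_mul] at h1
  rw [h2, sub_self] at h1
  rw [hd, (mul_eq_zero.1 h1.symm).resolve_right (hdim j), zero_smul]

end Modular

/-! ### Leg calculus for linear maps, needed before ι is known to be multiplicative. -/

section LinearLegs

variable {G : Type*} [Ring G] [HopfAlgebra ℂ G]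
variable {X : Type*} [Ring X] [Algebra ℂ X] {Y : Type*} [Ring Y] [Algebra ℂ Y]

lemma lTensor_comulFirst (f : X →ₗ[ℂ] Y) (y : G ⊗[ℂ] X) :
    (f.lTensor G).lTensor G (comulFirst y) = comulFirst (f.lTensor G y) := by
  induction y using TensorProduct.induction_on with
  | zero => simp
  | tmul a b =>
    rw [LinearMap.lTensor_tmul, comulFirst_tmul, comulFirst_tmul]
    induction comul (R := ℂ) a using TensorProduct.induction_on with
    | zero => simp
    | tmul c d => simp
    | add c d hc hd => simp only [map_add, add_mul, hc, hd]
  | add a b ha hb => simp only [map_add, ha, hb]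

lemma lTensor_leg1 (f : X →ₗ[ℂ] Y) (y : G ⊗[ℂ] X) :
    (f.lTensor G).lTensor G (leg1 y) = leg1 (f.lTensor G y) := by
  induction y using TensorProduct.induction_on with
  | zero => simp
  | tmul a b => simp
  | add a b ha hb => simp only [map_add, ha, hb]

lemma lTensor_leg12_mul (f : X →ₗ[ℂ] Y) (z : G ⊗[ℂ] G) (y : G ⊗[ℂ] (G ⊗[ℂ] X)) :
    (f.lTensor G).lTensor G (leg12 z * y) = leg12 z * (f.lTensor G).lTensor G y := by
  induction y using TensorProduct.induction_on with
  | zero => simp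
  | tmul a b =>
    induction b using TensorProduct.induction_on with
    | zero => simp
    | tmul b c =>
      induction z using TensorProduct.induction_on with
      | zero => simp
      | tmul d e => simp
      | add d e hd he => simp only [map_add, add_mul, hd, he]
    | add b c hb hc => simp only [TensorProduct.tmul_add, map_add, mul_add, hb, hc]
  | add a b ha hb => simp only [map_add, mul_add, ha, hb]

lemma lTensor_mul_leg12 (f : X →ₗ[ℂ] Y) (z : G ⊗[ℂ] G) (y : G ⊗[ℂ] (G ⊗[ℂ] X)) :
    (f.lTensor G).lTensor G (y * leg12 z) = (f.lTensor G).lTensor G y * leg12 z := by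
  induction y using TensorProduct.induction_on with
  | zero => simp
  | tmul a b =>
    induction b using TensorProduct.induction_on with
    | zero => simp
    | tmul b c =>
      induction z using TensorProduct.induction_on with
      | zero => simp
      | tmul d e => simp
      | add d e hd he => simp only [map_add, mul_add, hd, he]
    | add b c hb hc => simp only [TensorProduct.tmul_add, map_add, add_mul, hb, hc]
  | add a b ha hb => simp only [map_add, add_mul, ha, hb]

lemma component_lTensor (f : X →ₗ[ℂ] Y) (π : Module.Dual ℂ G) (y : G ⊗[ℂ] X) :
    component π (f.lTensor G y) = f (component π y) := by
  induction y using TensorProduct.induction_on with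
  | zero => simp
  | tmul a b => simp
  | add a b ha hb => simp only [map_add, ha, hb]

/-- `component` as a linear function of the linear form. -/
def components (y : G ⊗[ℂ] X) : Module.Dual ℂ G →ₗ[ℂ] X where
  toFun π := component π y
  map_add' π φ := by simp [component, TensorProduct.map_add_left]
  map_smul' c π := by simp [component, TensorProduct.map_smul_left]

@[simp] lemma components_apply (y : G ⊗[ℂ] X) (π : Module.Dual ℂ G) :
    components y π = component π y := rfl

lemma component_mapSnd (f : X →ₐ[ℂ] Y) (π : Module.Dual ℂ G) (y : G ⊗[ℂ] X) :
    component π (mapSnd f y) = f (component π y) :=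
  component_lTensor f.toLinearMap π y

lemma component_mul_one_tmul (π : Module.Dual ℂ G) (y : G ⊗[ℂ] X) (x : X) :
    component π (y * ((1 : G) ⊗ₜ[ℂ] x)) = component π y * x := by
  induction y using TensorProduct.induction_on with
  | zero => simp
  | tmul a b => simp
  | add a b ha hb => simp only [map_add, add_mul, ha, hb]

lemma component_one_tmul_mul (π : Module.Dual ℂ G) (y : G ⊗[ℂ] X) (x : X) :
    component π (((1 : G) ⊗ₜ[ℂ] x) * y) = x * component π y := by
  induction y using TensorProduct.induction_on with
  | zero => simp
  | tmul a b => simp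
  | add a b ha hb => simp only [map_add, mul_add, ha, hb]

lemma component_leg1 (π : Module.Dual ℂ G) (y : G ⊗[ℂ] X) :
    component π (leg1 y) = (1 : G) ⊗ₜ[ℂ] component π y := by
  induction y using TensorProduct.induction_on with
  | zero => simp
  | tmul a b => simp
  | add a b ha hb => simp only [map_add, TensorProduct.tmul_add, ha, hb]

lemma component_leg2_mul_leg1 (π φ : Module.Dual ℂ G) (x y : G ⊗[ℂ] X) :
    component π (component φ (leg2 x * leg1 y)) = component π x * component φ y := by
  rw [leg2_apply, component_one_tmul_mul, component_leg1, component_mul_one_tmul]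

lemma ext_component [FiniteDimensional ℂ G] {x y : G ⊗[ℂ] X}
    (h : ∀ π : Module.Dual ℂ G, component π x = component π y) : x = y := by
  rw [tensor_eq_sum_component (Module.finBasis ℂ G) x,
    tensor_eq_sum_component (Module.finBasis ℂ G) y]
  simp only [h]

lemma dual_component (π φ : Module.Dual ℂ G) (x : G ⊗[ℂ] G) :
    φ (component π x) = π (rightComponent φ x) := by
  induction x using TensorProduct.induction_on with
  | zero => simp
  | tmul a b => simp [mul_comm]
  | add a b ha hb => simp only [map_add, ha, hb]

lemma leg12_commute (z : G ⊗[ℂ] G) (x : X) :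
    leg12 z * ((1 : G) ⊗ₜ[ℂ] ((1 : G) ⊗ₜ[ℂ] x)) = ((1 : G) ⊗ₜ[ℂ] ((1 : G) ⊗ₜ[ℂ] x)) * leg12 z := by
  induction z using TensorProduct.induction_on with
  | zero => simp
  | tmul a b => simp
  | add a b ha hb => simp only [map_add, mul_add, add_mul, ha, hb]

/-- `r` intertwines `Δ` and `Δ'` also after applying `Δ_a`. -/
lemma swap12_comulFirst_mul {r : G ⊗[ℂ] G}
    (hr : ∀ ξ, r * comul (R := ℂ) ξ = flip (comul (R := ℂ) ξ) * r) (y : G ⊗[ℂ] X) :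
    swap12 (comulFirst y) * leg12 r = leg12 r * comulFirst y := by
  induction y using TensorProduct.induction_on with
  | zero => simp
  | tmul a b =>
    rw [comulFirst_tmul, map_mul, swap12_leg12, swap12_tmul, mul_assoc, ← leg12_commute,
      ← mul_assoc, ← map_mul, ← hr, map_mul, mul_assoc]
  | add a b ha hb => simp only [map_add, mul_add, add_mul, ha, hb]

/-- `x ⊗ y ↦ (z ↦ x₁ z y₂)`. -/
def outerSandwich : G ⊗[ℂ] G →ₗ[ℂ] G ⊗[ℂ] (G ⊗[ℂ] X) →ₗ[ℂ] G ⊗[ℂ] (G ⊗[ℂ] X) :=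
  sandwich (Algebra.TensorProduct.includeLeft : G →ₐ[ℂ] G ⊗[ℂ] (G ⊗[ℂ] X)).toLinearMap
    (leg2.comp (Algebra.TensorProduct.includeLeft : G →ₐ[ℂ] G ⊗[ℂ] X)).toLinearMap

/-- The inserted factors slide past the outer terms and meet r. With z = (id ⊗ S)(R) and r = R the
middle factor becomes 1, which strips R₁₂ from the fusion relation. -/
lemma outerSandwich_leg (z r : G ⊗[ℂ] G) (x y : G ⊗[ℂ] X) :
    outerSandwich z (leg2 x * leg12 r * leg1 y) = leg2 x * leg12 (sandwich
      (Algebra.TensorProduct.includeLeft : G →ₐ[ℂ] G ⊗[ℂ] G).toLinearMap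
      (Algebra.TensorProduct.includeRight : G →ₐ[ℂ] G ⊗[ℂ] G).toLinearMap z r) * leg1 y := by
  induction z using TensorProduct.induction_on with
  | zero => simp
  | tmul a b =>
    have h1 : (a ⊗ₜ[ℂ] (1 : G ⊗[ℂ] X)) * leg2 x = leg2 x * (a ⊗ₜ[ℂ] (1 : G ⊗[ℂ] X)) := by simp
    have h2 : leg1 y * ((1 : G) ⊗ₜ[ℂ] (b ⊗ₜ[ℂ] (1 : X))) =
        ((1 : G) ⊗ₜ[ℂ] (b ⊗ₜ[ℂ] (1 : X))) * leg1 y := by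
      induction y using TensorProduct.induction_on with
      | zero => simp
      | tmul a b => simp
      | add a b ha hb => simp only [map_add, mul_add, add_mul, ha, hb]
    have h3 : (a ⊗ₜ[ℂ] (1 : G ⊗[ℂ] X)) = leg12 (a ⊗ₜ[ℂ] (1 : G)) := by
      simp [Algebra.TensorProduct.one_def]
    have h4 : ((1 : G) ⊗ₜ[ℂ] (b ⊗ₜ[ℂ] (1 : X))) = leg12 ((1 : G) ⊗ₜ[ℂ] b) := by simp
    simp only [outerSandwich, sandwich_tmul, AlgHom.toLinearMap_apply, AlgHom.comp_apply,
      Algebra.TensorProduct.includeLeft_apply, Algebra.TensorProduct.includeRight_apply, map_mul]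
    rw [leg2_apply (b ⊗ₜ[ℂ] (1 : X)), ← h3, ← h4, mul_assoc, mul_assoc, mul_assoc, h2]
    simp only [← mul_assoc]
    rw [h1]
  | add a b ha hb => simp only [map_add, mul_add, add_mul, LinearMap.add_apply, ha, hb]

lemma lTensor_outerSandwich (f : X →ₗ[ℂ] Y) (z : G ⊗[ℂ] G) (y : G ⊗[ℂ] (G ⊗[ℂ] X)) :
    (f.lTensor G).lTensor G (outerSandwich z y) =
      outerSandwich z ((f.lTensor G).lTensor G y) := by
  induction z using TensorProduct.induction_on with
  | zero => simp
  | tmul a b =>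
    have h3 : (a ⊗ₜ[ℂ] (1 : G ⊗[ℂ] X)) = leg12 (a ⊗ₜ[ℂ] (1 : G)) := by
      simp [Algebra.TensorProduct.one_def]
    have h4 : leg2 (b ⊗ₜ[ℂ] (1 : X)) = leg12 ((1 : G) ⊗ₜ[ℂ] b) := by simp
    simp only [outerSandwich, sandwich_tmul, AlgHom.toLinearMap_apply, AlgHom.comp_apply,
      Algebra.TensorProduct.includeLeft_apply]
    have h5 : (a ⊗ₜ[ℂ] (1 : G ⊗[ℂ] Y)) = leg12 (a ⊗ₜ[ℂ] (1 : G)) := by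
      simp [Algebra.TensorProduct.one_def]
    have h6 : leg2 (b ⊗ₜ[ℂ] (1 : Y)) = leg12 ((1 : G) ⊗ₜ[ℂ] b) := by simp
    rw [h3, h4, lTensor_mul_leg12, lTensor_leg12_mul, h5, h6]
  | add a b ha hb => simp only [map_add, LinearMap.add_apply, ha, hb]

end LinearLegs

section Counit

variable {G : Type*} [Ring G] [HopfAlgebra ℂ G] [StarRing G] [StarModule ℂ G]

lemma counitFirst_leg1 {X : Type*} [Ring X] [Algebra ℂ X] (y : G ⊗[ℂ] X) :
    counitFirst (leg1 y) = (1 : G) ⊗ₜ[ℂ] counitFirst y := by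
  rw [counitFirst_eq_component, counitFirst_eq_component, component_leg1]

lemma counitFirst_leg2 {X : Type*} [Ring X] [Algebra ℂ X] (y : G ⊗[ℂ] X) :
    counitFirst (leg2 y) = y := by
  simp

lemma RibbonStructure.counitFirst_R (𝓡 : RibbonStructure G) :
    counitFirst (𝓡.R : G ⊗[ℂ] G) = 1 := by
  have h := congrArg counitFirst 𝓡.comul_id_R
  rw [counitFirst_comulFirst, map_mul, counitFirst_leg1, counitFirst_leg2] at h
  have h2 : (1 : G) ⊗ₜ[ℂ] counitFirst (𝓡.R : G ⊗[ℂ] G) = 1 := by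
    have := congrArg (· * ((𝓡.R⁻¹ : (G ⊗[ℂ] G)ˣ) : G ⊗[ℂ] G)) h
    simpa [mul_assoc] using this.symm
  have h3 := congrArg counitFirst h2
  simpa using h3

lemma RibbonStructure.counitFirst_N (𝓡 : RibbonStructure G) :
    counitFirst (𝓡.N : G ⊗[ℂ] G) = 1 := by
  have h : ∀ x : G ⊗[ℂ] G, counitFirst (flip x) = rightComponent counit x := by
    intro x
    induction x using TensorProduct.induction_on with
    | zero => simp
    | tmul a b => simp
    | add a b ha hb => simp only [map_add, ha, hb]
  rw [N_eq, map_mul, counitFirst_R, h, rightComponent_counit_R, one_mul]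

end Counit

/-! ### Consequences of the defining relations in an arbitrary algebra -/

section Solutions

variable {G : Type*} [Ring G] [HopfAlgebra ℂ G] [StarRing G] [StarModule ℂ G]
  {𝓡 : RibbonStructure G} {F : (G ⊗[ℂ] (G ⊗[ℂ] Center G))ˣ}
  {σ : Center G →ₐ[ℂ] G ⊗[ℂ] Center G}
  {B : Type*} [Ring B] [Algebra ℂ B] {j : Center G →ₐ[ℂ] B} {Φ : (G ⊗[ℂ] B)ˣ}

lemma center_mul_comm (f g : Center G) : f * g = g * f :=
  Subtype.ext ((Subalgebra.mem_center_iff.1 f.2 (g : G)).symm)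

lemma center_right_commute (x : G ⊗[ℂ] Center G) (f : Center G) :
    x * ((1 : G) ⊗ₜ[ℂ] f) = ((1 : G) ⊗ₜ[ℂ] f) * x := by
  induction x using TensorProduct.induction_on with
  | zero => simp
  | tmul a b => simp [center_mul_comm b f]
  | add a b ha hb => simp only [mul_add, add_mul, ha, hb]

lemma center_right_commute₂ (x : G ⊗[ℂ] (G ⊗[ℂ] Center G)) (f : Center G) :
    x * ((1 : G) ⊗ₜ[ℂ] ((1 : G) ⊗ₜ[ℂ] f)) = ((1 : G) ⊗ₜ[ℂ] ((1 : G) ⊗ₜ[ℂ] f)) * x := by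
  induction x using TensorProduct.induction_on with
  | zero => simp
  | tmul a b => simp [center_right_commute b f]
  | add a b ha hb => simp only [mul_add, add_mul, ha, hb]

lemma tmul_one_commute {X : Type*} [Ring X] [Algebra ℂ X] {z : G}
    (hz : z ∈ Subalgebra.center ℂ G) (x : G ⊗[ℂ] X) :
    (z ⊗ₜ[ℂ] (1 : X)) * x = x * (z ⊗ₜ[ℂ] (1 : X)) := by
  induction x using TensorProduct.induction_on with
  | zero => simp
  | tmul a b => simp [Subalgebra.mem_center_iff.1 hz a]
  | add a b ha hb => simp only [mul_add, add_mul, ha, hb]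

lemma leg12_tmul_commute {X : Type*} [Ring X] [Algebra ℂ X] {z w : G}
    (hz : z ∈ Subalgebra.center ℂ G) (hw : w ∈ Subalgebra.center ℂ G) (x : G ⊗[ℂ] (G ⊗[ℂ] X)) :
    Commute (leg12 (z ⊗ₜ[ℂ] w)) x := by
  change leg12 (z ⊗ₜ[ℂ] w) * x = x * leg12 (z ⊗ₜ[ℂ] w)
  induction x using TensorProduct.induction_on with
  | zero => simp
  | tmul a b => simp [Subalgebra.mem_center_iff.1 hz a, tmul_one_commute hw b]
  | add a b ha hb => simp only [mul_add, add_mul, ha, hb]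

lemma mul_mul_shuffle {A : Type*} [Ring A] {a b : A} (ha : ∀ x, Commute a x)
    (hb : ∀ x, Commute b x) (p x q y : A) :
    b * a * (p * x * q * y) = p * (b * x) * q * (a * y) := by
  calc b * a * (p * x * q * y) = b * (a * (p * x * q)) * y := by simp only [mul_assoc]
    _ = (b * p) * x * q * (a * y) := by rw [(ha _).eq]; simp only [mul_assoc]
    _ = _ := by rw [(hb p).eq]; simp only [mul_assoc]

lemma structD_val (𝓡 : RibbonStructure G) (σ : Center G →ₐ[ℂ] G ⊗[ℂ] Center G) :
    (structD 𝓡 σ : G ⊗[ℂ] Center G) =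
      ((𝓡.v : G) ⊗ₜ[ℂ] (1 : Center G)) * ((1 : G) ⊗ₜ[ℂ] ((𝓡.vC⁻¹ : (Center G)ˣ) : Center G)) *
        σ (𝓡.vC : Center G) := by
  rw [structD, ← map_inv]
  rfl

lemma twistedR_val (F : (G ⊗[ℂ] (G ⊗[ℂ] Center G))ˣ) (r : (G ⊗[ℂ] G)ˣ) :
    (twistedR F r : G ⊗[ℂ] (G ⊗[ℂ] Center G)) =
      swap12 (F : G ⊗[ℂ] (G ⊗[ℂ] Center G)) * leg12 (r : G ⊗[ℂ] G) *
        ((F⁻¹ : (G ⊗[ℂ] (G ⊗[ℂ] Center G))ˣ) : G ⊗[ℂ] (G ⊗[ℂ] Center G)) := rfl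

/-- `σ(f)` commutes with `D`. -/
lemma structD_commute (f : Center G) : (structD 𝓡 σ : G ⊗[ℂ] Center G) * σ f =
    σ f * (structD 𝓡 σ : G ⊗[ℂ] Center G) := by
  rw [structD_val, mul_assoc, ← map_mul, center_mul_comm, map_mul, ← mul_assoc, mul_assoc _ _ (σ f),
    ← center_right_commute, ← mul_assoc, tmul_one_commute 𝓡.v_central]
  simp only [mul_assoc]

namespace SolvesRelations

/-- `N_Φ = Φ⁻¹ D Φ`. -/
def monodromy (𝓡 : RibbonStructure G) (σ : Center G →ₐ[ℂ] G ⊗[ℂ] Center G)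
    (j : Center G →ₐ[ℂ] B) (Φ : (G ⊗[ℂ] B)ˣ) : G ⊗[ℂ] B :=
  ((Φ⁻¹ : (G ⊗[ℂ] B)ˣ) : G ⊗[ℂ] B) * mapSnd j (structD 𝓡 σ : G ⊗[ℂ] Center G) * Φ

lemma mul_monodromy : (Φ : G ⊗[ℂ] B) * monodromy 𝓡 σ j Φ =
    mapSnd j (structD 𝓡 σ : G ⊗[ℂ] Center G) * Φ := by
  simp [monodromy, ← mul_assoc]

/-- In D = v_a v⁻¹ σ(v) the factor σ(v) passes through Φ and becomes v, leaving v_a times a group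
commutator. -/
lemma monodromy_eq (h : SolvesRelations F σ j Φ) : monodromy 𝓡 σ j Φ =
    ((𝓡.v : G) ⊗ₜ[ℂ] (1 : B)) * (((Φ⁻¹ : (G ⊗[ℂ] B)ˣ) : G ⊗[ℂ] B) *
      ((1 : G) ⊗ₜ[ℂ] j ((𝓡.vC⁻¹ : (Center G)ˣ) : Center G)) * Φ *
      ((1 : G) ⊗ₜ[ℂ] j (𝓡.vC : Center G))) := by
  rw [monodromy, structD_val, map_mul, map_mul, mapSnd_tmul, mapSnd_tmul, map_one]
  simp only [mul_assoc]
  rw [h.exchange, ← mul_assoc, ← tmul_one_commute 𝓡.v_central]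
  simp only [mul_assoc]

lemma exchange_leg2 (h : SolvesRelations F σ j Φ) (y : G ⊗[ℂ] Center G) :
    mapSnd (mapSnd j) (mapSnd σ y) * leg2 (Φ : G ⊗[ℂ] B) =
      leg2 (Φ : G ⊗[ℂ] B) * leg1 (mapSnd j y) := by
  induction y using TensorProduct.induction_on with
  | zero => simp
  | tmul a b => simp [h.exchange]
  | add a b ha hb => simp only [map_add, mul_add, add_mul, ha, hb]

/-- Exchanging the two copies of Φ in the operator product turns Φ²Φ¹ into Φ¹Φ² at the cost of
F'rF⁻¹, for any r intertwining Δ and Δ'; it is used for both R₊ and R₋. -/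
lemma leg1_mul_leg2 (h : SolvesRelations F σ j Φ) (r : (G ⊗[ℂ] G)ˣ)
    (hr : ∀ ξ, (r : G ⊗[ℂ] G) * comul (R := ℂ) ξ = flip (comul (R := ℂ) ξ) * (r : G ⊗[ℂ] G)) :
    leg1 (Φ : G ⊗[ℂ] B) * leg2 (Φ : G ⊗[ℂ] B) * leg12 (r : G ⊗[ℂ] G) =
      mapSnd (mapSnd j) (twistedR F r : G ⊗[ℂ] (G ⊗[ℂ] Center G)) *
        (leg2 (Φ : G ⊗[ℂ] B) * leg1 (Φ : G ⊗[ℂ] B)) := by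
  have h1 := congrArg swap12 h.operatorProduct
  rw [map_mul, map_mul, swap12_leg1, swap12_leg2] at h1
  rw [h1, mul_assoc, swap12_comulFirst_mul hr, h.operatorProduct, twistedR_val, map_mul, map_mul,
    mapSnd_swap12, mapSnd_leg12, ← mul_assoc (_ * _ * _), mul_assoc (_ * _) _ (mapSnd (mapSnd j) _),
    ← map_mul, Units.inv_mul, map_one, mul_one, mul_assoc]

lemma Rminus_val_mul : (𝓡.Rminus : G ⊗[ℂ] G) * flip (𝓡.R : G ⊗[ℂ] G) = 1 :=
  Units.inv_mul (Units.map (flip (G := G) : G ⊗[ℂ] G →* G ⊗[ℂ] G) 𝓡.R)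

lemma mul_Rminus_val : flip (𝓡.R : G ⊗[ℂ] G) * (𝓡.Rminus : G ⊗[ℂ] G) = 1 :=
  Units.mul_inv (Units.map (flip (G := G) : G ⊗[ℂ] G →* G ⊗[ℂ] G) 𝓡.R)

lemma Rminus_comul (ξ : G) : (𝓡.Rminus : G ⊗[ℂ] G) * comul (R := ℂ) ξ =
    flip (comul (R := ℂ) ξ) * 𝓡.Rminus := by
  have h := 𝓡.flip_R_comul ξ
  calc (𝓡.Rminus : G ⊗[ℂ] G) * comul (R := ℂ) ξ
      = 𝓡.Rminus * (comul (R := ℂ) ξ * flip (𝓡.R : G ⊗[ℂ] G)) * 𝓡.Rminus := by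
        rw [mul_assoc, mul_assoc, mul_Rminus_val, mul_one]
    _ = _ := by rw [← h, ← mul_assoc, Rminus_val_mul, one_mul]

/-- Covariance of the monodromy: `N¹ Φ² = Φ² R N¹ R'`. -/
lemma leg1_monodromy_mul_leg2 (h : SolvesRelations F σ j Φ) (hF : StructureRelations 𝓡 F σ) :
    leg1 (monodromy 𝓡 σ j Φ) * leg2 (Φ : G ⊗[ℂ] B) =
      leg2 (Φ : G ⊗[ℂ] B) * (leg12 (𝓡.R : G ⊗[ℂ] G) * leg1 (monodromy 𝓡 σ j Φ) *
        leg12 (flip (𝓡.R : G ⊗[ℂ] G))) := by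
  have hD := congrArg (mapSnd (G := G) (mapSnd j)) hF.D_left
  rw [map_mul, map_mul, mapSnd_leg1] at hD
  have hm := congrArg leg1 (mul_monodromy (𝓡 := 𝓡) (σ := σ) (j := j) (Φ := Φ))
  rw [map_mul, map_mul] at hm
  have hp := h.leg1_mul_leg2 𝓡.Rplus 𝓡.R_comul
  have hn := h.leg1_mul_leg2 𝓡.Rminus Rminus_comul
  set P1 := leg1 (Φ : G ⊗[ℂ] B)
  set P2 := leg2 (Φ : G ⊗[ℂ] B)
  set N1 := leg1 (monodromy 𝓡 σ j Φ)
  -- Multiplying by Φ¹ and R₋ brings D¹ next to ℛ₋, so that D¹ℛ₋ = ℛ₊σ²(D) can be used.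
  have key : P1 * (N1 * P2 * leg12 (𝓡.Rminus : G ⊗[ℂ] G)) =
      P1 * (P2 * (leg12 (𝓡.R : G ⊗[ℂ] G) * N1)) := by
    calc P1 * (N1 * P2 * leg12 (𝓡.Rminus : G ⊗[ℂ] G))
        = (P1 * N1) * P2 * leg12 (𝓡.Rminus : G ⊗[ℂ] G) := by simp only [mul_assoc]
      _ = leg1 (mapSnd j (structD 𝓡 σ : G ⊗[ℂ] Center G)) *
            (P1 * P2 * leg12 (𝓡.Rminus : G ⊗[ℂ] G)) := by rw [hm]; simp only [mul_assoc]
      _ = mapSnd (mapSnd j) (RRplus 𝓡 F : G ⊗[ℂ] (G ⊗[ℂ] Center G)) *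
            (mapSnd (mapSnd j) (mapSnd σ (structD 𝓡 σ : G ⊗[ℂ] Center G)) * P2) * P1 := by
          rw [hn, ← mul_assoc]
          erw [hD]
          simp only [mul_assoc]
      _ = mapSnd (mapSnd j) (RRplus 𝓡 F : G ⊗[ℂ] (G ⊗[ℂ] Center G)) * (P2 * P1) * N1 := by
          rw [h.exchange_leg2, mul_assoc, mul_assoc P2, ← hm]
          simp only [mul_assoc]
      _ = P1 * (P2 * (leg12 (𝓡.R : G ⊗[ℂ] G) * N1)) := by
          erw [← hp]
          simp only [mul_assoc]
          rfl
  have key2 : N1 * P2 * leg12 (𝓡.Rminus : G ⊗[ℂ] G) = P2 * (leg12 (𝓡.R : G ⊗[ℂ] G) * N1) :=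
    (Φ.isUnit.map leg1).mul_left_cancel key
  rw [← mul_assoc, ← key2, mul_assoc, ← map_mul, Rminus_val_mul, map_one, mul_one]

/-- The monodromy obeys the same fusion relation as N. Writing it as v_a Φ⁻¹v⁻¹Φv, the element F
drops out because it commutes with v, and R'RΔ(v) = v ⊗ v supplies the R-matrices. -/
lemma monodromy_comulFirst (h : SolvesRelations F σ j Φ) (hF : StructureRelations 𝓡 F σ) :
    leg12 (𝓡.R : G ⊗[ℂ] G) * comulFirst (monodromy 𝓡 σ j Φ) =
      leg2 (monodromy 𝓡 σ j Φ) * leg12 (𝓡.R : G ⊗[ℂ] G) * leg1 (monodromy 𝓡 σ j Φ) := by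
  have hc := congrArg swap12 (h.leg1_monodromy_mul_leg2 hF)
  simp only [map_mul, swap12_leg1, swap12_leg2, swap12_leg12, flip_flip] at hc
  have hNeq := h.monodromy_eq (𝓡 := 𝓡)
  set n := monodromy 𝓡 σ j Φ
  have hdelta : flip (𝓡.R : G ⊗[ℂ] G) * 𝓡.R * comul (R := ℂ) (𝓡.v : G) =
      (𝓡.v : G) ⊗ₜ[ℂ] (𝓡.v : G) := by
    rw [𝓡.ribbon, mul_assoc, ← Bialgebra.comul_mul, Units.inv_mul, Bialgebra.comul_one, mul_one]
  let P1 : (G ⊗[ℂ] (G ⊗[ℂ] B))ˣ := Units.map (leg1 (G := G) (X := B)).toMonoidHom Φ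
  let P2 : (G ⊗[ℂ] (G ⊗[ℂ] B))ˣ := Units.map (leg2 (G := G) (X := B)).toMonoidHom Φ
  let PD : (G ⊗[ℂ] (G ⊗[ℂ] B))ˣ := Units.map (comulFirst (G := G) (X := B)).toMonoidHom Φ
  let jF : (G ⊗[ℂ] (G ⊗[ℂ] B))ˣ :=
    Units.map (mapSnd (G := G) (mapSnd (G := G) j)).toMonoidHom F
  let c : (G ⊗[ℂ] (G ⊗[ℂ] B))ˣ := Units.map
    ((mapSnd (G := G) (mapSnd (G := G) j)).comp (leg2.comp
      (Algebra.TensorProduct.includeRight : Center G →ₐ[ℂ] G ⊗[ℂ] Center G))).toMonoidHom 𝓡.vC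
  have hop : P2 * P1 = jF * PD := Units.ext h.operatorProduct
  have hcF : c * jF = jF * c := by
    refine Units.ext ?_
    have := congrArg (mapSnd (G := G) (mapSnd (G := G) j))
      (center_right_commute₂ (F : G ⊗[ℂ] (G ⊗[ℂ] Center G)) (𝓡.vC : Center G))
    rw [map_mul, map_mul] at this
    exact this.symm
  have hN1 : leg1 n = leg12 ((𝓡.v : G) ⊗ₜ[ℂ] (1 : G)) *
      ((P1⁻¹ * c⁻¹ * P1 * c : (G ⊗[ℂ] (G ⊗[ℂ] B))ˣ) : G ⊗[ℂ] (G ⊗[ℂ] B)) := by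
    rw [hNeq, map_mul, map_mul, map_mul, map_mul]
    rfl
  have hN2 : leg2 n = leg12 ((1 : G) ⊗ₜ[ℂ] (𝓡.v : G)) *
      ((P2⁻¹ * c⁻¹ * P2 * c : (G ⊗[ℂ] (G ⊗[ℂ] B))ˣ) : G ⊗[ℂ] (G ⊗[ℂ] B)) := by
    rw [hNeq, map_mul, map_mul, map_mul, map_mul]
    rfl
  have hND : comulFirst n = leg12 (comul (R := ℂ) (𝓡.v : G)) *
      ((PD⁻¹ * c⁻¹ * PD * c : (G ⊗[ℂ] (G ⊗[ℂ] B))ˣ) : G ⊗[ℂ] (G ⊗[ℂ] B)) := by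
    rw [hNeq, map_mul, map_mul, map_mul, map_mul, comulFirst_tmul_one, comulFirst_one_tmul,
      comulFirst_one_tmul]
    rfl
  -- The commutator identity for a product, with Δ_a(Φ) = F⁻¹Φ²Φ¹.
  have hPD : PD⁻¹ * c⁻¹ * PD * c = P1⁻¹ * (P2⁻¹ * c⁻¹ * P2 * c) * P1 * (P1⁻¹ * c⁻¹ * P1 * c) := by
    have e1 : PD = jF⁻¹ * (P2 * P1) := by rw [hop]; group
    have e2 : jF * c⁻¹ * jF⁻¹ = c⁻¹ :=
      (Commute.inv_right (show Commute jF c from hcF.symm)).mul_inv_cancel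
    calc PD⁻¹ * c⁻¹ * PD * c = P1⁻¹ * P2⁻¹ * (jF * c⁻¹ * jF⁻¹) * P2 * P1 * c := by rw [e1]; group
      _ = _ := by rw [e2]; group
  -- Covariance with the two auxiliary legs exchanged: conjugating N² by Φ¹ gives R'N²R.
  have hc' : leg12 (flip (𝓡.R : G ⊗[ℂ] G)) * (leg2 n * leg12 (𝓡.R : G ⊗[ℂ] G)) =
      ((P1⁻¹ : (G ⊗[ℂ] (G ⊗[ℂ] B))ˣ) : G ⊗[ℂ] (G ⊗[ℂ] B)) * leg2 n *
        (P1 : G ⊗[ℂ] (G ⊗[ℂ] B)) := by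
    rw [mul_assoc, Units.eq_inv_mul_iff_mul_eq]
    simp only [← mul_assoc] at hc ⊢
    exact hc.symm
  have hunit : IsUnit (leg12 (X := B) (flip (𝓡.R : G ⊗[ℂ] G))) :=
    (𝓡.R.isUnit.map flip).map (leg12 (G := G) (X := B))
  refine hunit.mul_left_cancel ?_
  have c1 := leg12_tmul_commute (X := B) 𝓡.v_central (one_mem _)
  have c2 := leg12_tmul_commute (X := B) (one_mem (Subalgebra.center ℂ G)) 𝓡.v_central
  have hvv : leg12 (X := B) ((𝓡.v : G) ⊗ₜ[ℂ] (𝓡.v : G)) =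
      leg12 ((1 : G) ⊗ₜ[ℂ] (𝓡.v : G)) * leg12 ((𝓡.v : G) ⊗ₜ[ℂ] (1 : G)) := by
    rw [← map_mul]; simp
  rw [← mul_assoc _ _ (leg1 n), hc', hND, ← mul_assoc, ← mul_assoc, ← map_mul, ← map_mul, hdelta,
    hPD, hN1, hN2, hvv]
  rw [Units.val_mul (_ * _ * _), Units.val_mul (_ * _), Units.val_mul P1⁻¹]
  exact mul_mul_shuffle c1 c2 _ _ _ _

end SolvesRelations

end Solutions

/-! ### The action of G on an arbitrary solution. -/

section HopfAction

variable {G : Type*} [Ring G] [HopfAlgebra ℂ G] [StarRing G] [StarModule ℂ G]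
  {𝓡 : RibbonStructure G} {F : (G ⊗[ℂ] (G ⊗[ℂ] Center G))ˣ}
  {σ : Center G →ₐ[ℂ] G ⊗[ℂ] Center G}
  {B : Type*} [Ring B] [Algebra ℂ B] {j : Center G →ₐ[ℂ] B} {Φ : (G ⊗[ℂ] B)ˣ}

namespace SolvesRelations

/-- Applying ε ⊗ ε to the operator product gives x² = j((ε ⊗ ε)(F)) x for x = (ε ⊗ id)(Φ), and x is
invertible. So this component of Φ lies in j(𝒞). -/
lemma counitFirst_eq (h : SolvesRelations F σ j Φ) : counitFirst (Φ : G ⊗[ℂ] B) =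
    j (counitFirst (counitFirst (F : G ⊗[ℂ] (G ⊗[ℂ] Center G)))) := by
  have h1 := congrArg (fun x => counitFirst (counitFirst x)) h.operatorProduct
  simp only [map_mul, counitFirst_leg1, counitFirst_leg2, counitFirst_mapSnd,
    counitFirst_comulFirst, counitFirst_tmul, Bialgebra.counit_one, one_smul] at h1
  exact (Φ.isUnit.map counitFirst).mul_right_cancel h1

lemma counitFirst_monodromy (h : SolvesRelations F σ j Φ) :
    counitFirst (monodromy 𝓡 σ j Φ) = 1 := by
  have hinv : counitFirst ((Φ⁻¹ : (G ⊗[ℂ] B)ˣ) : G ⊗[ℂ] B) * counitFirst (Φ : G ⊗[ℂ] B) = 1 := by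
    rw [← map_mul, Units.inv_mul, map_one]
  rw [h.monodromy_eq, map_mul, map_mul, map_mul, map_mul]
  simp only [counitFirst_tmul, 𝓡.counit_v, Bialgebra.counit_one, one_smul, one_mul]
  rw [h.counitFirst_eq] at hinv ⊢
  rw [mul_assoc _ _ (j (counitFirst _)), ← map_mul, center_mul_comm, map_mul, ← mul_assoc, hinv,
    one_mul, ← map_mul, Units.inv_mul, map_one]

lemma monodromy_commute (h : SolvesRelations F σ j Φ) (f : Center G) :
    monodromy 𝓡 σ j Φ * ((1 : G) ⊗ₜ[ℂ] j f) = ((1 : G) ⊗ₜ[ℂ] j f) * monodromy 𝓡 σ j Φ := by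
  refine Φ.isUnit.mul_left_cancel ?_
  rw [← mul_assoc, mul_monodromy, mul_assoc, h.exchange, ← mul_assoc, ← map_mul, structD_commute,
    map_mul, mul_assoc, ← mul_monodromy, ← mul_assoc, ← h.exchange, mul_assoc]

/-- If `N` is nondegenerate, the monodromy of a solution defines an action of `G`. -/
theorem exists_hopfAction [FiniteDimensional ℂ G] (h : SolvesRelations F σ j Φ)
    (hF : StructureRelations 𝓡 F σ)
    (hN : ∀ g : G, ∃ π : Module.Dual ℂ G, rightComponent π (𝓡.N : G ⊗[ℂ] G) = g) :
    ∃ ι : G →ₐ[ℂ] B,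
      (Φ : G ⊗[ℂ] B) * mapSnd ι (𝓡.N : G ⊗[ℂ] G) =
        mapSnd j (structD 𝓡 σ : G ⊗[ℂ] Center G) * Φ ∧
      (∀ ξ : G, ((1 : G) ⊗ₜ[ℂ] ι ξ) * (Φ : G ⊗[ℂ] B) =
        Φ * mapSnd ι (flip (comul (R := ℂ) ξ))) ∧
      ∀ (f : Center G) (ξ : G), ι ξ * j f = j f * ι ξ := by
  let Q : Module.Dual ℂ G →ₗ[ℂ] G := components (𝓡.N : G ⊗[ℂ] G)
  -- Nondegeneracy changes sides: a form annihilated by N in the first leg vanishes on all (id ⊗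
  -- φ)(N), that is, on G.
  have hQ : Function.Injective Q := by
    rw [← LinearMap.ker_eq_bot, LinearMap.ker_eq_bot']
    intro π hπ
    ext g
    obtain ⟨φ, rfl⟩ := hN g
    rw [← dual_component]
    exact (congrArg φ hπ).trans (map_zero φ)
  let e : Module.Dual ℂ G ≃ₗ[ℂ] G :=
    LinearEquiv.ofInjectiveOfFinrankEq Q hQ Subspace.dual_finrank_eq
  have he : ∀ π, e π = component π (𝓡.N : G ⊗[ℂ] G) := fun π => rfl
  -- Every g is a unique component (π ⊗ id)(N), and it is sent to the same component of the
  -- monodromy.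
  let ιl : G →ₗ[ℂ] B := (components (monodromy 𝓡 σ j Φ)).comp e.symm.toLinearMap
  have hι : ∀ π, ιl (component π (𝓡.N : G ⊗[ℂ] G)) = component π (monodromy 𝓡 σ j Φ) := by
    intro π
    rw [← he]
    simp [ιl]
  have hsurj : ∀ g : G, ∃ π, component π (𝓡.N : G ⊗[ℂ] G) = g := fun g =>
    ⟨e.symm g, by rw [← he, e.apply_symm_apply]⟩
  have hιN : ιl.lTensor G (𝓡.N : G ⊗[ℂ] G) = monodromy 𝓡 σ j Φ :=
    ext_component fun π => by rw [component_lTensor, hι]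
  have hone : ιl 1 = 1 := by
    have h1 := hι counit
    rwa [← counitFirst_eq_component, ← counitFirst_eq_component, 𝓡.counitFirst_N,
      h.counitFirst_monodromy] at h1
  -- Stripping R₁₂ from both fusion relations expresses N²N¹ and its analogue by one formula that is
  -- linear in the last leg; hence ι respects products of components.
  have hprod : (ιl.lTensor G).lTensor G
      (leg2 (𝓡.N : G ⊗[ℂ] G) * leg1 (𝓡.N : G ⊗[ℂ] G)) =
      leg2 (monodromy 𝓡 σ j Φ) * leg1 (monodromy 𝓡 σ j Φ) := by
    have e1 := congrArg (outerSandwich ((antipode ℂ).lTensor G (𝓡.R : G ⊗[ℂ] G)))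
      𝓡.leg12_R_mul_comulFirst_N
    have e2 := congrArg (outerSandwich ((antipode ℂ).lTensor G (𝓡.R : G ⊗[ℂ] G)))
      (h.monodromy_comulFirst hF)
    rw [outerSandwich_leg, 𝓡.sandwich_antipode_R, map_one, mul_one] at e1 e2
    rw [← e1, ← e2, lTensor_outerSandwich, lTensor_leg12_mul, lTensor_comulFirst, hιN]
  have hmul : ∀ x y, ιl (x * y) = ιl x * ιl y := by
    intro x y
    obtain ⟨π, rfl⟩ := hsurj x
    obtain ⟨φ, rfl⟩ := hsurj y
    rw [hι, hι, ← component_leg2_mul_leg1, ← component_leg2_mul_leg1, ← hprod, component_lTensor,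
      component_lTensor]
  refine ⟨AlgHom.ofLinearMap ιl hone hmul, ?_, ?_, ?_⟩
  · rw [← mul_monodromy, ← hιN]
    rfl
  · intro ξ
    obtain ⟨π, rfl⟩ := hsurj ξ
    -- R₁₂N₁₃R'₁₂ is (id ⊗ Δ')(N), so the covariance of the monodromy says ξΦ = ΦΔ'(ξ) for all
    -- components ξ of N at once.
    have hcov := h.leg1_monodromy_mul_leg2 hF
    rw [← hιN, ← lTensor_leg1, ← lTensor_leg12_mul, ← lTensor_mul_leg12, ← 𝓡.mapComulFlip_N,
      lTensor_leg1, leg2_apply] at hcov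
    have e1 := congrArg (component π) hcov
    rw [component_one_tmul_mul, component_lTensor] at e1
    have e2 : ∀ y : G ⊗[ℂ] G, component π (RibbonStructure.mapComulFlip y) =
        flip (comul (R := ℂ) (component π y)) := by
      intro y
      induction y using TensorProduct.induction_on with
      | zero => simp
      | tmul a b => simp [RibbonStructure.mapComulFlip]
      | add a b ha hb => simp only [map_add, ha, hb]
    have e3 : ∀ y z : G ⊗[ℂ] B, component π (leg1 y * ((1 : G) ⊗ₜ[ℂ] z)) =
        ((1 : G) ⊗ₜ[ℂ] component π y) * z := by
      intro y z
      rw [component_mul_one_tmul, component_leg1]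
    rw [e2, e3, component_lTensor] at e1
    exact e1
  · intro f ξ
    obtain ⟨π, rfl⟩ := hsurj ξ
    change ιl _ * _ = _ * ιl _
    rw [hι, ← component_mul_one_tmul, h.monodromy_commute, component_one_tmul_mul]

end SolvesRelations

end HopfAction

/-- Components of a product with Δ_a(Φ) are again single components of Φ, for a convolved linear
form; hence words in Φ reduce to length one. -/
lemma component_component_mul_comulFirst {G : Type*} [Ring G] [HopfAlgebra ℂ G] {B : Type*}
    [Ring B] [Algebra ℂ B] (π φ : Module.Dual ℂ G) (a b : G) (x : B)
    (y : G ⊗[ℂ] B) :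
    component π (component φ ((a ⊗ₜ[ℂ] (b ⊗ₜ[ℂ] x)) * comulFirst y)) =
      x * component ((LinearMap.mul' ℂ ℂ).comp ((TensorProduct.map φ π).comp
        ((LinearMap.mulLeft ℂ (a ⊗ₜ[ℂ] b)).comp comul))) y := by
  induction y using TensorProduct.induction_on with
  | zero => simp
  | tmul g z =>
    rw [comulFirst_tmul]
    simp only [component_tmul, LinearMap.comp_apply]
    induction comul (R := ℂ) g using TensorProduct.induction_on with
    | zero => simp
    | tmul c d => simp [smul_smul, mul_comm]
    | add c d hc hd => simp only [map_add, mul_add, add_mul, hc, hd, add_smul]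
  | add c d hc hd => simp only [map_add, mul_add, hc, hd]

/-! ### Normal form f Φ_π and the upper dimension bound. -/

section Span

variable {G : Type*} [Ring G] [HopfAlgebra ℂ G] [StarRing G] [StarModule ℂ G]
  {𝓡 : RibbonStructure G} {F : (G ⊗[ℂ] (G ⊗[ℂ] Center G))ˣ}
  {σ : Center G →ₐ[ℂ] G ⊗[ℂ] Center G}
  {B : Type*} [Ring B] [Algebra ℂ B] {j : Center G →ₐ[ℂ] B} {Φ : (G ⊗[ℂ] B)ˣ}

/-- The generators of the algebra of relations. -/
def generators (j : Center G →ₐ[ℂ] B) (Φ : (G ⊗[ℂ] B)ˣ) : Set B :=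
  Set.range j ∪ Set.range fun π : Module.Dual ℂ G => component π (Φ : G ⊗[ℂ] B)

/-- `f ⊗ π ↦ f Φ_π`. -/
def normalForm (j : Center G →ₐ[ℂ] B) (Φ : (G ⊗[ℂ] B)ˣ) :
    Center G ⊗[ℂ] Module.Dual ℂ G →ₗ[ℂ] B :=
  (LinearMap.mul' ℂ B).comp (TensorProduct.map j.toLinearMap (components (Φ : G ⊗[ℂ] B)))

@[simp] lemma normalForm_tmul (f : Center G) (π : Module.Dual ℂ G) :
    normalForm j Φ (f ⊗ₜ[ℂ] π) = j f * component π (Φ : G ⊗[ℂ] B) := by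
  simp [normalForm]

lemma component_component_mem_range (π φ : Module.Dual ℂ G)
    (x : G ⊗[ℂ] (G ⊗[ℂ] Center G)) :
    component π (component φ (mapSnd (mapSnd j) x * comulFirst (Φ : G ⊗[ℂ] B))) ∈
      LinearMap.range (normalForm j Φ) := by
  induction x using TensorProduct.induction_on with
  | zero => simp
  | tmul a b =>
    induction b using TensorProduct.induction_on with
    | zero => simp
    | tmul b c =>
      rw [mapSnd_tmul, mapSnd_tmul, component_component_mul_comulFirst, ← normalForm_tmul]
      exact ⟨_, rfl⟩
    | add b c hb hc =>
      simp only [TensorProduct.tmul_add, map_add, add_mul]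
      exact Submodule.add_mem _ hb hc
  | add a b ha hb =>
    simp only [map_add, add_mul]
    exact Submodule.add_mem _ ha hb

namespace SolvesRelations

lemma one_mem_range_normalForm (h : SolvesRelations F σ j Φ) :
    (1 : B) ∈ LinearMap.range (normalForm j Φ) := by
  let c : (Center G)ˣ := Units.map (counitFirst.comp counitFirst :
    G ⊗[ℂ] (G ⊗[ℂ] Center G) →ₐ[ℂ] Center G).toMonoidHom F
  refine ⟨((c⁻¹ : (Center G)ˣ) : Center G) ⊗ₜ[ℂ] counit, ?_⟩
  rw [normalForm_tmul, ← counitFirst_eq_component, h.counitFirst_eq, ← map_mul]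
  exact (congrArg j c.inv_mul).trans (map_one j)

/-- The algebra generated by `𝒞` and the components of `Φ` is spanned by the products `f Φ_π`. -/
lemma adjoin_le_range_normalForm (h : SolvesRelations F σ j Φ) :
    Subalgebra.toSubmodule (Algebra.adjoin ℂ (generators j Φ)) ≤
      LinearMap.range (normalForm j Φ) := by
  intro x hx
  -- The span contains 1, so stability under left multiplication by generators suffices.
  suffices hmul : ∀ y ∈ LinearMap.range (normalForm j Φ),
      x * y ∈ LinearMap.range (normalForm j Φ) by
    simpa using hmul 1 h.one_mem_range_normalForm
  replace hx : x ∈ Algebra.adjoin ℂ (generators j Φ) := hx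
  induction hx using Algebra.adjoin_induction with
  | mem x hx =>
    rintro _ ⟨y, rfl⟩
    rcases hx with ⟨f, rfl⟩ | ⟨π, rfl⟩
    · induction y using TensorProduct.induction_on with
      | zero => simp
      | tmul g φ =>
        rw [normalForm_tmul, ← mul_assoc, ← map_mul, ← normalForm_tmul]
        exact ⟨_, rfl⟩
      | add a b ha hb => rw [map_add, mul_add]; exact Submodule.add_mem _ ha hb
    · induction y using TensorProduct.induction_on with
      | zero => simp
      | tmul g φ =>
        -- In Φ_π g Φ_φ the central g moves left through Φ as σ(g), and the two copies of Φ fuse to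
        -- FΔ_a(Φ).
        have key : component π (Φ : G ⊗[ℂ] B) * (j g * component φ (Φ : G ⊗[ℂ] B)) =
            component π (component φ (mapSnd (mapSnd j)
              (leg2 (σ g) * (F : G ⊗[ℂ] (G ⊗[ℂ] Center G))) * comulFirst (Φ : G ⊗[ℂ] B))) := by
          rw [map_mul (mapSnd (mapSnd j)), mul_assoc, ← h.operatorProduct, mapSnd_leg2,
            ← mul_assoc (leg2 (mapSnd j (σ g))), ← map_mul leg2, ← h.exchange,
            component_leg2_mul_leg1, component_mul_one_tmul, mul_assoc]
        rw [normalForm_tmul]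
        change component π (Φ : G ⊗[ℂ] B) * _ ∈ _
        rw [key]
        exact component_component_mem_range _ _ _
      | add a b ha hb => rw [map_add, mul_add]; exact Submodule.add_mem _ ha hb
  | algebraMap r =>
    intro y hy
    rw [← Algebra.smul_def]
    exact Submodule.smul_mem _ _ hy
  | add x y _ _ hx hy =>
    intro z hz
    rw [add_mul]
    exact Submodule.add_mem _ (hx z hz) (hy z hz)
  | mul x y _ _ hx hy =>
    intro z hz
    rw [mul_assoc]
    exact hx _ (hy z hz)

lemma finrank_adjoin_le [FiniteDimensional ℂ G] (h : SolvesRelations F σ j Φ) :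
    FiniteDimensional ℂ (Algebra.adjoin ℂ (generators j Φ)) ∧
    Module.finrank ℂ (Algebra.adjoin ℂ (generators j Φ)) ≤
      Module.finrank ℂ (Center G) * Module.finrank ℂ G := by
  have hfd : FiniteDimensional ℂ (Center G) :=
    FiniteDimensional.finiteDimensional_submodule (Subalgebra.toSubmodule (Center G).toSubalgebra)
  have hle := h.adjoin_le_range_normalForm
  have h1 : FiniteDimensional ℂ (Subalgebra.toSubmodule (Algebra.adjoin ℂ (generators j Φ))) :=
    Submodule.finiteDimensional_of_le hle
  refine ⟨h1, (Submodule.finrank_mono hle).trans ((LinearMap.finrank_range_le _).trans ?_)⟩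
  rw [Module.finrank_tensorProduct, Subspace.dual_finrank_eq]

/-- Images of solutions are solutions. -/
lemma map {B' : Type*} [Ring B'] [Algebra ℂ B'] (h : SolvesRelations F σ j Φ) (f : B →ₐ[ℂ] B') :
    SolvesRelations F σ (f.comp j) (Units.map (mapSnd (G := G) f).toMonoidHom Φ) where
  operatorProduct := by
    have := congrArg (mapSnd (G := G) (mapSnd (G := G) f)) h.operatorProduct
    rw [map_mul, map_mul, mapSnd_leg1, mapSnd_leg2, mapSnd_comulFirst, mapSnd_mapSnd] at this
    have e : (mapSnd (G := G) f).comp (mapSnd (G := G) j) = mapSnd (f.comp j) := by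
      ext x
      · simp
      · simp
    rw [e] at this
    exact this
  exchange c := by
    have := congrArg (mapSnd (G := G) f) (h.exchange c)
    rw [map_mul, map_mul, mapSnd_mapSnd] at this
    exact this

end SolvesRelations

lemma mapSnd_injective {X Y : Type*} [Ring X] [Algebra ℂ X] [Ring Y] [Algebra ℂ Y]
    {f : X →ₐ[ℂ] Y} (hf : Function.Injective f) :
    Function.Injective (mapSnd (G := G) f) :=
  Module.Flat.lTensor_preserves_injective_linearMap (M := G) f.toLinearMap hf

namespace SolvesRelations

lemma of_injective {B' : Type*} [Ring B'] [Algebra ℂ B'] {f : B →ₐ[ℂ] B'}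
    (hf : Function.Injective f)
    (h : SolvesRelations F σ (f.comp j) (Units.map (mapSnd (G := G) f).toMonoidHom Φ)) :
    SolvesRelations F σ j Φ where
  operatorProduct := by
    have := h.operatorProduct
    apply mapSnd_injective (G := G) (mapSnd_injective (G := G) hf)
    rw [map_mul, map_mul, mapSnd_leg1, mapSnd_leg2, mapSnd_comulFirst, mapSnd_mapSnd]
    have e : (mapSnd (G := G) f).comp (mapSnd (G := G) j) = mapSnd (f.comp j) := by
      ext x
      · simp
      · simp
    rw [e]
    exact this
  exchange c := by
    apply mapSnd_injective (G := G) hf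
    rw [map_mul, map_mul, mapSnd_mapSnd]
    exact h.exchange c

/-- A solution restricts to the subalgebra generated by its components. -/
lemma exists_restrict [FiniteDimensional ℂ G] (h : SolvesRelations F σ j Φ) :
    ∃ (jA : Center G →ₐ[ℂ] Algebra.adjoin ℂ (generators j Φ))
      (ΦA : (G ⊗[ℂ] Algebra.adjoin ℂ (generators j Φ))ˣ),
      (Algebra.adjoin ℂ (generators j Φ)).val.comp jA = j ∧
      Units.map (mapSnd (G := G) (Algebra.adjoin ℂ (generators j Φ)).val).toMonoidHom ΦA = Φ ∧
      SolvesRelations F σ jA ΦA := by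
  set A := Algebra.adjoin ℂ (generators j Φ) with hA
  have hfd : FiniteDimensional ℂ A := h.finrank_adjoin_le.1
  have hcomp : ∀ π : Module.Dual ℂ G, component π (Φ : G ⊗[ℂ] B) ∈ A := fun π =>
    Algebra.subset_adjoin (Or.inr ⟨π, rfl⟩)
  let jA : Center G →ₐ[ℂ] A := j.codRestrict A fun f => Algebra.subset_adjoin (Or.inl ⟨f, rfl⟩)
  let b := Module.finBasis ℂ G
  let x : G ⊗[ℂ] A := ∑ i, b i ⊗ₜ[ℂ] (⟨component (b.coord i) (Φ : G ⊗[ℂ] B), hcomp _⟩ : A)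
  have hx : mapSnd A.val x = (Φ : G ⊗[ℂ] B) := by
    rw [tensor_eq_sum_component b (Φ : G ⊗[ℂ] B), map_sum]
    rfl
  have hinj : Function.Injective (mapSnd (G := G) A.val) :=
    mapSnd_injective Subtype.val_injective
  -- G ⊗ A is finite-dimensional, so regularity, inherited from Φ in the larger algebra, already
  -- gives an inverse inside it.
  have hunit : IsUnit x := by
    have : IsArtinianRing (G ⊗[ℂ] A) := IsArtinianRing.of_finite ℂ _
    rw [IsArtinianRing.isUnit_iff_isRightRegular]
    intro y z hyz
    apply hinj
    have := congrArg (mapSnd A.val) hyz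
    simp only [map_mul, hx] at this
    exact Φ.isUnit.mul_right_cancel this
  have hΦ : Units.map (mapSnd (G := G) A.val).toMonoidHom hunit.unit = Φ := Units.ext hx
  have hj : A.val.comp jA = j := by ext f; rfl
  refine ⟨jA, hunit.unit, hj, hΦ, of_injective (f := A.val) Subtype.val_injective ?_⟩
  rw [hΦ, hj]
  exact h

end SolvesRelations

end Span

/-! ### Universality from equality of dimensions. -/

section Universal

variable {G : Type*} [Ring G] [HopfAlgebra ℂ G] [StarRing G] [StarModule ℂ G]
  {𝓡 : RibbonStructure G} {F : (G ⊗[ℂ] (G ⊗[ℂ] Center G))ˣ}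
  {σ : Center G →ₐ[ℂ] G ⊗[ℂ] Center G}

lemma ext_prod [FiniteDimensional ℂ G] {X Y : Type*} [Ring X] [Algebra ℂ X] [Ring Y] [Algebra ℂ Y]
    {y z : G ⊗[ℂ] (X × Y)} (h1 : mapSnd (AlgHom.fst ℂ X Y) y = mapSnd (AlgHom.fst ℂ X Y) z)
    (h2 : mapSnd (AlgHom.snd ℂ X Y) y = mapSnd (AlgHom.snd ℂ X Y) z) : y = z := by
  refine ext_component fun π => Prod.ext ?_ ?_
  · have := congrArg (component π) h1
    rwa [component_mapSnd, component_mapSnd] at this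
  · have := congrArg (component π) h2
    rwa [component_mapSnd, component_mapSnd] at this

lemma ext_prod₂ [FiniteDimensional ℂ G] {X Y : Type*} [Ring X] [Algebra ℂ X] [Ring Y] [Algebra ℂ Y]
    {y z : G ⊗[ℂ] (G ⊗[ℂ] (X × Y))}
    (h1 : mapSnd (mapSnd (AlgHom.fst ℂ X Y)) y = mapSnd (mapSnd (AlgHom.fst ℂ X Y)) z)
    (h2 : mapSnd (mapSnd (AlgHom.snd ℂ X Y)) y = mapSnd (mapSnd (AlgHom.snd ℂ X Y)) z) :
    y = z := by
  refine ext_component fun π => ext_prod ?_ ?_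
  · have := congrArg (component π) h1
    rwa [component_mapSnd, component_mapSnd] at this
  · have := congrArg (component π) h2
    rwa [component_mapSnd, component_mapSnd] at this

lemma mapSnd_comp_mapSnd {X Y Z : Type*} [Ring X] [Algebra ℂ X] [Ring Y] [Algebra ℂ Y] [Ring Z]
    [Algebra ℂ Z] (f : Y →ₐ[ℂ] Z) (g : X →ₐ[ℂ] Y) :
    (mapSnd (G := G) f).comp (mapSnd (G := G) g) = mapSnd (f.comp g) :=
  AlgHom.ext fun x => mapSnd_mapSnd g f x

variable {B : Type*} [Ring B] [Algebra ℂ B] {j : Center G →ₐ[ℂ] B} {Φ : (G ⊗[ℂ] B)ˣ}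
  {B' : Type*} [Ring B'] [Algebra ℂ B'] {j' : Center G →ₐ[ℂ] B'} {Φ' : (G ⊗[ℂ] B')ˣ}

/-- The pair of two elements of `G ⊗ B` and `G ⊗ B'`. -/
def unitsPair (Φ : (G ⊗[ℂ] B)ˣ) (Φ' : (G ⊗[ℂ] B')ˣ) : (G ⊗[ℂ] (B × B'))ˣ :=
  Units.map ((Algebra.TensorProduct.prodRight ℂ ℂ G B B').symm :
    (G ⊗[ℂ] B) × (G ⊗[ℂ] B') →* G ⊗[ℂ] (B × B')) (MulEquiv.prodUnits.symm (Φ, Φ'))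

lemma prodRight_eq (z : G ⊗[ℂ] (B × B')) : Algebra.TensorProduct.prodRight ℂ ℂ G B B' z =
    (mapSnd (AlgHom.fst ℂ B B') z, mapSnd (AlgHom.snd ℂ B B') z) := by
  induction z using TensorProduct.induction_on with
  | zero => simp only [map_zero]; rfl
  | tmul a b => simp [Algebra.TensorProduct.prodRight_tmul]
  | add a b ha hb => simp only [map_add, ha, hb, Prod.mk_add_mk]

lemma unitsPair_eq (Φ : (G ⊗[ℂ] B)ˣ) (Φ' : (G ⊗[ℂ] B')ˣ) :
    mapSnd (AlgHom.fst ℂ B B') (unitsPair Φ Φ' : G ⊗[ℂ] (B × B')) = Φ ∧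
    mapSnd (AlgHom.snd ℂ B B') (unitsPair Φ Φ' : G ⊗[ℂ] (B × B')) = Φ' := by
  have h := prodRight_eq (unitsPair Φ Φ' : G ⊗[ℂ] (B × B'))
  have h2 : Algebra.TensorProduct.prodRight ℂ ℂ G B B' (unitsPair Φ Φ' : G ⊗[ℂ] (B × B')) =
      ((Φ : G ⊗[ℂ] B), (Φ' : G ⊗[ℂ] B')) :=
    (Algebra.TensorProduct.prodRight ℂ ℂ G B B').apply_symm_apply _
  rw [h2, Prod.ext_iff] at h
  exact ⟨h.1.symm, h.2.symm⟩

namespace SolvesRelations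

lemma prod [FiniteDimensional ℂ G] (h : SolvesRelations F σ j Φ) (h' : SolvesRelations F σ j' Φ') :
    SolvesRelations F σ (j.prod j') (unitsPair Φ Φ') where
  operatorProduct := by
    apply ext_prod₂
    · rw [map_mul, map_mul, mapSnd_leg1, mapSnd_leg2, mapSnd_comulFirst, mapSnd_mapSnd,
        mapSnd_comp_mapSnd, (unitsPair_eq Φ Φ').1]
      exact h.operatorProduct
    · rw [map_mul, map_mul, mapSnd_leg1, mapSnd_leg2, mapSnd_comulFirst, mapSnd_mapSnd,
        mapSnd_comp_mapSnd, (unitsPair_eq Φ Φ').2]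
      exact h'.operatorProduct
  exchange c := by
    apply ext_prod
    · rw [map_mul, map_mul, mapSnd_mapSnd, (unitsPair_eq Φ Φ').1]
      exact h.exchange c
    · rw [map_mul, map_mul, mapSnd_mapSnd, (unitsPair_eq Φ Φ').2]
      exact h'.exchange c

/-- A generating solution of the maximal possible dimension is universal. -/
theorem isAlgebraOfRelations [FiniteDimensional ℂ G] [FiniteDimensional ℂ B]
    (h : SolvesRelations F σ j Φ) (hgen : Algebra.adjoin ℂ (generators j Φ) = ⊤)
    (hdim : Module.finrank ℂ (Center G) * Module.finrank ℂ G ≤ Module.finrank ℂ B) :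
    IsAlgebraOfRelations.{_, u₄} F σ j Φ where
  solves := h
  generated := hgen
  universal := by
    intro B' _ _ j' Φ' h'
    -- The pair of solutions generates a subalgebra A of B × B' with the same upper dimension bound.
    -- As A projects onto B, whose dimension attains the bound, A is the graph of the required
    -- homomorphism.
    have hP := h.prod h'
    have hΦ := unitsPair_eq Φ Φ'
    obtain ⟨hfd, hle⟩ := hP.finrank_adjoin_le
    set A := Algebra.adjoin ℂ (generators (j.prod j') (unitsPair Φ Φ')) with hA
    let p : A →ₐ[ℂ] B := (AlgHom.fst ℂ B B').comp A.val
    have hjA : ∀ f, (j.prod j') f ∈ A := fun f => Algebra.subset_adjoin (Or.inl ⟨f, rfl⟩)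
    have hΦA : ∀ π : Module.Dual ℂ G, component π (unitsPair Φ Φ' : G ⊗[ℂ] (B × B')) ∈ A :=
      fun π => Algebra.subset_adjoin (Or.inr ⟨π, rfl⟩)
    have hc1 : ∀ π : Module.Dual ℂ G,
        (component π (unitsPair Φ Φ' : G ⊗[ℂ] (B × B'))).1 = component π (Φ : G ⊗[ℂ] B) := by
      intro π
      rw [← hΦ.1, component_mapSnd]; rfl
    have hc2 : ∀ π : Module.Dual ℂ G,
        (component π (unitsPair Φ Φ' : G ⊗[ℂ] (B × B'))).2 = component π (Φ' : G ⊗[ℂ] B') := by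
      intro π
      rw [← hΦ.2, component_mapSnd]; rfl
    have hsurj : Function.Surjective p := by
      rw [← AlgHom.range_eq_top, eq_top_iff, ← hgen]
      refine Algebra.adjoin_le ?_
      rintro _ (⟨f, rfl⟩ | ⟨π, rfl⟩)
      · exact ⟨⟨_, hjA f⟩, rfl⟩
      · exact ⟨⟨_, hΦA π⟩, hc1 π⟩
    have hinj : Function.Injective p := by
      have hfin : Module.finrank ℂ A = Module.finrank ℂ B :=
        le_antisymm (hle.trans hdim) (LinearMap.finrank_le_finrank_of_surjective
          (f := p.toLinearMap) hsurj)
      exact (LinearMap.injective_iff_surjective_of_finrank_eq_finrank (f := p.toLinearMap)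
        hfin).2 hsurj
    let e : A ≃ₐ[ℂ] B := AlgEquiv.ofBijective p ⟨hinj, hsurj⟩
    let ψ : B →ₐ[ℂ] B' := ((AlgHom.snd ℂ B B').comp A.val).comp e.symm.toAlgHom
    have hψ : ∀ a : A, ψ (a : B × B').1 = (a : B × B').2 := by
      intro a
      have : e.symm (a : B × B').1 = a := e.symm_apply_apply a
      change (e.symm (a : B × B').1 : B × B').2 = _
      rw [this]
    have hψj : ψ.comp j = j' := AlgHom.ext fun f => hψ ⟨_, hjA f⟩
    have hψΦ : mapSnd ψ (Φ : G ⊗[ℂ] B) = (Φ' : G ⊗[ℂ] B') := by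
      refine ext_component fun π => ?_
      rw [component_mapSnd, ← hc1, ← hc2]
      exact hψ ⟨_, hΦA π⟩
    refine ⟨ψ, ⟨hψj, hψΦ⟩, fun ψ' ⟨h1, h2⟩ => ?_⟩
    refine AlgHom.ext_of_adjoin_eq_top hgen ?_
    rintro _ (⟨f, rfl⟩ | ⟨π, rfl⟩)
    · exact (DFunLike.congr_fun h1 f).trans (DFunLike.congr_fun hψj f).symm
    · change ψ' (component π (Φ : G ⊗[ℂ] B)) = ψ (component π (Φ : G ⊗[ℂ] B))
      rw [← component_mapSnd, ← component_mapSnd, h2, hψΦ]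

end SolvesRelations

end Universal

/-! ### The lower dimension bound for covariant elements. -/

section DimensionBound

variable {G : Type*} [Ring G] [HopfAlgebra ℂ G]
  {W : Type*} [AddCommGroup W] [Module ℂ W]

/-- The action of `G ⊗ End(W)` on `G ⊗ W`. -/
def tensorAct : G ⊗[ℂ] Module.End ℂ W →ₐ[ℂ] Module.End ℂ (G ⊗[ℂ] W) :=
  (Module.endTensorEndAlgHom (R := ℂ) (A := ℂ)).comp
    (Algebra.TensorProduct.map (Algebra.lmul ℂ G) (AlgHom.id ℂ (Module.End ℂ W)))

@[simp] lemma tensorAct_tmul (g h : G) (T : Module.End ℂ W) (w : W) :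
    tensorAct (g ⊗ₜ[ℂ] T) (h ⊗ₜ[ℂ] w) = (g * h) ⊗ₜ[ℂ] T w := by
  simp [tensorAct, Module.endTensorEndAlgHom_apply]

/-- A covariant invertible element forces the integral to act nontrivially. -/
lemma map_integral_ne_zero [FiniteDimensional ℂ G] [Nontrivial W]
    {Λ : G} (hΛ : IsIntegral Λ)
    (ι : G →ₐ[ℂ] Module.End ℂ W) (Φ : (G ⊗[ℂ] Module.End ℂ W)ˣ)
    (hcov : ∀ ξ : G, ((1 : G) ⊗ₜ[ℂ] ι ξ) * (Φ : G ⊗[ℂ] Module.End ℂ W) =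
      (Φ : G ⊗[ℂ] Module.End ℂ W) * mapSnd ι (flip (comul (R := ℂ) ξ))) : ι Λ ≠ 0 := by
  intro h0
  set y := mapSnd ι (flip (comul (R := ℂ) Λ)) with hy
  have h1 := hcov Λ
  rw [h0, TensorProduct.tmul_zero, zero_mul] at h1
  have h2 : y = 0 := Φ.isUnit.mul_left_cancel (by rw [mul_zero, ← h1])
  -- If ι(Λ) = 0, covariance kills (id ⊗ ι)(Δ'(Λ)), whereas t maps it to ι(∑ Λ₁S(Λ₂)) = 1.
  let t : G ⊗[ℂ] Module.End ℂ W →ₗ[ℂ] Module.End ℂ W :=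
    TensorProduct.lift ((LinearMap.mul ℂ (Module.End ℂ W)).flip.comp
      (ι.toLinearMap.comp (antipode ℂ)))
  have ht : ∀ x : G ⊗[ℂ] G, t (mapSnd ι (flip x)) = ι (mulAntipode x) := by
    intro x
    induction x using TensorProduct.induction_on with
    | zero => simp
    | tmul a b => simp [t]
    | add a b ha hb => simp only [map_add, ha, hb]
  have h3 := ht (comul (R := ℂ) Λ)
  rw [← hy, h2, map_zero, hΛ.mulAntipode_comul_eq_one, map_one] at h3
  exact one_ne_zero h3.symm

/-- A covariant invertible element forces `dim W ≥ dim G`. -/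
theorem finrank_le_of_covariant [FiniteDimensional ℂ G] [FiniteDimensional ℂ W] [Nontrivial W]
    (hS : Function.Surjective (antipode ℂ (A := G))) {Λ : G} (hΛ : IsIntegral Λ)
    (ι : G →ₐ[ℂ] Module.End ℂ W) (Φ : (G ⊗[ℂ] Module.End ℂ W)ˣ)
    (hcov : ∀ ξ : G, ((1 : G) ⊗ₜ[ℂ] ι ξ) * (Φ : G ⊗[ℂ] Module.End ℂ W) =
      (Φ : G ⊗[ℂ] Module.End ℂ W) * mapSnd ι (flip (comul (R := ℂ) ξ))) :
    Module.finrank ℂ G ≤ Module.finrank ℂ W := by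
  set y := mapSnd ι (flip (comul (R := ℂ) Λ)) with hy
  have hne := map_integral_ne_zero hΛ ι Φ hcov
  obtain ⟨w, hw⟩ : ∃ w, ι Λ w ≠ 0 := by
    by_contra hcon
    push Not at hcon
    exact hne (LinearMap.ext hcon)
  -- Behind Δ'(Λ) a vector S(h) ⊗ w acts like 1 ⊗ ι(h)w. As S is onto, y attains its whole range on
  -- 1 ⊗ W, so its rank is at most dim W.
  have hrange : LinearMap.range (tensorAct y) ≤
      LinearMap.range ((tensorAct y).comp (TensorProduct.mk ℂ G W 1)) := by
    rintro _ ⟨z, rfl⟩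
    induction z using TensorProduct.induction_on with
    | zero => simp
    | tmul g w =>
      obtain ⟨h, rfl⟩ := hS g
      refine ⟨ι h w, ?_⟩
      have h1 := congrArg (fun x => tensorAct (mapSnd ι (flip x)) (1 ⊗ₜ[ℂ] w))
        (hΛ.comul_mul_tmul_one h)
      simpa [hy] using h1
    | add a b ha hb => rw [map_add]; exact Submodule.add_mem _ ha hb
  have hbound : Module.finrank ℂ (LinearMap.range (tensorAct y)) ≤ Module.finrank ℂ W :=
    (Submodule.finrank_mono hrange).trans (LinearMap.finrank_range_le _)
  -- Covariance says ΦyΦ⁻¹ = 1 ⊗ ι(Λ), and the range of the latter contains G ⊗ ι(Λ)w, of dimension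
  -- dim G.
  let q : G →ₗ[ℂ] G ⊗[ℂ] W := (TensorProduct.mk ℂ G W).flip (ι Λ w)
  have hq : Function.Injective q := by
    obtain ⟨f, hf⟩ := Module.Projective.exists_dual_eq_one ℂ hw
    refine Function.LeftInverse.injective
      (g := (TensorProduct.rid ℂ G).toLinearMap.comp (TensorProduct.map LinearMap.id f)) ?_
    intro g
    simp [q, hf]
  have hq' : LinearMap.range q ≤
      (LinearMap.range (tensorAct y)).map (tensorAct (Φ : G ⊗[ℂ] Module.End ℂ W)) := by
    rintro _ ⟨g, rfl⟩
    refine ⟨tensorAct y (tensorAct ((Φ⁻¹ : (G ⊗[ℂ] Module.End ℂ W)ˣ) : G ⊗[ℂ] Module.End ℂ W)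
      (g ⊗ₜ w)), ⟨_, rfl⟩, ?_⟩
    rw [← Module.End.mul_apply, ← Module.End.mul_apply, ← map_mul, ← map_mul, ← hcov,
      mul_assoc, Units.mul_inv, mul_one, tensorAct_tmul, one_mul]
    rfl
  calc Module.finrank ℂ G = Module.finrank ℂ (LinearMap.range q) :=
        (LinearMap.finrank_range_of_inj hq).symm
    _ ≤ _ := Submodule.finrank_mono hq'
    _ ≤ _ := Submodule.finrank_map_le _ _
    _ ≤ _ := hbound

end DimensionBound

/-! ### A solution on the dual of `G` -/

section Regular

variable {G : Type*} [Ring G] [HopfAlgebra ℂ G]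

/-- The convolution product of linear forms. -/
def conv : Module.Dual ℂ G →ₗ[ℂ] Module.End ℂ (Module.Dual ℂ G) :=
  LinearMap.mk₂ ℂ (fun π φ => (LinearMap.mul' ℂ ℂ).comp ((TensorProduct.map π φ).comp comul))
    (by intros; ext; simp [TensorProduct.map_add_left])
    (by intros; ext; simp [TensorProduct.map_smul_left])
    (by intros; ext; simp [TensorProduct.map_add_right])
    (by intros; ext; simp [TensorProduct.map_smul_right])

lemma conv_apply (π φ : Module.Dual ℂ G) (h : G) :
    conv π φ h = LinearMap.mul' ℂ ℂ (TensorProduct.map π φ (comul (R := ℂ) h)) := rfl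

lemma conv_mul (π φ : Module.Dual ℂ G) : conv π * conv φ = conv (conv π φ) := by
  ext χ h
  let f : G ⊗[ℂ] (G ⊗[ℂ] G) →ₗ[ℂ] ℂ := (LinearMap.mul' ℂ ℂ).comp
    (TensorProduct.map π ((LinearMap.mul' ℂ ℂ).comp (TensorProduct.map φ χ)))
  have hf : ∀ (x : G ⊗[ℂ] G) (c : G), f (leg12 x * (1 ⊗ₜ[ℂ] (1 ⊗ₜ[ℂ] c))) =
      LinearMap.mul' ℂ ℂ (TensorProduct.map π φ x) * χ c := by
    intro x c
    induction x using TensorProduct.induction_on with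
    | zero => simp
    | tmul a b => simp [f, mul_assoc]
    | add a b ha hb => simp only [map_add, add_mul, ha, hb]
  have h1 := coassoc_eval f ((LinearMap.mul' ℂ ℂ).comp (TensorProduct.map (conv π φ) χ))
    (fun a c => by rw [hf]; rfl) h
  rw [mapSnd_comul_eval f ((LinearMap.mul' ℂ ℂ).comp (TensorProduct.map π (conv φ χ)))
    (fun a b => rfl)] at h1
  exact h1

lemma conv_counit : conv (counit : Module.Dual ℂ G) = 1 := by
  ext φ h
  have e : ∀ x : G ⊗[ℂ] G, LinearMap.mul' ℂ ℂ (TensorProduct.map counit φ x) =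
      φ (component counit x) := by
    intro x
    induction x using TensorProduct.induction_on with
    | zero => simp
    | tmul a b => simp
    | add a b ha hb => simp only [map_add, ha, hb]
  rw [conv_apply, e, component_counit_comul]
  rfl

/-- Right translation on linear forms. -/
def translate : G →ₐ[ℂ] Module.End ℂ (Module.Dual ℂ G) :=
  AlgHom.ofLinearMap
    (LinearMap.mk₂ ℂ (fun g φ => φ.comp (LinearMap.mulRight ℂ g))
      (by intros; ext; simp [mul_add]) (by intros; ext; simp)
      (by intros; ext; simp) (by intros; ext; simp))
    (by ext; simp) (by intros; ext; simp [mul_assoc])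

@[simp] lemma translate_apply (g : G) (φ : Module.Dual ℂ G) (h : G) :
    translate g φ h = φ (h * g) := rfl

variable [FiniteDimensional ℂ G]

variable (G) in
/-- The canonical element `∑ bᵢ ⊗ conv(bⁱ)`. -/
def canonicalElt : G ⊗[ℂ] Module.End ℂ (Module.Dual ℂ G) :=
  ∑ i, Module.finBasis ℂ G i ⊗ₜ[ℂ] conv ((Module.finBasis ℂ G).coord i)

lemma component_canonicalElt (π : Module.Dual ℂ G) : component π (canonicalElt G) = conv π := by
  rw [canonicalElt, map_sum]
  simp only [component_tmul, ← map_smul, ← map_sum]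
  congr 1
  refine (Module.finBasis ℂ G).ext fun k => ?_
  simp

/-- Convolution is dual to Δ, so the canonical element fuses without any F, and in the opposite
order; its inverse has the order required of Φ. -/
lemma leg1_mul_leg2_canonicalElt :
    leg1 (canonicalElt G) * leg2 (canonicalElt G) = comulFirst (canonicalElt G) := by
  refine ext_component fun φ => ext_component fun π => ?_
  have h1 := component_component_mul_comulFirst π φ 1 1 1 (canonicalElt G)
  rw [← Algebra.TensorProduct.one_def, ← Algebra.TensorProduct.one_def, one_mul, one_mul,
    component_canonicalElt] at h1
  rw [h1, leg2_apply, component_mul_one_tmul, component_leg1, component_one_tmul_mul,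
    component_canonicalElt, component_canonicalElt, conv_mul]
  congr 1
  ext h
  simp [conv_apply, ← Algebra.TensorProduct.one_def]

lemma one_tmul_translate_mul_canonicalElt (g : G) :
    ((1 : G) ⊗ₜ[ℂ] translate g) * canonicalElt G =
      canonicalElt G * mapSnd translate (comul (R := ℂ) g) := by
  refine ext_component fun π => ?_
  rw [component_one_tmul_mul, component_canonicalElt]
  ext φ h
  have e0 : ∀ (y : G ⊗[ℂ] Module.End ℂ (Module.Dual ℂ G)) (a : G)
      (T : Module.End ℂ (Module.Dual ℂ G)), component π (y * (a ⊗ₜ[ℂ] T)) =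
        component (π.comp (LinearMap.mulRight ℂ a)) y * T := by
    intro y a T
    induction y using TensorProduct.induction_on with
    | zero => simp
    | tmul c d => simp
    | add c d hc hd => simp only [map_add, add_mul, hc, hd]
  have e1 : ∀ x : G ⊗[ℂ] G, component π (canonicalElt G * mapSnd translate x) φ h =
      LinearMap.mul' ℂ ℂ (TensorProduct.map π φ (comul (R := ℂ) h * x)) := by
    intro x
    induction x using TensorProduct.induction_on with
    | zero => simp
    | tmul a b =>
      rw [mapSnd_tmul, e0, component_canonicalElt, Module.End.mul_apply, conv_apply]
      induction comul (R := ℂ) h using TensorProduct.induction_on with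
      | zero => simp
      | tmul c d => simp
      | add c d hc hd => simp only [map_add, add_mul, hc, hd]
    | add a b ha hb => simp only [map_add, mul_add, LinearMap.add_apply, ha, hb]
  rw [e1, ← Bialgebra.comul_mul]
  rfl

/-- (S ⊗ id) of the canonical element is a left inverse, by the antipode axiom; in finite dimension
this suffices. -/
lemma isUnit_canonicalElt : IsUnit (canonicalElt G) := by
  let t : G ⊗[ℂ] (G ⊗[ℂ] Module.End ℂ (Module.Dual ℂ G)) →ₗ[ℂ]
      G ⊗[ℂ] Module.End ℂ (Module.Dual ℂ G) :=
    (antipodeMul.rTensor _).comp (TensorProduct.assoc ℂ G G _).symm.toLinearMap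
  have e1 : ∀ x y, t (leg1 x * leg2 y) = (antipode ℂ).rTensor _ x * y := by
    intro x y
    induction x using TensorProduct.induction_on with
    | zero => simp
    | tmul a b =>
      induction y using TensorProduct.induction_on with
      | zero => simp
      | tmul c d => simp [t]
      | add c d hc hd =>
        simp only [map_add, mul_add] at hc hd ⊢
        rw [hc, hd]
    | add a b ha hb => simp only [map_add, add_mul, ha, hb]
  have e2 : ∀ x, t (comulFirst x) = (1 : G) ⊗ₜ[ℂ] component counit x := by
    intro x
    induction x using TensorProduct.induction_on with
    | zero => simp
    | tmul a b =>
      have : ∀ z : G ⊗[ℂ] G, t (leg12 z * ((1 : G) ⊗ₜ[ℂ] ((1 : G) ⊗ₜ[ℂ] b))) =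
          antipodeMul z ⊗ₜ[ℂ] b := by
        intro z
        induction z using TensorProduct.induction_on with
        | zero => simp
        | tmul c d => simp [t]
        | add c d hc hd => simp only [map_add, add_mul, TensorProduct.add_tmul, hc, hd]
      rw [comulFirst_tmul, this, antipodeMul_comul, Algebra.algebraMap_eq_smul_one,
        component_tmul, TensorProduct.smul_tmul]
    | add a b ha hb => simp only [map_add, TensorProduct.tmul_add, ha, hb]
  have h1 : (antipode ℂ).rTensor _ (canonicalElt G) * canonicalElt G = 1 := by
    rw [← e1, leg1_mul_leg2_canonicalElt, e2, component_canonicalElt, conv_counit]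
    rfl
  have : IsArtinianRing (G ⊗[ℂ] Module.End ℂ (Module.Dual ℂ G)) :=
    IsArtinianRing.of_finite ℂ (G ⊗[ℂ] Module.End ℂ (Module.Dual ℂ G))
  have hu : IsUnit ((antipode ℂ).rTensor _ (canonicalElt G)) := by
    rw [IsArtinianRing.isUnit_iff_isRightRegular]
    intro x y hxy
    have := congrArg (· * canonicalElt G) hxy
    simpa [mul_assoc, h1] using this
  obtain ⟨u, hu⟩ := hu
  rw [← hu] at h1
  exact ⟨u⁻¹, (Units.eq_inv_of_mul_eq_one_left h1).symm⟩

variable [StarRing G] [StarModule ℂ G]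

variable (G) in
/-- `g ⊗ c ↦ ε(c) g`. -/
def evalCenter : G ⊗[ℂ] Center G →ₐ[ℂ] G :=
  (Algebra.TensorProduct.rid ℂ ℂ G).toAlgHom.comp (Algebra.TensorProduct.map (AlgHom.id ℂ G)
    ((Bialgebra.counitAlgHom ℂ G).comp (Center G).toSubalgebra.val))

@[simp] lemma evalCenter_tmul (g : G) (c : Center G) :
    evalCenter G (g ⊗ₜ[ℂ] c) = counit (R := ℂ) (c : G) • g := by
  simp [evalCenter]

lemma mapSnd_evalCenter_comulFirst (y : G ⊗[ℂ] Center G) :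
    mapSnd (evalCenter G) (comulFirst y) = comul (R := ℂ) (evalCenter G y) := by
  induction y using TensorProduct.induction_on with
  | zero => simp
  | tmul a b =>
    have : ∀ z : G ⊗[ℂ] G, mapSnd (evalCenter G)
        (leg12 z * ((1 : G) ⊗ₜ[ℂ] ((1 : G) ⊗ₜ[ℂ] b))) = counit (R := ℂ) (b : G) • z := by
      intro z
      induction z using TensorProduct.induction_on with
      | zero => simp
      | tmul c d => simp
      | add c d hc hd => simp only [map_add, add_mul, smul_add, hc, hd]
    rw [comulFirst_tmul, this, evalCenter_tmul, map_smul]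
  | add a b ha hb => simp only [map_add, ha, hb]

/-- The relations have a solution in the endomorphisms of the dual of `G`. -/
theorem exists_solvesRelations {𝓡 : RibbonStructure G} {F : (G ⊗[ℂ] (G ⊗[ℂ] Center G))ˣ}
    {σ : Center G →ₐ[ℂ] G ⊗[ℂ] Center G} (hF : StructureRelations 𝓡 F σ) :
    ∃ (j : Center G →ₐ[ℂ] Module.End ℂ (Module.Dual ℂ G))
      (Φ : (G ⊗[ℂ] Module.End ℂ (Module.Dual ℂ G))ˣ), SolvesRelations F σ j Φ := by
  obtain ⟨Θ, hΘ⟩ := isUnit_canonicalElt (G := G)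
  -- The factor 𝒞 is evaluated by ε and the remaining auxiliary leg acts by translation. With j = p
  -- ∘ σ, the new leg produced by σ becomes the operator leg.
  let p : G ⊗[ℂ] Center G →ₐ[ℂ] Module.End ℂ (Module.Dual ℂ G) := translate.comp (evalCenter G)
  let F₀ : (G ⊗[ℂ] Module.End ℂ (Module.Dual ℂ G))ˣ := Units.map (mapSnd (G := G) p).toMonoidHom F
  have hF₀ : (F₀ : G ⊗[ℂ] Module.End ℂ (Module.Dual ℂ G)) = mapSnd p (F : G ⊗[ℂ] _) := rfl
  have hcomm : ∀ y : G ⊗[ℂ] Center G,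
      ((1 : G) ⊗ₜ[ℂ] p y) * (Θ : G ⊗[ℂ] Module.End ℂ (Module.Dual ℂ G)) =
        (Θ : G ⊗[ℂ] Module.End ℂ (Module.Dual ℂ G)) * mapSnd p (comulFirst y) := by
    intro y
    rw [hΘ, ← mapSnd_mapSnd, mapSnd_evalCenter_comulFirst, ← one_tmul_translate_mul_canonicalElt]
    rfl
  -- For Φ = F₀Θ⁻¹ the operator product is the image of the cocycle identity under p, and the
  -- exchange relation is the image of σ²σ¹ = Δ_F ∘ σ.
  refine ⟨p.comp σ, F₀ * Θ⁻¹, ?_, ?_⟩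
  · have hY : ∀ y : G ⊗[ℂ] (G ⊗[ℂ] Center G), leg1 (mapSnd p y) * leg2 (Θ : G ⊗[ℂ] _) =
        leg2 (Θ : G ⊗[ℂ] _) * mapSnd (mapSnd p) (mapSnd comulFirst y) := by
      intro y
      induction y using TensorProduct.induction_on with
      | zero => simp
      | tmul a b => simp [hcomm]
      | add a b ha hb => simp only [map_add, mul_add, add_mul, ha, hb]
    have hcoc := congrArg (mapSnd (G := G) (mapSnd (G := G) p)) hF.cocycle
    rw [map_mul, map_mul, mapSnd_leg2, mapSnd_comulFirst, mapSnd_mapSnd (mapSnd σ) (mapSnd p),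
      mapSnd_comp_mapSnd, ← hF₀] at hcoc
    have hΔ := leg1_mul_leg2_canonicalElt (G := G)
    rw [← hΘ] at hΔ
    have hYF := hY (F : G ⊗[ℂ] (G ⊗[ℂ] Center G))
    rw [← hF₀] at hYF
    let l1 := Units.map (leg1 (G := G) (X := Module.End ℂ (Module.Dual ℂ G))).toMonoidHom
    let l2 := Units.map (leg2 (G := G) (X := Module.End ℂ (Module.Dual ℂ G))).toMonoidHom
    let lD := Units.map (comulFirst (G := G) (X := Module.End ℂ (Module.Dual ℂ G))).toMonoidHom
    let jF := Units.map (mapSnd (G := G) (mapSnd (G := G) (p.comp σ))).toMonoidHom F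
    let Y := Units.map ((mapSnd (G := G) (mapSnd (G := G) p)).comp
      (mapSnd (G := G) comulFirst)).toMonoidHom F
    have u1 : l1 F₀ * l2 Θ = l2 Θ * Y := Units.ext hYF
    have u2 : l1 Θ * l2 Θ = lD Θ := Units.ext hΔ
    have u3 : l2 F₀ * Y = jF * lD F₀ := Units.ext hcoc
    have goal : l2 (F₀ * Θ⁻¹) * l1 (F₀ * Θ⁻¹) = jF * lD (F₀ * Θ⁻¹) := by
      rw [map_mul, map_mul, map_mul, map_inv, map_inv, map_inv, ← u2, ← mul_assoc jF, ← u3]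
      have : l1 F₀ = l2 Θ * Y * (l2 Θ)⁻¹ := by rw [← u1]; group
      rw [this]
      group
    exact congrArg Units.val goal
  · intro f
    have h1 := congrArg (mapSnd (G := G) p) (hF.σ_σ f)
    rw [comulFFirst, map_mul, map_mul, mapSnd_mapSnd] at h1
    have h2 := hcomm (σ f)
    have h3 : (((Θ⁻¹ : (G ⊗[ℂ] Module.End ℂ (Module.Dual ℂ G))ˣ)) : G ⊗[ℂ] _) *
        ((1 : G) ⊗ₜ[ℂ] p (σ f)) = mapSnd p (comulFirst (σ f)) *
        (((Θ⁻¹ : (G ⊗[ℂ] Module.End ℂ (Module.Dual ℂ G))ˣ)) : G ⊗[ℂ] _) := by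
      rw [Units.inv_mul_eq_iff_eq_mul, ← mul_assoc, ← h2, mul_assoc, Units.mul_inv, mul_one]
    rw [Units.val_mul, mul_assoc]
    change _ * (_ * ((1 : G) ⊗ₜ[ℂ] p (σ f))) = _
    have h4 : mapSnd p ((F⁻¹ : (G ⊗[ℂ] (G ⊗[ℂ] Center G))ˣ) : G ⊗[ℂ] (G ⊗[ℂ] Center G)) *
        (F₀ : G ⊗[ℂ] Module.End ℂ (Module.Dual ℂ G)) = 1 := by
      rw [hF₀, ← map_mul, Units.inv_mul, map_one]
    have key : ∀ {M : Type _} [Monoid M] {a b c d e : M}, e = a * b * c → c * a = 1 →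
        a * (b * d) = e * (a * d) := by
      intro M _ a b c d e h h'
      rw [h, mul_assoc _ c, ← mul_assoc c, h', one_mul, mul_assoc]
    rw [h3]
    exact key h1 h4

end Regular

/-! ### Irreducibility -/

section Irreducibility

/-- An irreducible algebra of operators on a finite-dimensional complex space is the algebra of all
operators. -/
lemma subalgebra_eq_top_of_irreducible {W : Type*} [AddCommGroup W] [Module ℂ W]
    [FiniteDimensional ℂ W] [Nontrivial W] (A : Subalgebra ℂ (Module.End ℂ W))
    (hA : ∀ U : Submodule ℂ W, (∀ a ∈ A, ∀ x ∈ U, a x ∈ U) → U = ⊥ ∨ U = ⊤) : A = ⊤ := by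
  have hsimple : IsSimpleModule A W := by
    rw [isSimpleModule_iff]
    refine { eq_bot_or_eq_top := fun U => ?_ }
    rcases hA (U.restrictScalars ℂ) (fun a ha x hx => U.smul_mem ⟨a, ha⟩ hx) with h | h
    · exact Or.inl ((Submodule.restrictScalars_eq_bot_iff ..).1 h)
    · exact Or.inr ((Submodule.restrictScalars_eq_top_iff ..).1 h)
  rw [eq_top_iff]
  intro T _
  -- By Schur's lemma the commutant of A is ℂ, so every linear T is linear over it; the density
  -- theorem then finds T in A.
  let f : Module.End (Module.End A W) W :=
    { toFun := T
      map_add' := T.map_add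
      map_smul' := fun φ x => by
        obtain ⟨c, rfl⟩ :=
          (IsSimpleModule.algebraMap_end_bijective_of_isAlgClosed (A := A) (V := W) ℂ).2 φ
        exact T.map_smul c x }
  classical
  let b := Module.finBasis ℂ W
  obtain ⟨r, hr⟩ := jacobson_density (R := A) f (Finset.univ.image b)
  have : T = r := b.ext fun i => hr (b i) (by simp)
  rw [this]
  exact r.2

variable {G : Type*} [Ring G] [HopfAlgebra ℂ G] [StarRing G] [StarModule ℂ G]
  [FiniteDimensional ℂ G] {𝓡 : RibbonStructure G} {F : (G ⊗[ℂ] (G ⊗[ℂ] Center G))ˣ}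
  {σ : Center G →ₐ[ℂ] G ⊗[ℂ] Center G}

/-- The action of a subalgebra of `End(W)` on an invariant subspace. -/
def restrictAct {W : Type*} [AddCommGroup W] [Module ℂ W] (A : Subalgebra ℂ (Module.End ℂ W))
    (U : Submodule ℂ W) (hU : ∀ a ∈ A, ∀ x ∈ U, a x ∈ U) : A →ₐ[ℂ] Module.End ℂ U where
  toFun a := (a : Module.End ℂ W).restrict (hU a a.2)
  map_one' := rfl
  map_mul' _ _ := rfl
  map_zero' := rfl
  map_add' _ _ := rfl
  commutes' _ := rfl

/-- A solution in the endomorphisms of a space of dimension at most `dim G` is irreducible. -/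
theorem SolvesRelations.adjoin_eq_top {W : Type*} [AddCommGroup W] [Module ℂ W]
    [FiniteDimensional ℂ W] [Nontrivial W] {j : Center G →ₐ[ℂ] Module.End ℂ W}
    {Φ : (G ⊗[ℂ] Module.End ℂ W)ˣ} (h : SolvesRelations F σ j Φ)
    (hF : StructureRelations 𝓡 F σ)
    (hN : ∀ g : G, ∃ π : Module.Dual ℂ G, rightComponent π (𝓡.N : G ⊗[ℂ] G) = g)
    (hS : Function.Surjective (antipode ℂ (A := G))) {Λ : G} (hΛ : IsIntegral Λ)
    (hW : Module.finrank ℂ W ≤ Module.finrank ℂ G) :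
    Algebra.adjoin ℂ (generators j Φ) = ⊤ := by
  refine subalgebra_eq_top_of_irreducible _ fun U hU => ?_
  by_cases hbot : U = ⊥
  · exact Or.inl hbot
  have : Nontrivial U := Submodule.nontrivial_iff_ne_bot.2 hbot
  right
  -- Restricting to a nonzero invariant U again gives a solution, hence a covariant Φ, so dim U ≥
  -- dim G ≥ dim W.
  obtain ⟨jA, ΦA, -, -, hA⟩ := h.exists_restrict
  have hU' := hA.map (restrictAct _ U hU)
  obtain ⟨ι, -, hcov, -⟩ := hU'.exists_hopfAction hF hN
  refine Submodule.eq_top_of_finrank_eq (le_antisymm (Submodule.finrank_le U) ?_)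
  exact hW.trans (finrank_le_of_covariant hS hΛ ι _ hcov)

/-- The relations force `G` to be commutative. -/
theorem StructureRelations.mul_comm (hF : StructureRelations 𝓡 F σ)
    (hN : ∀ g : G, ∃ π : Module.Dual ℂ G, rightComponent π (𝓡.N : G ⊗[ℂ] G) = g)
    (hS : Function.Surjective (antipode ℂ (A := G))) {Λ : G} (hΛ : IsIntegral Λ) (x y : G) :
    x * y = y * x := by
  obtain ⟨j, Φ, h⟩ := exists_solvesRelations hF
  have := nontrivial_of_hopf G
  have hdual : Module.finrank ℂ (Module.Dual ℂ G) = Module.finrank ℂ G :=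
    Subspace.dual_finrank_eq
  -- All (dim G)² dimensions of operators on the dual are generated, which the upper bound allows
  -- only if dim 𝒞 = dim G.
  have htop := h.adjoin_eq_top hF hN hS hΛ hdual.le
  have hle := h.finrank_adjoin_le.2
  rw [htop, subalgebra_top_finrank_eq_submodule_top_finrank, finrank_top,
    Module.finrank_linearMap, hdual] at hle
  have hcenter : Subalgebra.toSubmodule (Center G).toSubalgebra = ⊤ :=
    Submodule.eq_top_of_finrank_eq (le_antisymm (Submodule.finrank_le _)
      (Nat.le_of_mul_le_mul_right hle Module.finrank_pos))
  have hx : x ∈ Subalgebra.toSubmodule (Center G).toSubalgebra := by rw [hcenter]; trivial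
  exact ((Subalgebra.mem_center_iff (R := ℂ)).1 hx y).symm

end Irreducibility

/-! ### Characters -/

section Characters

variable {G : Type*} [Ring G] [HopfAlgebra ℂ G]
  {X : Type*} [Ring X] [Algebra ℂ X] {Y : Type*} [Ring Y] [Algebra ℂ Y]

/-- `χ ⊗ id` for a character `χ`. -/
def evalFirst (χ : G →ₐ[ℂ] ℂ) : G ⊗[ℂ] X →ₐ[ℂ] X :=
  (Algebra.TensorProduct.lid ℂ X).toAlgHom.comp (Algebra.TensorProduct.map χ (AlgHom.id ℂ X))

@[simp] lemma evalFirst_tmul (χ : G →ₐ[ℂ] ℂ) (g : G) (x : X) :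
    evalFirst χ (g ⊗ₜ[ℂ] x) = χ g • x := by
  simp [evalFirst]

lemma evalFirst_eq_component (χ : G →ₐ[ℂ] ℂ) (y : G ⊗[ℂ] X) :
    evalFirst χ y = component χ.toLinearMap y := by
  induction y using TensorProduct.induction_on with
  | zero => simp
  | tmul a b => simp
  | add a b ha hb => simp only [map_add, ha, hb]

lemma evalFirst_mapSnd (χ : G →ₐ[ℂ] ℂ) (f : X →ₐ[ℂ] Y) (y : G ⊗[ℂ] X) :
    evalFirst χ (mapSnd f y) = f (evalFirst χ y) := by
  rw [evalFirst_eq_component, component_mapSnd, evalFirst_eq_component]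

lemma evalFirst_leg1 (χ : G →ₐ[ℂ] ℂ) (y : G ⊗[ℂ] X) :
    evalFirst χ (leg1 y) = (1 : G) ⊗ₜ[ℂ] evalFirst χ y := by
  induction y using TensorProduct.induction_on with
  | zero => simp
  | tmul a b => simp
  | add a b ha hb => simp only [map_add, TensorProduct.tmul_add, ha, hb]

lemma evalFirst_leg12 (χ : G →ₐ[ℂ] ℂ) (y : G ⊗[ℂ] G) :
    evalFirst χ (leg12 (X := X) y) = evalFirst χ y ⊗ₜ[ℂ] (1 : X) := by
  induction y using TensorProduct.induction_on with
  | zero => simp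
  | tmul a b => simp [TensorProduct.smul_tmul']
  | add a b ha hb => simp only [map_add, TensorProduct.add_tmul, ha, hb]

/-- The product of two characters. -/
def charMul (χ ψ : G →ₐ[ℂ] ℂ) : G →ₐ[ℂ] ℂ :=
  ψ.comp ((evalFirst χ).comp (Bialgebra.comulAlgHom ℂ G))

lemma charMul_apply (χ ψ : G →ₐ[ℂ] ℂ) (g : G) :
    charMul χ ψ g = ψ (evalFirst χ (comul (R := ℂ) g)) := rfl

lemma evalFirst_evalFirst_comulFirst (χ ψ : G →ₐ[ℂ] ℂ) (y : G ⊗[ℂ] X) :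
    evalFirst ψ (evalFirst χ (comulFirst y)) = evalFirst (charMul χ ψ) y := by
  induction y using TensorProduct.induction_on with
  | zero => simp
  | tmul a b =>
    rw [comulFirst_tmul, map_mul, map_mul, evalFirst_leg12, evalFirst_tmul, evalFirst_tmul,
      evalFirst_tmul, charMul_apply]
    simp
  | add a b ha hb => simp only [map_add, ha, hb]

lemma evalFirst_star [StarRing G] [StarModule ℂ G] [StarRing X] [StarModule ℂ X]
    {χ : G →ₐ[ℂ] ℂ} (hχ : ∀ g, χ (star g) = star (χ g)) (y : G ⊗[ℂ] X) :
    evalFirst χ (star y) = star (evalFirst χ y) := by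
  induction y using TensorProduct.induction_on with
  | zero => simp
  | tmul a b => simp [TensorProduct.star_tmul, hχ]
  | add a b ha hb => simp only [star_add, map_add, ha, hb]

lemma apply_evalFirst_flip (χ ψ : G →ₐ[ℂ] ℂ) (y : G ⊗[ℂ] G) :
    ψ (evalFirst χ (flip y)) = χ (evalFirst ψ y) := by
  induction y using TensorProduct.induction_on with
  | zero => simp
  | tmul a b => simp [mul_comm]
  | add a b ha hb => simp only [map_add, ha, hb]

variable {I : Type*}

/-- The `χ i` are all the characters of `G`; they separate the points of `G` and respect `*`. -/
structure IsCharacterSystem [StarRing G] (χ : I → G →ₐ[ℂ] ℂ) : Prop where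
  bijective : Function.Bijective χ
  separating : ∀ x : G, (∀ i, χ i x = 0) → x = 0
  apply_star : ∀ i g, χ i (star g) = star (χ i g)

namespace IsCharacterSystem

variable [StarRing G] {χ : I → G →ₐ[ℂ] ℂ}

lemma ext_apply (hχ : IsCharacterSystem χ) {x y : G} (h : ∀ i, χ i x = χ i y) : x = y :=
  sub_eq_zero.1 (hχ.separating _ fun i => by rw [map_sub, h, sub_self])

lemma exists_eq (hχ : IsCharacterSystem χ) (φ : G →ₐ[ℂ] ℂ) : ∃ i, χ i = φ := hχ.bijective.2 φ

lemma card_eq [Fintype I] [FiniteDimensional ℂ G] (hχ : IsCharacterSystem χ) :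
    Fintype.card I = Module.finrank ℂ G := by
  refine le_antisymm ?_ ?_
  · rw [← Nat.card_eq_fintype_card, Nat.card_congr (Equiv.ofBijective χ hχ.bijective)]
    exact card_algHom_le_finrank ℂ G ℂ
  · rw [← Module.finrank_fintype_fun_eq_card ℂ]
    refine LinearMap.finrank_le_finrank_of_injective
      (f := LinearMap.pi fun i => (χ i).toLinearMap) ?_
    intro x y hxy
    exact hχ.ext_apply fun i => congrFun hxy i

lemma exists_apply_eq [Fintype I] [FiniteDimensional ℂ G] (hχ : IsCharacterSystem χ) (c : I → ℂ) :
    ∃ g : G, ∀ i, χ i g = c i := by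
  let f : G →ₗ[ℂ] (I → ℂ) := LinearMap.pi fun i => (χ i).toLinearMap
  have hinj : Function.Injective f := fun x y hxy => hχ.ext_apply fun i => congrFun hxy i
  have hsurj := (LinearMap.injective_iff_surjective_of_finrank_eq_finrank (f := f)
    (by rw [Module.finrank_fintype_fun_eq_card, hχ.card_eq])).1 hinj
  obtain ⟨g, hg⟩ := hsurj c
  exact ⟨g, fun i => congrFun hg i⟩

lemma mul_commute (hχ : IsCharacterSystem χ) (x y : G) : x * y = y * x :=
  hχ.ext_apply fun i => by rw [map_mul, map_mul, mul_comm]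

lemma ext_evalFirst [FiniteDimensional ℂ G] [Fintype I] (hχ : IsCharacterSystem χ)
    {y z : G ⊗[ℂ] X} (h : ∀ i, evalFirst (χ i) y = evalFirst (χ i) z) : y = z := by
  classical
  have hspan : ∀ π : Module.Dual ℂ G, ∃ c : I → ℂ, π = ∑ i, c i • (χ i).toLinearMap := by
    intro π
    -- These idempotents form a basis of G dual to the characters, so the characters span all linear
    -- forms.
    choose e he using fun k : I => hχ.exists_apply_eq (fun i => if i = k then 1 else 0)
    refine ⟨fun k => π (e k), ?_⟩
    ext g
    have : g = ∑ k, χ k g • e k := hχ.ext_apply fun i => by simp [map_sum, he]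
    conv_lhs => rw [this]
    simp [mul_comm]
  refine ext_component fun π => ?_
  obtain ⟨c, rfl⟩ := hspan π
  have key : ∀ w : G ⊗[ℂ] X, component (∑ i, c i • (χ i).toLinearMap) w =
      ∑ i, c i • evalFirst (χ i) w := by
    intro w
    induction w using TensorProduct.induction_on with
    | zero => simp
    | tmul a b => simp [Finset.sum_smul, smul_smul]
    | add a b ha hb => simp only [map_add, smul_add, Finset.sum_add_distrib, ha, hb]
  simp only [key, h]

end IsCharacterSystem

end Characters

/-! ### Irreducible representations of a commutative G. -/

section IrrepCharacters

variable {G : Type u₁} [Ring G] [HopfAlgebra ℂ G] [StarRing G] [StarModule ℂ G]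
variable {I : Type u₂} {V : I → Type u₃}
  [∀ i, NormedAddCommGroup (V i)] [∀ i, InnerProductSpace ℂ (V i)]
  [∀ i, FiniteDimensional ℂ (V i)] [∀ i, CompleteSpace (V i)]
  {τ : ∀ i, G →⋆ₐ[ℂ] (V i →L[ℂ] V i)}

lemma IsIrrepSystem.exists_characters [Fintype I] [FiniteDimensional ℂ G] [IsSemisimpleRing G]
    (hτ : IsIrrepSystem τ)
    (hcomm : ∀ x y : G, x * y = y * x) :
    (∀ i, Module.finrank ℂ (V i) = 1) ∧ ∃ χ : I → G →ₐ[ℂ] ℂ, IsCharacterSystem χ ∧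
      ∀ i g, τ i g = χ i g • 1 := by
  choose c hc using fun i g => hτ.exists_smul_of_central (hcomm g) i
  have hinj : ∀ (i : I) {s t : ℂ}, s • (1 : V i →L[ℂ] V i) = t • 1 → s = t := by
    intro i s t hst
    have := hτ.nontrivial i
    obtain ⟨x, hx⟩ := exists_ne (0 : V i)
    have h1 := congrArg (fun T : V i →L[ℂ] V i => T x) hst
    exact smul_left_injective ℂ hx (by simpa using h1)
  let χ : I → G →ₐ[ℂ] ℂ := fun i => AlgHom.ofLinearMap
    { toFun := c i
      map_add' := fun x y => hinj i (by rw [← hc, map_add, hc, hc, add_smul])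
      map_smul' := fun s x => hinj i (by
        rw [← hc, map_smul, hc, smul_smul]; rfl) }
    (hinj i (by
      change c i 1 • _ = _
      rw [← hc, map_one, one_smul]))
    (fun x y => hinj i (by
      change c i (x * y) • _ = (c i x * c i y) • _
      rw [← hc, map_mul, hc, hc, smul_mul_smul_comm, one_mul]))
  have hχ : ∀ i g, τ i g = χ i g • 1 := hc
  have hdim : ∀ i, Module.finrank ℂ (V i) = 1 := by
    intro i
    have := hτ.nontrivial i
    obtain ⟨x, hx⟩ := exists_ne (0 : V i)
    rw [finrank_eq_one_iff_of_nonzero x hx]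
    refine (hτ.irreducible i (Submodule.span ℂ {x}) fun ξ y hy => ?_).resolve_left
      fun h => hx (Submodule.span_singleton_eq_bot.1 h)
    rw [hχ]
    exact Submodule.smul_mem _ _ hy
  have hsep : ∀ x : G, (∀ i, χ i x = 0) → x = 0 := fun x hx =>
    hτ.faithful fun i => by rw [hχ, hx, zero_smul]
  have hχinj : Function.Injective χ := by
    intro i k hik
    refine hτ.inequivalent i k (LinearEquiv.ofFinrankEq _ _ ((hdim i).trans (hdim k).symm)) ?_
    intro ξ x
    rw [hχ, hχ, hik]
    simp
  have hle : Module.finrank ℂ G ≤ Fintype.card I := by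
    rw [← Module.finrank_fintype_fun_eq_card ℂ]
    refine LinearMap.finrank_le_finrank_of_injective
      (f := LinearMap.pi fun i => (χ i).toLinearMap) ?_
    intro x y hxy
    exact sub_eq_zero.1 (hsep _ fun i => by
      rw [map_sub, sub_eq_zero]; exact congrFun hxy i)
  refine ⟨hdim, χ, ⟨?_, hsep, ?_⟩, hχ⟩
  -- Distinct characters number at most dim G, and the separating family χ already has that many.
  · refine hχinj.bijective_of_nat_card_le ((card_algHom_le_finrank ℂ G ℂ).trans ?_)
    rwa [Nat.card_eq_fintype_card]
  · intro i g
    refine hinj i ?_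
    rw [← hχ, map_star, hχ, star_smul, star_one]

end IrrepCharacters

/-! ### Unitarity on characters, S = 1 and the Gauss sum. -/

section CommutativeRibbon

variable {G : Type*} [Ring G] [HopfAlgebra ℂ G] [StarRing G] [StarModule ℂ G]
  {𝓡 : RibbonStructure G} {F : (G ⊗[ℂ] (G ⊗[ℂ] Center G))ˣ}
  {σ : Center G →ₐ[ℂ] G ⊗[ℂ] Center G} {I : Type*} [Fintype I] {χ : I → G →ₐ[ℂ] ℂ}

lemma norm_eq_one_of_star_mul_self {z : ℂ} (h : star z * z = 1) : ‖z‖ = 1 := by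
  have := congrArg norm h
  rw [norm_mul, norm_star, norm_one] at this
  nlinarith [norm_nonneg z]

namespace IsCharacterSystem

lemma nonempty (hχ : IsCharacterSystem χ) : Nonempty I :=
  ⟨(hχ.exists_eq (Bialgebra.counitAlgHom ℂ G)).choose⟩

lemma norm_κ (hχ : IsCharacterSystem χ) (𝓡 : RibbonStructure G) (a : I) :
    ‖χ a (𝓡.κ : G)‖ = 1 := by
  have h1 : ‖χ a (𝓡.v : G)‖ = 1 := by
    apply norm_eq_one_of_star_mul_self
    rw [← hχ.apply_star, 𝓡.star_v, ← map_mul, Units.inv_mul, map_one]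
  rw [← 𝓡.κ_sq, map_pow, norm_pow] at h1
  exact (pow_eq_one_iff_of_nonneg (norm_nonneg _) two_ne_zero).1 h1

/-- Write R_ab for the value at (χ a, χ b). The star condition gives |R_ab||R_ba| = 1, and (Δ ⊗
id)(R) = R₁₃R₂₃ makes R_ab multiplicative in a. A maximal modulus M satisfies M² ≤ M, so all moduli
are at most 1 and hence equal to 1. -/
lemma norm_R (hχ : IsCharacterSystem χ) (𝓡 : RibbonStructure G) (a b : I) :
    ‖χ b (evalFirst (χ a) (𝓡.R : G ⊗[ℂ] G))‖ = 1 := by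
  have hinv : ∀ a b, ‖χ b (evalFirst (χ a) (𝓡.R : G ⊗[ℂ] G))‖ *
      ‖χ a (evalFirst (χ b) (𝓡.R : G ⊗[ℂ] G))‖ = 1 := by
    intro a b
    have h1 : star (χ b (evalFirst (χ a) (𝓡.R : G ⊗[ℂ] G))) *
        χ a (evalFirst (χ b) (𝓡.R : G ⊗[ℂ] G)) = 1 := by
      rw [← hχ.apply_star, ← evalFirst_star (hχ.apply_star a), 𝓡.star_R,
        apply_evalFirst_flip, ← map_mul, ← map_mul, Units.inv_mul, map_one, map_one]
    rw [← norm_star, ← norm_mul, h1, norm_one]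
  have := hχ.nonempty
  obtain ⟨⟨c, d⟩, hmax⟩ := Finite.exists_max
    fun p : I × I => ‖χ p.2 (evalFirst (χ p.1) (𝓡.R : G ⊗[ℂ] G))‖
  obtain ⟨e, he⟩ := hχ.exists_eq (charMul (χ c) (χ c))
  have hsq : χ d (evalFirst (χ e) (𝓡.R : G ⊗[ℂ] G)) =
      χ d (evalFirst (χ c) (𝓡.R : G ⊗[ℂ] G)) * χ d (evalFirst (χ c) (𝓡.R : G ⊗[ℂ] G)) := by
    rw [he, ← evalFirst_evalFirst_comulFirst, 𝓡.comul_id_R, map_mul, map_mul, evalFirst_leg1,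
      leg2_apply]
    simp
  have hle : ∀ a b, ‖χ b (evalFirst (χ a) (𝓡.R : G ⊗[ℂ] G))‖ ≤ 1 := by
    intro a b
    refine (hmax (a, b)).trans ?_
    have h1 := hmax (e, d)
    have h2 := hinv c d
    simp only [hsq, norm_mul] at h1
    have h3 : 0 < ‖χ d (evalFirst (χ c) (𝓡.R : G ⊗[ℂ] G))‖ := by
      refine lt_of_le_of_ne (norm_nonneg _) fun h => ?_
      rw [← h, zero_mul] at h2
      exact zero_ne_one h2
    exact le_of_mul_le_mul_left (by rwa [mul_one]) h3
  refine le_antisymm (hle a b) ?_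
  rw [← hinv a b]
  exact mul_le_of_le_one_right (norm_nonneg _) (hle b a)

lemma norm_S (hχ : IsCharacterSystem χ) (𝓡 : RibbonStructure G) (a b : I) :
    ‖χ b (evalFirst (χ a) (𝓡.S : G ⊗[ℂ] G))‖ = 1 := by
  have h1 : (𝓡.S : G ⊗[ℂ] G) * ((𝓡.κ : G) ⊗ₜ[ℂ] (𝓡.κ : G)) =
      (𝓡.R : G ⊗[ℂ] G) * comul (R := ℂ) (𝓡.κ : G) := by
    have h2 : 𝓡.S * 𝓡.κκ =
        𝓡.R * Units.map (Bialgebra.comulAlgHom ℂ G).toMonoidHom 𝓡.κ := by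
      rw [RibbonStructure.S, inv_mul_cancel_right]; rfl
    have h3 := congrArg Units.val h2
    have h4 : (𝓡.κκ : G ⊗[ℂ] G) = (𝓡.κ : G) ⊗ₜ[ℂ] (𝓡.κ : G) := by
      change ((𝓡.κ : G) ⊗ₜ[ℂ] (1 : G)) * ((1 : G) ⊗ₜ[ℂ] (𝓡.κ : G)) = _
      simp
    rw [Units.val_mul, h4] at h3
    exact h3
  have h2 := congrArg (fun y => ‖χ b (evalFirst (χ a) y)‖) h1
  obtain ⟨c, hc⟩ := hχ.exists_eq (charMul (χ a) (χ b))
  simpa [hχ.norm_R 𝓡, hχ.norm_κ 𝓡, ← charMul_apply, ← hc] using h2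

lemma star_mul_evalFirst_F (hχ : IsCharacterSystem χ) (hF : StructureRelations 𝓡 F σ) (a b : I) :
    star (evalFirst (χ b) (evalFirst (χ a) (F : G ⊗[ℂ] (G ⊗[ℂ] Center G)))) *
      evalFirst (χ b) (evalFirst (χ a) (F : G ⊗[ℂ] (G ⊗[ℂ] Center G))) =
      χ b (evalFirst (χ a) (𝓡.S : G ⊗[ℂ] G)) • 1 := by
  rw [← evalFirst_star (hχ.apply_star b), ← evalFirst_star (hχ.apply_star a), hF.star_F,
    map_mul, map_mul, mul_assoc, ← map_mul, ← map_mul, ← map_mul, Units.inv_mul, map_one, mul_one,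
    evalFirst_leg12, evalFirst_tmul]

/-- F* = S F⁻¹ makes this value the squared modulus of a value of F, hence nonnegative; it also has
modulus 1. -/
lemma apply_S (hχ : IsCharacterSystem χ) (hF : StructureRelations 𝓡 F σ) (a b : I) :
    χ b (evalFirst (χ a) (𝓡.S : G ⊗[ℂ] G)) = 1 := by
  have h := congrArg (fun y : Center G => χ a (y : G)) (hχ.star_mul_evalFirst_F hF a b)
  have hn := hχ.norm_S 𝓡 a b
  generalize evalFirst (χ b) (evalFirst (χ a) (F : G ⊗[ℂ] (G ⊗[ℂ] Center G))) = f at h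
  have h' : star (χ a (f : G)) * χ a (f : G) = χ b (evalFirst (χ a) (𝓡.S : G ⊗[ℂ] G)) := by
    rw [← hχ.apply_star, ← map_mul]
    refine h.trans ?_
    change χ a (_ • (1 : G)) = _
    simp
  rw [← h', Complex.star_def, Complex.conj_mul', ← Complex.ofReal_pow] at hn ⊢
  rw [Complex.norm_real, Real.norm_of_nonneg (by positivity)] at hn
  rw [hn, Complex.ofReal_one]

lemma S_eq_one [FiniteDimensional ℂ G] (hχ : IsCharacterSystem χ)
    (hF : StructureRelations 𝓡 F σ) : 𝓡.S = 1 := by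
  refine Units.ext (hχ.ext_evalFirst fun a => hχ.ext_apply fun b => ?_)
  rw [hχ.apply_S hF, Units.val_one, map_one, map_one]

lemma star_mul_evalFirst_F_eq_one (hχ : IsCharacterSystem χ) (hF : StructureRelations 𝓡 F σ)
    (a b : I) :
    star (evalFirst (χ b) (evalFirst (χ a) (F : G ⊗[ℂ] (G ⊗[ℂ] Center G)))) *
      evalFirst (χ b) (evalFirst (χ a) (F : G ⊗[ℂ] (G ⊗[ℂ] Center G))) = 1 := by
  rw [hχ.star_mul_evalFirst_F hF, hχ.apply_S hF, one_smul]

lemma apply_rightComponent (φ : G →ₐ[ℂ] ℂ) (π : Module.Dual ℂ G) (y : G ⊗[ℂ] G) :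
    φ (rightComponent π y) = π (evalFirst φ y) := by
  induction y using TensorProduct.induction_on with
  | zero => simp
  | tmul a b => simp [mul_comm]
  | add a b ha hb => simp only [map_add, ha, hb]

/-- The Gauss sum of the ribbon element does not vanish. -/
lemma sum_apply_inv_v_ne_zero (hχ : IsCharacterSystem χ)
    (hN : ∀ g : G, ∃ π : Module.Dual ℂ G, rightComponent π (𝓡.N : G ⊗[ℂ] G) = g)
    (hinj : ∀ b, Function.Injective fun a => charMul (χ a) (χ b)) :
    ∑ a, χ a ((𝓡.v⁻¹ : Gˣ) : G) ≠ 0 := by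
  intro h0
  -- Multiplication by a fixed character permutes the characters, so ∑ χ a is an invariant form.
  have hT : ∀ x : G, ∑ a, evalFirst (χ a) (comul (R := ℂ) x) = (∑ a, χ a x) • 1 := by
    intro x
    refine hχ.ext_apply fun b => ?_
    choose m hm using fun a => hχ.exists_eq (charMul (χ a) (χ b))
    have hm' : Function.Injective m := fun a a' h => hinj b (by
      simp only [← hm, h])
    rw [map_sum, map_smul, map_one, smul_eq_mul, mul_one,
      ← (Finite.injective_iff_bijective.1 hm').sum_comp (fun a => χ a x)]
    exact Finset.sum_congr rfl fun a _ => by rw [hm, charMul_apply]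
  have hNeq : (𝓡.N : G ⊗[ℂ] G) = ((𝓡.v : G) ⊗ₜ[ℂ] (𝓡.v : G)) *
      comul (R := ℂ) ((𝓡.v⁻¹ : Gˣ) : G) := by
    rw [← 𝓡.ribbon, 𝓡.N_eq]
    have hc : ∀ y z : G ⊗[ℂ] G, y * z = z * y := by
      intro y z
      induction y using TensorProduct.induction_on with
      | zero => simp
      | tmul a b =>
        induction z using TensorProduct.induction_on with
        | zero => simp
        | tmul c d => simp [hχ.mul_commute]
        | add c d hc hd => rw [mul_add, add_mul, hc, hd]
      | add c d hc hd => rw [mul_add, add_mul, hc, hd]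
    exact hc _ _
  -- From N = (v ⊗ v)Δ(v⁻¹) this sum is the Gauss sum times v, which is assumed to vanish.
  have hsum : ∑ a, χ a ((𝓡.v⁻¹ : Gˣ) : G) • evalFirst (χ a) (𝓡.N : G ⊗[ℂ] G) = 0 := by
    have h1 : ∀ a, χ a ((𝓡.v⁻¹ : Gˣ) : G) • evalFirst (χ a) (𝓡.N : G ⊗[ℂ] G) =
        (𝓡.v : G) * evalFirst (χ a) (comul (R := ℂ) ((𝓡.v⁻¹ : Gˣ) : G)) := by
      intro a
      rw [hNeq, map_mul, evalFirst_tmul, smul_mul_assoc, smul_smul, ← map_mul, Units.inv_mul,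
        map_one, one_smul]
    rw [Finset.sum_congr rfl fun a _ => h1 a, ← Finset.mul_sum, hT, h0, zero_smul, mul_zero]
  -- Testing against π with (id ⊗ π)(N) = v turns the sum into ∑ χ a (v⁻¹v), the number of
  -- characters.
  obtain ⟨π, hπ⟩ := hN (𝓡.v : G)
  have h2 := congrArg π hsum
  simp only [map_sum, map_smul, ← apply_rightComponent, hπ, smul_eq_mul, ← map_mul,
    Units.inv_mul, map_one, map_zero] at h2
  have := hχ.nonempty
  simp at h2

end IsCharacterSystem

/-- RΔ(κ) = Δ'(κ)R gives S⁻¹ = (κ ⊗ κ)R⁻¹Δ'(κ⁻¹), and covariance turns Δ'(κ⁻¹)Φ⁻¹ into Φ⁻¹κ⁻¹. So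
the two star conditions on a vertex operator agree. -/
lemma mapSnd_inv_S_mul_inv {B : Type*} [Ring B] [Algebra ℂ B] (𝓡 : RibbonStructure G)
    (ι : G →ₐ[ℂ] B) (Φ : (G ⊗[ℂ] B)ˣ)
    (hcov : ∀ ξ : G, ((1 : G) ⊗ₜ[ℂ] ι ξ) * (Φ : G ⊗[ℂ] B) =
      Φ * mapSnd ι (flip (comul (R := ℂ) ξ))) :
    mapSnd ι ((𝓡.S⁻¹ : (G ⊗[ℂ] G)ˣ) : G ⊗[ℂ] G) * ((Φ⁻¹ : (G ⊗[ℂ] B)ˣ) : G ⊗[ℂ] B) =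
      ((𝓡.κ : G) ⊗ₜ[ℂ] (1 : B)) * ((1 : G) ⊗ₜ[ℂ] ι (𝓡.κ : G)) *
      mapSnd ι ((𝓡.Rplus⁻¹ : (G ⊗[ℂ] G)ˣ) : G ⊗[ℂ] G) *
      ((Φ⁻¹ : (G ⊗[ℂ] B)ˣ) : G ⊗[ℂ] B) * ((1 : G) ⊗ₜ[ℂ] ι ((𝓡.κ⁻¹ : Gˣ) : G)) := by
  let m := Units.map (mapSnd (G := G) ι).toMonoidHom
  let c : Gˣ →* (G ⊗[ℂ] B)ˣ :=
    Units.map ((Algebra.TensorProduct.includeRight : B →ₐ[ℂ] G ⊗[ℂ] B).comp ι).toMonoidHom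
  let d := Units.map (Bialgebra.comulAlgHom ℂ G).toMonoidHom
  let d' := Units.map (flip.comp (Bialgebra.comulAlgHom ℂ G)).toMonoidHom
  have h1 : c 𝓡.κ⁻¹ * Φ = Φ * m (d' 𝓡.κ⁻¹) := Units.ext (hcov _)
  have h2 : 𝓡.R * d 𝓡.κ = d' 𝓡.κ * 𝓡.R := Units.ext (𝓡.R_comul _)
  have h3 : 𝓡.S⁻¹ = 𝓡.κκ * 𝓡.R⁻¹ * d' 𝓡.κ⁻¹ := by
    have : 𝓡.S = 𝓡.R * d 𝓡.κ * 𝓡.κκ⁻¹ := rfl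
    rw [this, h2, map_inv]
    group
  have h4 : m 𝓡.S⁻¹ * Φ⁻¹ = m 𝓡.κκ * m 𝓡.R⁻¹ * Φ⁻¹ * c 𝓡.κ⁻¹ := by
    have h5 : Φ⁻¹ * c 𝓡.κ⁻¹ = m (d' 𝓡.κ⁻¹) * Φ⁻¹ := by
      rw [eq_mul_inv_iff_mul_eq, mul_assoc, h1, inv_mul_cancel_left]
    rw [h3, map_mul, map_mul, mul_assoc _ Φ⁻¹, h5, mul_assoc (_ * _)]
  have h6 := congrArg Units.val h4
  have h7 : (m 𝓡.κκ : G ⊗[ℂ] B) = ((𝓡.κ : G) ⊗ₜ[ℂ] (1 : B)) * ((1 : G) ⊗ₜ[ℂ] ι (𝓡.κ : G)) := by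
    change mapSnd ι (((𝓡.κ : G) ⊗ₜ[ℂ] (1 : G)) * ((1 : G) ⊗ₜ[ℂ] (𝓡.κ : G))) = _
    rw [map_mul, mapSnd_tmul, mapSnd_tmul, map_one]
  rw [Units.val_mul, Units.val_mul, Units.val_mul, Units.val_mul, h7] at h6
  exact h6

end CommutativeRibbon

/-! ### Realization on a Hilbert space -/

section Eigenbasis

variable {G : Type*} [Ring G] [HopfAlgebra ℂ G] [StarRing G] [StarModule ℂ G]
  {I : Type*} [Fintype I] {χ : I → G →ₐ[ℂ] ℂ}

lemma evalFirst_covariant {B : Type*} [Ring B] [Algebra ℂ B] {ι : G →ₐ[ℂ] B}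
    {Φ : G ⊗[ℂ] B}
    (hcov : ∀ ξ : G, ((1 : G) ⊗ₜ[ℂ] ι ξ) * Φ = Φ * mapSnd ι (flip (comul (R := ℂ) ξ)))
    (φ : G →ₐ[ℂ] ℂ) (ξ : G) :
    ι ξ * evalFirst φ Φ = evalFirst φ Φ * ι (evalFirst φ (flip (comul (R := ℂ) ξ))) := by
  have h := congrArg (evalFirst φ) (hcov ξ)
  rwa [map_mul, map_mul, evalFirst_tmul, map_one, one_smul, evalFirst_mapSnd] at h

lemma counit_evalFirst_flip_comul (φ : G →ₐ[ℂ] ℂ) (ξ : G) :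
    counit (R := ℂ) (evalFirst φ (flip (comul (R := ℂ) ξ))) = φ ξ :=
  (apply_evalFirst_flip φ (Bialgebra.counitAlgHom ℂ G) _).trans
    (congrArg φ (counitFirst_comul ξ))

/-- A covariant invertible element produces an eigenbasis from a vacuum vector. -/
lemma exists_eigenbasis [FiniteDimensional ℂ G] {W : Type*} [AddCommGroup W] [Module ℂ W]
    [FiniteDimensional ℂ W] [Nontrivial W] (hχ : IsCharacterSystem χ)
    (hW : Module.finrank ℂ W = Module.finrank ℂ G) {Λ : G} (hΛ : IsIntegral Λ)
    (ι : G →ₐ[ℂ] Module.End ℂ W) (Φ : (G ⊗[ℂ] Module.End ℂ W)ˣ)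
    (hcov : ∀ ξ : G, ((1 : G) ⊗ₜ[ℂ] ι ξ) * (Φ : G ⊗[ℂ] Module.End ℂ W) =
      (Φ : G ⊗[ℂ] Module.End ℂ W) * mapSnd ι (flip (comul (R := ℂ) ξ))) :
    ∃ (u : Module.Basis I ℂ W) (w₀ : W), (∀ g, ι g w₀ = counit (R := ℂ) g • w₀) ∧
      (∀ a, evalFirst (χ a) (Φ : G ⊗[ℂ] Module.End ℂ W) w₀ = u a) ∧
      ∀ a g, ι g (u a) = χ a g • u a := by
  classical
  -- Any nonzero vector in the range of ι(Λ) is a vacuum, since gΛ = ε(g)Λ; covariance then makes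
  -- its image under the χ-component of Φ a χ-eigenvector.
  obtain ⟨w, hw⟩ : ∃ w, ι Λ w ≠ 0 := by
    by_contra hcon
    push Not at hcon
    exact map_integral_ne_zero hΛ ι Φ hcov (LinearMap.ext hcon)
  have hw₀ : ∀ g, ι g (ι Λ w) = counit (R := ℂ) g • ι Λ w := by
    intro g
    rw [← Module.End.mul_apply, ← map_mul, hΛ.left, map_smul, LinearMap.smul_apply]
  let u : I → W := fun a => evalFirst (χ a) (Φ : G ⊗[ℂ] Module.End ℂ W) (ι Λ w)
  have hu : ∀ a g, ι g (u a) = χ a g • u a := by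
    intro a g
    change (ι g * evalFirst (χ a) (Φ : G ⊗[ℂ] Module.End ℂ W)) (ι Λ w) = _
    rw [evalFirst_covariant hcov, Module.End.mul_apply, hw₀, map_smul,
      counit_evalFirst_flip_comul]
  have hu0 : ∀ a, u a ≠ 0 := by
    intro a h0
    apply hw
    have h1 : evalFirst (χ a) ((Φ⁻¹ : (G ⊗[ℂ] Module.End ℂ W)ˣ) : G ⊗[ℂ] Module.End ℂ W) *
        evalFirst (χ a) (Φ : G ⊗[ℂ] Module.End ℂ W) = 1 := by
      rw [← map_mul, Units.inv_mul, map_one]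
    have h2 := congrArg (fun T : Module.End ℂ W => T (ι Λ w)) h1
    simp only [Module.End.mul_apply, Module.End.one_apply] at h2
    have h3 : evalFirst (χ a) (Φ : G ⊗[ℂ] Module.End ℂ W) (ι Λ w) = 0 := h0
    rw [← h2, h3, map_zero]
  have hli : LinearIndependent ℂ u := by
    rw [Fintype.linearIndependent_iff]
    intro c hc k
    obtain ⟨e, he⟩ := hχ.exists_apply_eq fun i => if i = k then 1 else 0
    have h1 := congrArg (ι e) hc
    simp only [map_sum, map_smul, hu, he, map_zero, ite_smul, one_smul, zero_smul, smul_ite,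
      smul_zero, Finset.sum_ite_eq', Finset.mem_univ, if_true] at h1
    exact (smul_eq_zero.1 h1).resolve_right (hu0 k)
  have := hχ.nonempty
  refine ⟨basisOfLinearIndependentOfCardEqFinrank hli (by rw [hχ.card_eq, hW]), ι Λ w, hw₀,
    fun a => by simp [u], fun a g => by simp [hu]⟩

end Eigenbasis

section Hilbert

variable {G : Type*} [Ring G] [HopfAlgebra ℂ G] [StarRing G] [StarModule ℂ G]
  {𝓡 : RibbonStructure G} {F : (G ⊗[ℂ] (G ⊗[ℂ] Center G))ˣ}
  {σ : Center G →ₐ[ℂ] G ⊗[ℂ] Center G} {I : Type*} [Fintype I] {χ : I → G →ₐ[ℂ] ℂ}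
  {H : Type*} [NormedAddCommGroup H] [InnerProductSpace ℂ H] [CompleteSpace H]

open scoped InnerProductSpace

lemma clm_ext_orthonormalBasis (b : OrthonormalBasis I ℂ H) {S T : H →L[ℂ] H}
    (h : ∀ a c, ⟪b c, S (b a)⟫_ℂ = ⟪b c, T (b a)⟫_ℂ) : S = T := by
  apply ContinuousLinearMap.coe_injective
  refine b.toBasis.ext fun a => ?_
  refine InnerProductSpace.ext_inner_left_basis b.toBasis fun c => ?_
  simpa using h a c

/-- Solutions of the relations on a Hilbert space whose vertex operator creates an orthonormal
eigenbasis out of a vacuum vector. -/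
structure IsVacuumSolution (𝓡 : RibbonStructure G) (F : (G ⊗[ℂ] (G ⊗[ℂ] Center G))ˣ)
    (σ : Center G →ₐ[ℂ] G ⊗[ℂ] Center G) (χ : I → G →ₐ[ℂ] ℂ) (b : OrthonormalBasis I ℂ H)
    (ι : G →ₐ[ℂ] H →L[ℂ] H) (j : Center G →ₐ[ℂ] H →L[ℂ] H) (Φ : (G ⊗[ℂ] (H →L[ℂ] H))ˣ)
    (w₀ : H) : Prop where
  relations : StructureRelations 𝓡 F σ
  characters : IsCharacterSystem χ
  solves : SolvesRelations F σ j Φ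
  injective : Function.Injective j
  monodromy : (Φ : G ⊗[ℂ] (H →L[ℂ] H)) * mapSnd ι (𝓡.N : G ⊗[ℂ] G) =
    mapSnd j (structD 𝓡 σ : G ⊗[ℂ] Center G) * Φ
  covariance : ∀ ξ : G, ((1 : G) ⊗ₜ[ℂ] ι ξ) * (Φ : G ⊗[ℂ] (H →L[ℂ] H)) =
    Φ * mapSnd ι (flip (comul (R := ℂ) ξ))
  commute : ∀ (f : Center G) (ξ : G), ι ξ * j f = j f * ι ξ
  apply_basis : ∀ a g, ι g (b a) = χ a g • b a
  apply_vacuum : ∀ g, ι g w₀ = counit (R := ℂ) g • w₀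
  create : ∀ a, evalFirst (χ a) (Φ : G ⊗[ℂ] (H →L[ℂ] H)) w₀ = b a

namespace IsVacuumSolution

variable {b : OrthonormalBasis I ℂ H} {ι : G →ₐ[ℂ] H →L[ℂ] H} {j : Center G →ₐ[ℂ] H →L[ℂ] H}
  {Φ : (G ⊗[ℂ] (H →L[ℂ] H))ˣ} {w₀ : H}

lemma action_injective (h : IsVacuumSolution 𝓡 F σ χ b ι j Φ w₀) : Function.Injective ι := by
  intro x y hxy
  refine h.characters.ext_apply fun a => smul_left_injective ℂ (b.toBasis.ne_zero a) ?_
  simp only [OrthonormalBasis.coe_toBasis, ← h.apply_basis, hxy]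

lemma star_action (h : IsVacuumSolution 𝓡 F σ χ b ι j Φ w₀) (g : G) : star (ι g) = ι (star g) := by
  classical
  refine clm_ext_orthonormalBasis b fun a c => ?_
  rw [ContinuousLinearMap.star_eq_adjoint, ContinuousLinearMap.adjoint_inner_right,
    h.apply_basis, h.apply_basis, inner_smul_left, inner_smul_right, h.characters.apply_star,
    b.inner_eq_ite]
  split_ifs with hac
  · rw [hac]; rfl
  · simp

variable [FiniteDimensional ℂ G]

/-- Each character occurs exactly once in the eigenbasis, so an operator commuting with G is
diagonal, and diagonals come from G. -/
lemma exists_eq_action (h : IsVacuumSolution 𝓡 F σ χ b ι j Φ w₀) {T : H →L[ℂ] H}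
    (hT : ∀ g, ι g * T = T * ι g) : ∃ g, ι g = T := by
  classical
  obtain ⟨g, hg⟩ := h.characters.exists_apply_eq fun k => b.repr (T (b k)) k
  refine ⟨g, ContinuousLinearMap.coe_injective (b.toBasis.ext fun k => ?_)⟩
  obtain ⟨e, he⟩ := h.characters.exists_apply_eq fun i => if i = k then 1 else 0
  have h1 : T (b k) = ι e (T (b k)) := by
    have := congrArg (fun S : H →L[ℂ] H => S (b k)) (hT e)
    simp only [mul_apply_eq_comp] at this
    rw [this, h.apply_basis, he, if_pos rfl, one_smul]
  have h2 : ∀ x, ι e x = b.repr x k • b k := by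
    intro x
    conv_lhs => rw [← b.sum_repr x]
    simp [h.apply_basis, he]
  simp only [OrthonormalBasis.coe_toBasis, ContinuousLinearMap.coe_coe]
  rw [h.apply_basis, hg, ← h2, ← h1]

/-- The embedding of `𝒞` factors through `G`. -/
lemma exists_factor (h : IsVacuumSolution 𝓡 F σ χ b ι j Φ w₀) :
    ∃ θ : G →ₐ[ℂ] G, Function.Bijective θ ∧ ∀ f : Center G, j f = ι (θ f) := by
  let θ₀ : Center G →ₐ[ℂ] G := (AlgEquiv.ofInjective ι h.action_injective).symm.toAlgHom.comp
    (j.codRestrict ι.range fun f => h.exists_eq_action fun g => h.commute f g)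
  have hθ₀ : ∀ f, ι (θ₀ f) = j f := fun f =>
    congrArg Subtype.val ((AlgEquiv.ofInjective ι h.action_injective).apply_symm_apply _)
  let c : G →ₐ[ℂ] Center G := (AlgHom.id ℂ G).codRestrict (Center G).toSubalgebra fun g =>
    Subalgebra.mem_center_iff.2 fun x => h.characters.mul_commute x g
  have hc : ∀ f : Center G, c f = f := fun f => rfl
  have hinj : Function.Injective (θ₀.comp c) := by
    intro x y hxy
    have h1 : j (c x) = j (c y) := by rw [← hθ₀, ← hθ₀]; exact congrArg ι hxy
    exact congrArg Subtype.val (h.injective h1)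
  refine ⟨θ₀.comp c, ⟨hinj,
    LinearMap.injective_iff_surjective (f := (θ₀.comp c).toLinearMap).1 hinj⟩,
    fun f => ?_⟩
  rw [AlgHom.comp_apply, hc, hθ₀]

/-- The composite of a character with θ is again a character, and all characters respect the star.
-/
lemma star_embedding (h : IsVacuumSolution 𝓡 F σ χ b ι j Φ w₀) (f : Center G) :
    star (j f) = j (star f) := by
  obtain ⟨θ, -, hj⟩ := h.exists_factor
  rw [hj, hj, h.star_action]
  congr 1
  refine h.characters.ext_apply fun a => ?_
  obtain ⟨k, hk⟩ := h.characters.exists_eq ((χ a).comp θ)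
  have hk' : ∀ g, χ a (θ g) = χ k g := fun g => by rw [hk]; rfl
  rw [h.characters.apply_star, hk', hk']
  exact (h.characters.apply_star k f).symm

lemma range_embedding (h : IsVacuumSolution 𝓡 F σ χ b ι j Φ w₀) :
    Set.range j = ι '' (Center G : Set G) := by
  obtain ⟨θ, hθ, hj⟩ := h.exists_factor
  have hmem : ∀ g : G, g ∈ Center G := fun g =>
    Subalgebra.mem_center_iff.2 fun x => h.characters.mul_commute x g
  ext T
  constructor
  · rintro ⟨f, rfl⟩
    exact ⟨θ f, hmem _, (hj f).symm⟩
  · rintro ⟨g, -, rfl⟩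
    obtain ⟨x, rfl⟩ := hθ.2 g
    exact ⟨⟨x, hmem x⟩, hj _⟩

/-- The components of `Φ` permute the eigenbasis up to phases. -/
lemma exists_phase (h : IsVacuumSolution 𝓡 F σ χ b ι j Φ w₀) (a c : I) :
    ∃ (d : I) (z : ℂ), star z * z = 1 ∧ χ d = charMul (χ a) (χ c) ∧
      evalFirst (χ c) (Φ : G ⊗[ℂ] (H →L[ℂ] H)) (b a) = z • b d := by
  obtain ⟨d, hd⟩ := h.characters.exists_eq (charMul (χ a) (χ c))
  obtain ⟨θ, -, hj⟩ := h.exists_factor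
  have h1 := congrArg (fun y => evalFirst (χ c) (evalFirst (χ a) y)) h.solves.operatorProduct
  simp only [map_mul, evalFirst_leg1, leg2_apply, evalFirst_tmul, map_one, one_smul,
    evalFirst_mapSnd, evalFirst_evalFirst_comulFirst, ← hd] at h1
  have h2 := h.characters.star_mul_evalFirst_F_eq_one h.relations a c
  generalize evalFirst (χ c) (evalFirst (χ a) (F : G ⊗[ℂ] (G ⊗[ℂ] Center G))) = f at h1 h2
  -- On the vacuum the operator product reads Φ_c b_a = j(f) b_d, where f is the value of F at the
  -- two characters; f*f = 1 because S = 1.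
  refine ⟨d, χ d (θ f), ?_, hd, ?_⟩
  · obtain ⟨k, hk⟩ := h.characters.exists_eq ((χ d).comp θ)
    have hk' : ∀ g, χ d (θ g) = χ k g := fun g => by rw [hk]; rfl
    have h3 := congrArg (fun y : Center G => χ k (y : G)) h2
    simp only [hk', ← h.characters.apply_star, ← map_mul]
    exact h3.trans (map_one _)
  · have h3 := congrArg (fun T : H →L[ℂ] H => T w₀) h1
    simp only [mul_apply_eq_comp, h.create] at h3
    rw [h3, hj, h.apply_basis]

/-- If χ a and χ a' had the same product with χ c, the invertible operator Φ_c would send two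
independent basis vectors to multiples of one. -/
lemma charMul_injective (h : IsVacuumSolution 𝓡 F σ χ b ι j Φ w₀) (c : I) :
    Function.Injective fun a => charMul (χ a) (χ c) := by
  intro a a' haa
  obtain ⟨d, z, hz, hd, hΦ⟩ := h.exists_phase a c
  obtain ⟨d', z', hz', hd', hΦ'⟩ := h.exists_phase a' c
  have hdd : d = d' := h.characters.bijective.1 (by rw [hd, hd']; exact haa)
  subst hdd
  have h0 : evalFirst (χ c) ((Φ⁻¹ : (G ⊗[ℂ] (H →L[ℂ] H))ˣ) : G ⊗[ℂ] (H →L[ℂ] H)) *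
      evalFirst (χ c) (Φ : G ⊗[ℂ] (H →L[ℂ] H)) = 1 := by
    rw [← map_mul, Units.inv_mul, map_one]
  have hinj : Function.Injective
      ((evalFirst (χ c) (Φ : G ⊗[ℂ] (H →L[ℂ] H)) : H →L[ℂ] H) : H → H) := by
    intro x y hxy
    have := congrArg (evalFirst (χ c) ((Φ⁻¹ : (G ⊗[ℂ] (H →L[ℂ] H))ˣ) :
      G ⊗[ℂ] (H →L[ℂ] H)) : H →L[ℂ] H) hxy
    rwa [← mul_apply_eq_comp, ← mul_apply_eq_comp, h0,
      one_apply_eq_self, one_apply_eq_self] at this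
  have h1 : z' • b a = z • b a' := hinj (by
    rw [map_smul, map_smul, hΦ, hΦ', smul_smul, smul_smul, mul_comm])
  by_contra hne
  have h2 := congrArg (fun x => ⟪b a, x⟫_ℂ) h1
  classical
  simp only [inner_smul_right, b.inner_eq_ite, if_neg hne, if_true, mul_zero, mul_one] at h2
  rw [h2, mul_zero] at hz'
  exact zero_ne_one hz'

lemma star_eq_inv (h : IsVacuumSolution 𝓡 F σ χ b ι j Φ w₀) :
    star (Φ : G ⊗[ℂ] (H →L[ℂ] H)) = ((Φ⁻¹ : (G ⊗[ℂ] (H →L[ℂ] H))ˣ) : G ⊗[ℂ] (H →L[ℂ] H)) := by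
  classical
  suffices hs : star (Φ : G ⊗[ℂ] (H →L[ℂ] H)) * (Φ : G ⊗[ℂ] (H →L[ℂ] H)) = 1 from
    Units.eq_inv_of_mul_eq_one_right hs
  refine h.characters.ext_evalFirst fun c => ?_
  rw [map_mul, map_one, evalFirst_star (h.characters.apply_star c)]
  refine clm_ext_orthonormalBasis b fun a a' => ?_
  rw [mul_apply_eq_comp, ContinuousLinearMap.star_eq_adjoint,
    ContinuousLinearMap.adjoint_inner_right, one_apply_eq_self]
  obtain ⟨d, z, hz, hd, hΦ⟩ := h.exists_phase a c
  obtain ⟨d', z', hz', hd', hΦ'⟩ := h.exists_phase a' c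
  rw [hΦ, hΦ', inner_smul_left, inner_smul_right, b.inner_eq_ite, b.inner_eq_ite]
  by_cases haa : a' = a
  · subst haa
    have hdd : d' = d := h.characters.bijective.1 (by rw [hd, hd'])
    subst hdd
    have hzz : z' = z := smul_left_injective ℂ (b.toBasis.ne_zero d') (by
      simp only [OrthonormalBasis.coe_toBasis, ← hΦ, ← hΦ'])
    subst hzz
    simpa using hz
  · have hdd : d' ≠ d := fun hdd => haa (h.charMul_injective c (by
      simp only [← hd, ← hd', hdd]))
    simp [haa, hdd]

/-- The embedding of `𝒞` maps the ribbon element to the ribbon element. -/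
lemma embedding_vC (h : IsVacuumSolution 𝓡 F σ χ b ι j Φ w₀)
    (hN : ∀ g : G, ∃ π : Module.Dual ℂ G, rightComponent π (𝓡.N : G ⊗[ℂ] G) = g) :
    j (𝓡.vC : Center G) = ι (𝓡.v : G) := by
  obtain ⟨θ, hθ, hj⟩ := h.exists_factor
  -- Evaluate ΦN = DΦ at χ a on the vacuum. It reads v⁻¹Φv = j(v)⁻¹Φj(v) once the factor χ a (v) is
  -- cancelled, and v fixes the vacuum as ε(v) = 1.
  have hχv : ∀ a, χ a ((𝓡.v⁻¹ : Gˣ) : G) =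
      counit (R := ℂ) (θ (𝓡.v : G)) * χ a (θ ((𝓡.v⁻¹ : Gˣ) : G)) := by
    intro a
    set U := evalFirst (χ a) (Φ : G ⊗[ℂ] (H →L[ℂ] H)) with hU
    have hN' : evalFirst (χ a) (𝓡.N : G ⊗[ℂ] G) = χ a (𝓡.v : G) •
        (evalFirst (χ a) (flip (comul (R := ℂ) ((𝓡.v⁻¹ : Gˣ) : G))) * (𝓡.v : G)) := by
      have h1 := congrArg flip 𝓡.ribbon
      rw [map_mul, flip_flip, ← 𝓡.N_eq, map_mul, flip_tmul] at h1
      rw [h1, map_mul, evalFirst_tmul, smul_mul_assoc, h.characters.mul_commute]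
    have hcov := evalFirst_covariant h.covariance (χ a) ((𝓡.v⁻¹ : Gˣ) : G)
    have hex := congrArg (evalFirst (χ a)) (h.solves.exchange (𝓡.vC : Center G))
    rw [map_mul, map_mul, evalFirst_tmul, map_one, one_smul, evalFirst_mapSnd, ← hU] at hex
    have hD : evalFirst (χ a) (structD 𝓡 σ : G ⊗[ℂ] Center G) = χ a (𝓡.v : G) •
        (((𝓡.vC⁻¹ : (Center G)ˣ) : Center G) * evalFirst (χ a) (σ (𝓡.vC : Center G))) := by
      rw [structD_val, map_mul, map_mul, evalFirst_tmul, evalFirst_tmul, map_one, one_smul,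
        smul_mul_assoc, one_mul, smul_mul_assoc]
    have hm := congrArg (evalFirst (χ a)) h.monodromy
    rw [map_mul, map_mul, evalFirst_mapSnd, evalFirst_mapSnd, hN', hD, map_smul, map_smul,
      ← hU, smul_mul_assoc, mul_smul_comm, map_mul ι, map_mul j, mul_assoc, ← hex, ← mul_assoc U,
      hU, ← hcov, hj, hj] at hm
    have hv : χ a (𝓡.v : G) ≠ 0 := ((𝓡.v.isUnit.map (χ a))).ne_zero
    have hm' := congrArg (fun T : H →L[ℂ] H => T w₀) (smul_right_injective _ hv hm)
    simp only [mul_apply_eq_comp, h.apply_vacuum, map_smul, h.create, h.apply_basis] at hm'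
    rw [𝓡.counit_v, one_smul, smul_smul] at hm'
    have hb : b a ≠ 0 := by simpa using b.toBasis.ne_zero a
    exact smul_left_injective ℂ hb hm'
  -- θ permutes the characters, so both sides of `hχv` sum to the same Gauss sum. As that is
  -- nonzero, the factor ε(θ(v)) is 1.
  have hsum : ∑ a, χ a (θ ((𝓡.v⁻¹ : Gˣ) : G)) = ∑ a, χ a ((𝓡.v⁻¹ : Gˣ) : G) := by
    choose p hp using fun a => h.characters.exists_eq ((χ a).comp θ)
    have hpinj : Function.Injective p := by
      intro a a' haa
      refine h.characters.bijective.1 (AlgHom.ext fun g => ?_)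
      obtain ⟨x, rfl⟩ := hθ.2 g
      have h1 : (χ a).comp θ = (χ a').comp θ := by rw [← hp, ← hp, haa]
      exact DFunLike.congr_fun h1 x
    rw [← (Finite.injective_iff_bijective.1 hpinj).sum_comp (fun a => χ a ((𝓡.v⁻¹ : Gˣ) : G))]
    exact Finset.sum_congr rfl fun a _ => by rw [hp]; rfl
  have hone : counit (R := ℂ) (θ (𝓡.v : G)) = 1 := by
    have h1 : ∑ a, χ a ((𝓡.v⁻¹ : Gˣ) : G) =
        counit (R := ℂ) (θ (𝓡.v : G)) * ∑ a, χ a ((𝓡.v⁻¹ : Gˣ) : G) := by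
      conv_lhs => rw [Finset.sum_congr rfl fun a _ => hχv a, ← Finset.mul_sum, hsum]
    exact (mul_eq_right₀ (h.characters.sum_apply_inv_v_ne_zero hN h.charMul_injective)).1 h1.symm
  have hinv : θ ((𝓡.v⁻¹ : Gˣ) : G) = ((𝓡.v⁻¹ : Gˣ) : G) :=
    h.characters.ext_apply fun a => by rw [hχv a, hone, one_mul]
  rw [hj]
  congr 1
  change θ (𝓡.v : G) = (𝓡.v : G)
  have h2 : θ (𝓡.v : G) * ((𝓡.v⁻¹ : Gˣ) : G) = 1 := by
    rw [← hinv, ← map_mul, Units.mul_inv, map_one]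
  rw [Units.mul_inv_eq_one] at h2
  exact h2

end IsVacuumSolution

end Hilbert

/-! ### Transport along algebra maps and injectivity of j. -/

section Transport

variable {G : Type*} [Ring G] [HopfAlgebra ℂ G] [StarRing G] [StarModule ℂ G]
  {F : (G ⊗[ℂ] (G ⊗[ℂ] Center G))ˣ} {σ : Center G →ₐ[ℂ] G ⊗[ℂ] Center G}
  {B : Type*} [Ring B] [Algebra ℂ B] {j : Center G →ₐ[ℂ] B} {Φ : (G ⊗[ℂ] B)ˣ}

lemma generators_map {B' : Type*} [Ring B'] [Algebra ℂ B'] (f : B →ₐ[ℂ] B') :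
    generators (f.comp j) (Units.map (mapSnd (G := G) f).toMonoidHom Φ) =
      f '' generators j Φ := by
  have h : ∀ π : Module.Dual ℂ G, component π (mapSnd f (Φ : G ⊗[ℂ] B)) =
      f (component π (Φ : G ⊗[ℂ] B)) := fun π => by
    rw [component_mapSnd]
  ext x
  constructor
  · rintro (⟨c, rfl⟩ | ⟨π, rfl⟩)
    · exact ⟨j c, Or.inl ⟨c, rfl⟩, rfl⟩
    · exact ⟨component π (Φ : G ⊗[ℂ] B), Or.inr ⟨π, rfl⟩, (h π).symm⟩
  · rintro ⟨_, ⟨c, rfl⟩ | ⟨π, rfl⟩, rfl⟩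
    · exact Or.inl ⟨c, rfl⟩
    · exact Or.inr ⟨π, h π⟩

lemma adjoin_generators_map_eq_top {B' : Type*} [Ring B'] [Algebra ℂ B'] (f : B →ₐ[ℂ] B')
    (hf : Function.Surjective f) (h : Algebra.adjoin ℂ (generators j Φ) = ⊤) :
    Algebra.adjoin ℂ (generators (f.comp j) (Units.map (mapSnd (G := G) f).toMonoidHom Φ)) = ⊤ := by
  rw [generators_map, ← AlgHom.map_adjoin, h, Algebra.map_top, AlgHom.range_eq_top]
  exact hf

/-- In a generating solution of maximal dimension the center is embedded. -/
lemma SolvesRelations.injective [FiniteDimensional ℂ G] [FiniteDimensional ℂ B]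
    (h : SolvesRelations F σ j Φ) (hgen : Algebra.adjoin ℂ (generators j Φ) = ⊤)
    (hdim : Module.finrank ℂ (Center G) * Module.finrank ℂ G ≤ Module.finrank ℂ B) :
    Function.Injective j := by
  have hfd : FiniteDimensional ℂ (Center G) :=
    FiniteDimensional.finiteDimensional_submodule (Subalgebra.toSubmodule (Center G).toSubalgebra)
  have hsurj : Function.Surjective (normalForm j Φ) := by
    rw [← LinearMap.range_eq_top, eq_top_iff, ← Algebra.top_toSubmodule, ← hgen]
    exact h.adjoin_le_range_normalForm
  -- Equality of dimensions makes the normal form unique, so j(f) = 0 forces f ⊗ ε = 0.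
  have hfin : Module.finrank ℂ (Center G ⊗[ℂ] Module.Dual ℂ G) = Module.finrank ℂ B := by
    refine le_antisymm ?_ (LinearMap.finrank_le_finrank_of_surjective hsurj)
    rwa [Module.finrank_tensorProduct, Subspace.dual_finrank_eq]
  have hinj := (LinearMap.injective_iff_surjective_of_finrank_eq_finrank hfin).2 hsurj
  rw [injective_iff_map_eq_zero]
  intro f hf
  have h1 : f ⊗ₜ[ℂ] (counit : Module.Dual ℂ G) = 0 := hinj (by
    rw [normalForm_tmul, hf, zero_mul, map_zero])
  have h2 := congrArg ((TensorProduct.rid ℂ (Center G)).toLinearMap.comp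
    (TensorProduct.map LinearMap.id (Module.Dual.eval ℂ G 1))) h1
  simpa using h2

end Transport

/-! ### Assembly on the model space. -/

section Model

variable {I : Type*} [Fintype I] {V : I → Type*} [∀ i, NormedAddCommGroup (V i)]
  [∀ i, InnerProductSpace ℂ (V i)] [∀ i, FiniteDimensional ℂ (V i)] [∀ i, CompleteSpace (V i)]

lemma exists_model_basis {G : Type*} [Ring G] [HopfAlgebra ℂ G] [StarRing G] [StarModule ℂ G]
    {τ : ∀ i, G →⋆ₐ[ℂ] (V i →L[ℂ] V i)} {χ : I → G →ₐ[ℂ] ℂ}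
    (hdim : ∀ i, Module.finrank ℂ (V i) = 1) (hχ : ∀ i g, τ i g = χ i g • 1) :
    ∃ b : OrthonormalBasis I ℂ (ModelSpace V), ∀ a g, modelRep τ g (b a) = χ a g • b a := by
  classical
  let B : ∀ i, OrthonormalBasis (Fin 1) ℂ (V i) := fun i =>
    (stdOrthonormalBasis ℂ (V i)).reindex (finCongr (hdim i))
  let b : OrthonormalBasis I ℂ (ModelSpace V) :=
    (Pi.orthonormalBasis B).reindex (Equiv.sigmaUnique I fun _ => Fin 1)
  have hb : ∀ a, ∃ y, b a = PiLp.single 2 a y := fun a =>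
    ⟨B a default, by
      rw [OrthonormalBasis.reindex_apply, Pi.orthonormalBasis_apply]
      rfl⟩
  refine ⟨b, fun a g => ?_⟩
  obtain ⟨y, hy⟩ := hb a
  ext i
  rw [hy]
  change τ i g (PiLp.single 2 a y i) = χ a g • PiLp.single 2 a y i
  rw [hχ]
  by_cases h : i = a
  · subst h; simp
  · simp [h]

variable {G : Type u₁} [Ring G] [HopfAlgebra ℂ G] [StarRing G] [StarModule ℂ G]
  [FiniteDimensional ℂ G] [IsSemisimpleRing G] [DecidableEq I]
  {𝓡 : RibbonStructure G} {τ : ∀ i, G →⋆ₐ[ℂ] (V i →L[ℂ] V i)}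

lemma exists_rightComponent_N (hτ : IsIrrepSystem τ) (hmodular : IsUnit (sMatrix 𝓡 τ)) (g : G) :
    ∃ π : Module.Dual ℂ G, rightComponent π (𝓡.N : G ⊗[ℂ] G) = g := by
  obtain ⟨Λ, hΛ⟩ := exists_isIntegral G
  obtain ⟨π, hπ⟩ := exists_rightComponent_N_eq 𝓡 hτ hmodular hΛ
  exact 𝓡.rightComponent_N_surjective hΛ π hπ g

/-- The relations are solved on the model space by a vertex operator that creates the model space
out of the vacuum, and this solution is universal. -/
theorem exists_isVacuumSolution {F : (G ⊗[ℂ] (G ⊗[ℂ] Center G))ˣ}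
    {σ : Center G →ₐ[ℂ] G ⊗[ℂ] Center G} (hτ : IsIrrepSystem τ)
    (hmodular : IsUnit (sMatrix 𝓡 τ)) (hF : StructureRelations 𝓡 F σ) :
    ∃ (χ : I → G →ₐ[ℂ] ℂ) (b : OrthonormalBasis I ℂ (ModelSpace V))
      (j : Center G →ₐ[ℂ] ModelEnd V) (Φ : (G ⊗[ℂ] ModelEnd V)ˣ) (w₀ : ModelSpace V),
      IsVacuumSolution 𝓡 F σ χ b (modelRep τ) j Φ w₀ ∧
        IsAlgebraOfRelations.{_, u₄} F σ j Φ := by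
  have hN := exists_rightComponent_N hτ hmodular
  have hS := 𝓡.antipode_surjective (isUnit_uElt 𝓡 hτ hmodular)
  obtain ⟨Λ, hΛ⟩ := exists_isIntegral G
  obtain ⟨hdim, χ, hχ, hτχ⟩ := hτ.exists_characters (hF.mul_comm hN hS hΛ)
  obtain ⟨b, hb⟩ := exists_model_basis hdim hτχ
  have := nontrivial_of_hopf G
  have hdual : Module.finrank ℂ (Module.Dual ℂ G) = Module.finrank ℂ G := Subspace.dual_finrank_eq
  obtain ⟨j₀, Φ₀, h₀⟩ := exists_solvesRelations hF
  obtain ⟨ι₀, hmon, hcov, hcom⟩ := h₀.exists_hopfAction hF hN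
  obtain ⟨u, w₀, hw₀, hcreate, hu⟩ := exists_eigenbasis hχ hdual hΛ ι₀ Φ₀ hcov
  -- Matching the created eigenbasis with an orthonormal one of the same characters turns the action
  -- ι₀ into the diagonal action and fixes the Hilbert structure.
  let T : Module.Dual ℂ G ≃ₗ[ℂ] ModelSpace V := u.equiv b.toBasis (Equiv.refl I)
  have hT : ∀ a, T (u a) = b a := fun a => by simp [T]
  let e : Module.End ℂ (Module.Dual ℂ G) ≃ₐ[ℂ] ModelEnd V :=
    (T.conjAlgEquiv ℂ).trans (Module.End.toContinuousLinearMap (ModelSpace V))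
  have he : ∀ A x, e A (T x) = T (A x) := fun A x => congrArg (fun y => T (A y))
    (T.symm_apply_apply x)
  have hι : (e : _ →ₐ[ℂ] ModelEnd V).comp ι₀ = modelRep τ := by
    ext1 g
    refine ContinuousLinearMap.coe_injective (b.toBasis.ext fun a => ?_)
    change e (ι₀ g) (b.toBasis a) = modelRep τ g (b.toBasis a)
    rw [OrthonormalBasis.coe_toBasis, hb, ← hT, he, hu, map_smul]
  have hfin : Module.finrank ℂ (Center G) * Module.finrank ℂ G ≤
      Module.finrank ℂ (ModelEnd V) := by
    rw [← e.toLinearEquiv.finrank_eq, Module.finrank_linearMap, hdual]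
    exact Nat.mul_le_mul_right _ (Submodule.finrank_le
      (Subalgebra.toSubmodule (Center G).toSubalgebra))
  have hsol := h₀.map (e : _ →ₐ[ℂ] ModelEnd V)
  have hgen := adjoin_generators_map_eq_top (e : _ →ₐ[ℂ] ModelEnd V) e.surjective
    (h₀.adjoin_eq_top hF hN hS hΛ hdual.le)
  have : FiniteDimensional ℂ (ModelEnd V) := Module.Finite.equiv e.toLinearEquiv
  refine ⟨χ, b, _, _, T w₀, ?_, hsol.isAlgebraOfRelations hgen hfin⟩
  exact
    { relations := hF
      characters := hχ
      solves := hsol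
      injective := hsol.injective hgen hfin
      monodromy := by
        have h1 := congrArg (mapSnd (G := G) (e : _ →ₐ[ℂ] ModelEnd V)) hmon
        rw [map_mul, map_mul, mapSnd_mapSnd, mapSnd_mapSnd, hι] at h1
        exact h1
      covariance := fun ξ => by
        have h1 := congrArg (mapSnd (G := G) (e : _ →ₐ[ℂ] ModelEnd V)) (hcov ξ)
        rw [map_mul, map_mul, mapSnd_mapSnd, mapSnd_tmul, ← AlgHom.comp_apply, hι] at h1
        exact h1
      commute := fun f ξ => by
        have h1 := congrArg (e : _ →ₐ[ℂ] ModelEnd V) (hcom f ξ)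
        rw [map_mul, map_mul, ← AlgHom.comp_apply, hι] at h1
        exact h1
      apply_basis := hb
      apply_vacuum := fun g => by
        rw [← hι]
        change e (ι₀ g) (T w₀) = _
        rw [he, hw₀, map_smul]
      create := fun a => by
        have h1 : evalFirst (χ a) (mapSnd (e : _ →ₐ[ℂ] ModelEnd V)
            (Φ₀ : G ⊗[ℂ] Module.End ℂ (Module.Dual ℂ G))) = e (evalFirst (χ a)
            (Φ₀ : G ⊗[ℂ] Module.End ℂ (Module.Dual ℂ G))) := evalFirst_mapSnd _ _ _
        change evalFirst (χ a) (mapSnd (e : _ →ₐ[ℂ] ModelEnd V)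
            (Φ₀ : G ⊗[ℂ] Module.End ℂ (Module.Dual ℂ G))) (T w₀) = b a
        rw [h1, he, hcreate, hT] }

end Model

end VertexOp

end

theorem proposition2
    {G : Type u₁} [Ring G] [HopfAlgebra ℂ G] [StarRing G] [StarModule ℂ G]
    [FiniteDimensional ℂ G] [IsSemisimpleRing G]
    (𝓡 : VertexOp.RibbonStructure G)
    {I : Type u₂} [Fintype I] [DecidableEq I] {V : I → Type u₃}
    [∀ i, NormedAddCommGroup (V i)] [∀ i, InnerProductSpace ℂ (V i)]
    [∀ i, FiniteDimensional ℂ (V i)] [∀ i, CompleteSpace (V i)]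
    (τ : ∀ i, G →⋆ₐ[ℂ] (V i →L[ℂ] V i)) (hτ : VertexOp.IsIrrepSystem τ)
    (hmodular : IsUnit (VertexOp.sMatrix 𝓡 τ))
    (F : (G ⊗[ℂ] (G ⊗[ℂ] VertexOp.Center G))ˣ)
    (σ : VertexOp.Center G →ₐ[ℂ] G ⊗[ℂ] VertexOp.Center G)
    (hFσ : VertexOp.StructureRelations 𝓡 F σ) :
    ∃ (j : VertexOp.Center G →⋆ₐ[ℂ] VertexOp.ModelEnd V)
      (Φ : (G ⊗[ℂ] VertexOp.ModelEnd V)ˣ),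
      Function.Injective j ∧
      Set.range j = VertexOp.modelRep τ '' (VertexOp.Center G : Set G) ∧
      j (𝓡.vC : VertexOp.Center G) = VertexOp.modelRep τ (𝓡.v : G) ∧
      VertexOp.IsVertexOperator 𝓡 τ Φ ∧
      VertexOp.IsAlgebraOfRelations.{u₁, u₄} F σ j.toAlgHom Φ ∧
      (Φ : G ⊗[ℂ] VertexOp.ModelEnd V) *
          VertexOp.mapSnd (VertexOp.modelRep τ) (𝓡.N : G ⊗[ℂ] G) =
        VertexOp.mapSnd j.toAlgHom (VertexOp.structD 𝓡 σ : G ⊗[ℂ] VertexOp.Center G) *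
          (Φ : G ⊗[ℂ] VertexOp.ModelEnd V) := by
  obtain ⟨χ, b, j₀, Φ, w₀, h, hrel⟩ :=
    VertexOp.exists_isVacuumSolution.{u₁, u₄} hτ hmodular hFσ
  let j : VertexOp.Center G →⋆ₐ[ℂ] VertexOp.ModelEnd V :=
    { j₀ with map_star' := fun f => (h.star_embedding f).symm }
  have hstar : star (Φ : G ⊗[ℂ] VertexOp.ModelEnd V) =
      VertexOp.mapSnd (VertexOp.modelRep τ) ((𝓡.S⁻¹ : (G ⊗[ℂ] G)ˣ) : G ⊗[ℂ] G) *
        ((Φ⁻¹ : (G ⊗[ℂ] VertexOp.ModelEnd V)ˣ) : G ⊗[ℂ] VertexOp.ModelEnd V) := by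
    -- As S = 1, the generalized unitarity is ordinary unitarity of Φ.
    rw [h.characters.S_eq_one h.relations, inv_one, Units.val_one, map_one, one_mul, h.star_eq_inv]
  exact ⟨j, Φ, h.injective, h.range_embedding,
    h.embedding_vC (VertexOp.exists_rightComponent_N hτ hmodular),
    ⟨h.covariance, hstar, hstar.trans (VertexOp.mapSnd_inv_S_mul_inv 𝓡 _ Φ h.covariance)⟩,
    hrel, h.monodromy⟩
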